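/- Let $A$ be an associative ring with $1$ and an involution $a\mapsto\bar a$. Modules are left $A$-modules. The dual $M^*=\mathrm{Hom}_A(M,A)$ has the action $(af)(x)=f(x)\bar a$, a morphism $\phi:M\to N^*$ is regarded as a pairing $\phi(x)(y)$ with $\phi(ax)(by)=b\,\phi(x)(y)\,\bar a$, and its dual $\phi^*:N\to M^*$ is $\phi^*(y)(x)=\overline{\phi(x)(y)}$. For a chain complex $C$ write $C^p=(C_p)^*$; $C^{m-*}$ is the complex with $C^{m-r}$ in degree $r$ and differential $(-1)^rd^*$. **Hyperquadratic chains.** For a complex $C$ an $m$-chain of $\widehat W^{\%}C$ is a family $\theta=\{\theta_s\in\mathrm{Hom}_A(C^{p},C_{q})\mid p+q=m+s,\ s\in\mathbb Z\}$, with $(d\theta)_s=d\theta_s+(-1)^q\theta_sd^*+(-1)^{m+s-1}(\theta_{s-1}+(-1)^sT\theta_{s-1}):C^p\to C_q$, where $T\phi=(-1)^{pq}\phi^*$. The chains of $W^{\%}C$ are the families with $\theta_s=0$ for $s<0$; $J:W^{\%}C\to\widehat W^{\%}C$ is the inclusion. A chain map $f$ induces $f^{\%}$, $\theta_s\mapsto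 f\theta_sf^*$. A chain homotopy $h:f\simeq f'$ induces a chain homotopy $(h;f,f')^{\%}:f^{\%}\simeq f'^{\%}$, which for a chain homotopy given dually by maps $h$ with $f'^*-f^*=dh+hd$ is defined on $m$-chains $\sigma$ by $(x,y)\mapsto\sigma_s(f^*x)(hy)+(-1)^q\sigma_s(hx)(f'^*y)+(-1)^{m-1+q}(T\sigma_{s-1})(hx)(hy)$ for $x,y$ of degrees $p,q$. **Chain bundles.** A chain bundle $(B,\beta)$ is an $A$-module chain complex $B$ together with a family of morphisms $\beta_s:B_i\to B^{j}$ $(i+j=-s)$ such that $$(-1)^{j+1}d^*\beta_s+(-1)^s\beta_sd+(-1)^{s-1}\bigl(\beta_{s-1}+(-1)^sT\beta_{s-1}\bigr)=0:B_i\to B^j .$$ **The groups $L\langle B,\beta\rangle^{2n}(A)$.** A $2n$-dimensional symmetric $(B,\beta)$-structure $(\phi,\theta,f)$ on $C$ consists of a $2n$-cycle $\phi$ of $W^{\%}C$, a chain map $f:B^{2n-*}\to C$, given by its dual $f^*:C^{2n-*}\to B$, and a $(2n+1)$-chain $\theta$ of $\widehat W^{\%}C$ with $J(\phi)-f^{\%}(S^{2n}\beta)=d\theta$,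 where $(S^{2n}\beta)_s=\beta_{s-2n}$. The pullback $f^{\%}(S^{2n}\beta)$ is formed by the pairings $\beta_{s-2n}(f^*x)(f^*y)$. Structures on $C$ are added by $(\phi,\theta,f)+(\phi',\theta',f')=(\phi+\phi',\theta+\theta'+[f,f'](S^{2n}\beta),f+f')$, where $[f,f'](\sigma)_s=-T(f'\sigma_{s+1}f^*)$. An equivalence $(\phi,\theta,f)\to(\phi',\theta',f')$ consists of $\xi\in W^{\%}C$ with $\phi'-\phi=d\xi$, a chain homotopy $h:f\simeq f'$, and $\eta\in\widehat W^{\%}C$ with $J(\xi)-(h;f,f')^{\%}(S^{2n}\beta)-\theta'+\theta=d\eta$. A $2n$-dimensional symmetric $(B,\beta)$-structure Poincaré complex $(C,\phi,\theta,f)$ is a complex $C$ of f.g. projective modules with $C_r=0$ unless $0\le r\le 2n$, with such a structure for which $\phi_0:C^{2n-*}\to C$ is a chain equivalence. It is a boundary if there are a complex $D$ of f.g. projective modules with $D_r=0$ unless $0\le r\le 2n+1$, a chain map $i:C\to D$ and an equivalence $(\delta\phi,\delta\theta,\delta f)$ from $i_*(\phi,\theta,f)$ to $0$ such that $(\delta\phi_0,\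 (-1)^{r-1}\phi_0i^*):D^{2n+1-r}\to D_r\oplus C_{r-1}$ is a chain equivalence from $D^{2n+1-*}$ to the mapping cone of $i$. $(C,\phi,\theta,f)$ and $(C',\phi',\theta',f')$ are cobordant if $(C,\phi,\theta,f)\oplus-(C',\phi',\theta',f')$ is a boundary. $L\langle B,\beta\rangle^{2n}(A)$ is the group of cobordism classes, with addition by direct sum. **Forms and Witt groups.** Let $\epsilon=\pm1$. Let $Q$ be an $A$-group, that is, an abelian group on which the multiplicative monoid of $A$ acts by additive maps, with $A$-equivariant homomorphisms $s:A/\{b-\epsilon\bar b\}\to Q$ and $r:Q\to\{a\in A\mid\epsilon\bar a=a\}$ such that $rs(b)=b+\epsilon\bar b$ ($A$ acts on source and target by $(a,b)\mapsto ab\bar a$). A nonsingular $Q$-quadratic form $(M,\lambda,\mu)$ is a f.g. projective $A$-module $M$ with an isomorphism $\lambda=\epsilon\lambda^*:M\to M^*$ and a map $\mu:M\to Q$ such that $\mu(ax)=a\mu(x)$, $r(\mu(x))=\lambda(x)(x)$ and $\mu(x+y)-\mu(x)-\mu(y)=s(\lambda(x)(y))$. It is hyperbolic if there is a direct summand $j:L\subset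 M$ with $\mu j=0$ and $0\to L\xrightarrow{\,j\,}M\xrightarrow{\,j^*\lambda\,}L^*\to0$ exact. The Witt group $W_Q(A)$ is the abelian group, under direct sum, of nonsingular $Q$-quadratic forms modulo the relation $F\sim F'$ if $F\oplus H\cong F'\oplus H'$ for some hyperbolic $H,H'$. **The groups $Q(n)$.** Let $Q(n)=Q\langle B,\beta\rangle^{2n}(S^nA)=\{(a,b)\in A\oplus B_n\mid db=0\}/\!\sim$, where $(a,b)\sim(a',b')$ if there are $(x,y)\in A\oplus B_{n+1}$ with $b'-b=dy$ and $$a'-a=x-(-1)^n\bar x-(-1)^n\beta_{-2n-1}(b)(y)-\beta_{-2n-1}(y)(b')-(-1)^n\beta_{-2n-2}(y)(y),$$ with $(a,b)+(a',b')=(a+a'-\beta_{-2n}(b)(b'),\,b+b')$, $c(a,b)=(ca\bar c,cb)$, $s(a)=(a,0)$, $r(a,b)=a+(-1)^n\bar a+\beta_{-2n}(b)(b)$ and $\epsilon=(-1)^n$. **Theorem.** Let $(B,\beta)$ be any chain bundle over $A$. Direct sum makes $W_{Q(n)}(A)$ and $L\langle B,\beta\rangle^{2n}(A)$ into abelian groups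 for all $n\ge0$, and there are morphisms of abelian groups $$W_{Q(n)}(A)\to L\langle B,\beta\rangle^{2n}(A);\quad (M,\lambda,\mu)\mapsto(C,\phi,\theta,f)\qquad(n\ge0)$$ which send $(M,\lambda,\mu)$ to the class of any $2n$-dimensional symmetric $(B,\beta)$-structure Poincaré complex with $C_r=0$ for $r\ne n$, $C^n=M$, $\phi_0=\lambda$ and $v_n(\phi,\theta,f)=\mu$ (such complexes exist), where $v_n(\phi,\theta,f):H^n(C)\to Q(n);\ x\mapsto(\theta_{-1}(x)(x),f^*(x))$. (1) For every ring with involution $A$ the morphism for $n=0$ is an isomorphism: $L\langle B,\beta\rangle^0(A)=W_{Q(0)}(A)$. (2) If $A$ is a field (with any involution), then for every $n\ge0$ the morphism is a split injection, split by the morphism $L\langle B,\beta\rangle^{2n}(A)\to W_{Q(n)}(A);\ (C,\phi,\theta,f)\mapsto(H^n(C),\phi_0,v_n(\phi,\theta,f))$. -/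

import Mathlib

open CategoryTheory

universe u

namespace ChainBundleL

section Duality

/-- The dual `M^* = Hom_A(M, A)` of a left `A`-module. -/
def InvDual (A : Type u) [Ring A] (M : Type u) [AddCommGroup M] [Module A M] : Type u :=
  M →ₗ[A] A

variable {A : Type u} [Ring A] {M N M' N' : Type u}
  [AddCommGroup M] [Module A M] [AddCommGroup N] [Module A N]
  [AddCommGroup M'] [Module A M'] [AddCommGroup N'] [Module A N']

instance : AddCommGroup (InvDual A M) := inferInstanceAs (AddCommGroup (M →ₗ[A] A))

instance : FunLike (InvDual A M) M A := inferInstanceAs (FunLike (M →ₗ[A] A) M A)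

instance : LinearMapClass (InvDual A M) A M A :=
  inferInstanceAs (LinearMapClass (M →ₗ[A] A) A M A)

@[ext] theorem InvDual.ext {f g : InvDual A M} (h : ∀ x, f x = g x) : f = g :=
  LinearMap.ext h

@[simp] theorem InvDual.add_apply (f g : InvDual A M) (x : M) : (f + g) x = f x + g x := rfl
@[simp] theorem InvDual.sub_apply (f g : InvDual A M) (x : M) : (f - g) x = f x - g x := rfl
@[simp] theorem InvDual.neg_apply (f : InvDual A M) (x : M) : (-f) x = -(f x) := rfl
@[simp] theorem InvDual.zero_apply (x : M) : (0 : InvDual A M) x = 0 := rfl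

variable [StarRing A]

/-- `A` acts on `M^*` by `(a f)(x) = f(x) ā`. -/
instance : Module A (InvDual A M) where
  smul a f :=
    { toFun := fun x => f x * star a
      map_add' := fun x y => by rw [map_add, add_mul]
      map_smul' := fun b x => by simp [mul_assoc] }
  one_smul f := InvDual.ext fun x => show f x * star (1 : A) = f x by simp
  mul_smul a b f := InvDual.ext fun x =>
    show f x * star (a * b) = f x * star b * star a by rw [star_mul, mul_assoc]
  smul_zero a := InvDual.ext fun x => show (0 : A) * star a = 0 by simp
  smul_add a f g := InvDual.ext fun x =>
    show (f x + g x) * star a = f x * star a + g x * star a by rw [add_mul]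
  add_smul a b f := InvDual.ext fun x =>
    show f x * star (a + b) = f x * star a + f x * star b by rw [star_add, mul_add]
  zero_smul f := InvDual.ext fun x => show f x * star (0 : A) = 0 by simp

@[simp] theorem InvDual.smul_apply (a : A) (f : InvDual A M) (x : M) :
    (a • f) x = f x * star a := rfl

/-- The dual `f^* : N^* → M^*`, `g ↦ g ∘ f`, of `f : M → N`. -/
def dualMap (f : M →ₗ[A] N) : InvDual A N →ₗ[A] InvDual A M where
  toFun g := LinearMap.comp (show N →ₗ[A] A from g) f
  map_add' _ _ := rfl
  map_smul' _ _ := rfl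

@[simp] theorem dualMap_apply (f : M →ₗ[A] N) (g : InvDual A N) (x : M) :
    dualMap f g x = g (f x) := rfl

/-- A morphism `φ : M → N^*` is the same as a pairing `φ(x, y) = φ(x)(y)` with
`φ(a x, b y) = b φ(x, y) ā`.  Its dual `φ^* : N = N^** → M^*` is `φ^*(y)(x) = star (φ(x)(y))`. -/
def transpose (φ : M →ₗ[A] InvDual A N) : N →ₗ[A] InvDual A M where
  toFun y :=
    { toFun := fun x => star (φ x y)
      map_add' := fun x x' => by simp
      map_smul' := fun a x => by simp }
  map_add' y y' := InvDual.ext fun x => show star (φ x (y + y')) = star (φ x y) + star (φ x y') by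
    rw [map_add, star_add]
  map_smul' b y := InvDual.ext fun x => show star (φ x (b • y)) = star (φ x y) * star b by
    rw [map_smul, smul_eq_mul, star_mul]

@[simp] theorem transpose_apply (φ : M →ₗ[A] InvDual A N) (x : M) (y : N) :
    transpose φ y x = star (φ x y) := rfl

/-- The pairing `(x, y) ↦ φ(a x, b y)`, i.e. the morphism `b^* φ a`. -/
def pullPair (φ : M →ₗ[A] InvDual A N) (a : M' →ₗ[A] M) (b : N' →ₗ[A] N) :
    M' →ₗ[A] InvDual A N' :=
  dualMap b ∘ₗ φ ∘ₗ a

@[simp] theorem pullPair_apply (φ : M →ₗ[A] InvDual A N) (a : M' →ₗ[A] M) (b : N' →ₗ[A] N)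
    (x : M') (y : N') : pullPair φ a b x y = φ (a x) (b y) := rfl

end Duality

/-- A chain bundle `(B, β)`: an `A`-module chain complex `B` with a `0`-dimensional
hyperquadratic structure on `B^{0-*}`, that is morphisms `β_s : B_i → B^j` (`i + j = -s`), or
pairings `β_s(x)(y)`, subject to the cycle condition
`(-1)^{j+1} d^* β_s + (-1)^s β_s d + (-1)^{s-1} (β_{s-1} + (-1)^s T β_{s-1}) = 0 : B_i → B^j`.
The complex `B` is arbitrary: it may be finite-dimensional, or infinite-dimensional as is the
case for universal chain bundles. -/
structure ChainBundle (A : Type u) [Ring A] [StarRing A] where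
  B : ChainComplex (ModuleCat.{u} A) ℤ
  β : ∀ s i j : ℤ, B.X i →ₗ[A] InvDual A (B.X j)
  β_deg : ∀ s i j : ℤ, i + j ≠ -s → β s i j = 0
  cycle : ∀ (s i j : ℤ) (x : B.X i) (y : B.X j),
    (j + 1).negOnePow • β s i (j - 1) x (B.d j (j - 1) y)
      + s.negOnePow • β s (i - 1) j (B.d i (i - 1) x) y
      + (s - 1).negOnePow • (β (s - 1) i j x y
          + s.negOnePow • (i * j).negOnePow • star (β (s - 1) j i y x)) = 0

/-! ### `Q`-groups and quadratic forms -/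

/-- An `A`-group `Q` with `A`-morphisms `r : Q → H^0(ℤ₂; A, ε)` and
`s : H_0(ℤ₂; A, ε) → Q` such that `r s = 1 + T_ε`.  (An `A`-group is exactly an abelian group
with a `DistribMulAction` of `A`.  The morphism `s` is given on representatives in `A`, and
`r` as a map to `A`.) -/
structure QGroup (A : Type u) [Ring A] [StarRing A] (ε : ℤˣ) where
  carrier : Type u
  [grp : AddCommGroup carrier]
  [act : DistribMulAction A carrier]
  r : carrier →+ A
  s : A →+ carrier
  r_symm : ∀ q, ε • star (r q) = r q
  r_smul : ∀ (a : A) q, r (a • q) = a * r q * star a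
  s_symm : ∀ b : A, s (b - ε • star b) = 0
  s_smul : ∀ a b : A, s (a * b * star a) = a • s b
  r_s : ∀ b : A, r (s b) = b + ε • star b

attribute [instance] QGroup.grp QGroup.act

section Qn

variable {A : Type u} [Ring A] [StarRing A] (β : ChainBundle A) (n : ℤ)

/-- Pairs `(a, b)` with `a ∈ A` and `b ∈ B_n`, `db = 0`. -/
@[ext] structure QPair where
  a : A
  b : β.B.X n
  db : β.B.d n (n - 1) b = 0

/-- `(a, b) ∼ (a', b')` if there are `x ∈ A`, `y ∈ B_{n+1}` with `b' - b = dy` and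
`a' - a = x - (-1)^n x̄ - (-1)^n β_{-2n-1}(b)(y) - β_{-2n-1}(y)(b') - (-1)^n β_{-2n-2}(y)(y)`. -/
def QPair.Rel {β : ChainBundle A} {n : ℤ} (p q : QPair β n) : Prop :=
  ∃ (x : A) (y : β.B.X (n + 1)),
    q.b - p.b = β.B.d (n + 1) n y ∧
    q.a - p.a = x - n.negOnePow • star x
      - n.negOnePow • β.β (-2 * n - 1) n (n + 1) p.b y
      - β.β (-2 * n - 1) (n + 1) n y q.b
      - n.negOnePow • β.β (-2 * n - 2) (n + 1) (n + 1) y y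

variable {β n}

theorem cyc0 (w w' : β.B.X n) (hw : β.B.d n (n - 1) w = 0) (hw' : β.B.d n (n - 1) w' = 0) :
    β.β (-2 * n) n n w w' = n.negOnePow • star (β.β (-2 * n) n n w' w) := by
  have h := β.cycle (-2 * n + 1) n n w w'
  rw [hw, hw', add_sub_cancel_right] at h
  have e1 : (-2 * n + 1).negOnePow = -1 := Int.negOnePow_odd _ ⟨-n, by ring⟩
  have e2 : (-2 * n).negOnePow = 1 := Int.negOnePow_even _ ⟨-n, by ring⟩
  rw [e1, e2, Int.negOnePow_mul_self] at h
  simp only [map_zero, InvDual.zero_apply, smul_zero, one_smul, zero_add] at h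
  rw [Units.neg_smul, one_smul, ← sub_eq_add_neg, sub_eq_zero] at h
  exact h

theorem cyc1 (y : β.B.X (n + 1)) (w : β.B.X n) (hw : β.B.d n (n - 1) w = 0) :
    β.β (-2 * n) n n (β.B.d (n + 1) n y) w
      = β.β (-2 * n - 1) (n + 1) n y w + star (β.β (-2 * n - 1) n (n + 1) w y) := by
  have h := β.cycle (-2 * n) (n + 1) n y w
  have e1 : (-2 * n - 1).negOnePow = -1 := Int.negOnePow_odd _ ⟨-n - 1, by ring⟩
  have e2 : (-2 * n).negOnePow = 1 := Int.negOnePow_even _ ⟨-n, by ring⟩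
  have e3 : ((n + 1) * n).negOnePow = 1 :=
    Int.negOnePow_even _ (by rw [mul_comm]; exact Int.even_mul_succ_self n)
  rw [hw, e1, e2, e3] at h
  simp only [map_zero, smul_zero, one_smul, zero_add] at h
  rw [Units.neg_smul, one_smul, ← sub_eq_add_neg, sub_eq_zero] at h
  have key : ∀ k, k = n → β.β (-2 * n) k n (β.B.d (n + 1) k y) w
      = β.β (-2 * n) n n (β.B.d (n + 1) n y) w := by rintro k rfl; rfl
  rw [← key (n + 1 - 1) (by ring), h]

theorem cyc2 (x y : β.B.X (n + 1)) :
    β.β (-2 * n - 1) (n + 1) n x (β.B.d (n + 1) n y)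
      - n.negOnePow • β.β (-2 * n - 1) n (n + 1) (β.B.d (n + 1) n x) y
      = - n.negOnePow • β.β (-2 * n - 2) (n + 1) (n + 1) x y
        - star (β.β (-2 * n - 2) (n + 1) (n + 1) y x) := by
  have h := β.cycle (-2 * n - 1) (n + 1) (n + 1) x y
  have e1 : (-2 * n - 1).negOnePow = -1 := Int.negOnePow_odd _ ⟨-n - 1, by ring⟩
  have e2 : (-2 * n - 1 - 1).negOnePow = 1 := Int.negOnePow_even _ ⟨-n - 1, by ring⟩
  have e3 : ((n + 1) * (n + 1)).negOnePow = - n.negOnePow := by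
    rw [Int.negOnePow_mul_self, Int.negOnePow_succ]
  have e4 : (n + 1 + 1).negOnePow = n.negOnePow := by
    rw [Int.negOnePow_succ, Int.negOnePow_succ, neg_neg]
  have e5 : -2 * n - 1 - 1 = -2 * n - 2 := by ring
  rw [e1, e2, e3, e4, e5] at h
  have key : ∀ k, k = n → β.β (-2 * n - 1) k (n + 1) (β.B.d (n + 1) k x) y
      = β.β (-2 * n - 1) n (n + 1) (β.B.d (n + 1) n x) y := by rintro k rfl; rfl
  have key' : ∀ k, k = n → β.β (-2 * n - 1) (n + 1) k x (β.B.d (n + 1) k y)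
      = β.β (-2 * n - 1) (n + 1) n x (β.B.d (n + 1) n y) := by rintro k rfl; rfl
  rw [key _ (by ring), key' _ (by ring)] at h
  rcases Int.even_or_odd n with hn | hn
  · rw [Int.negOnePow_even _ hn] at h ⊢
    simp only [one_smul, Units.neg_smul] at h ⊢
    rw [← sub_eq_zero, ← h]; abel
  · rw [Int.negOnePow_odd _ hn] at h ⊢
    simp only [one_smul, Units.neg_smul, neg_neg] at h ⊢
    rw [← sub_eq_zero, ← neg_eq_zero, ← h]; abel

/-- The subgroup `{x - (-1)^n x̄}` of `A`. -/
def skew (A : Type u) [Ring A] [StarRing A] (n : ℤ) : AddSubgroup A where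
  carrier := {c | ∃ x : A, c = x - n.negOnePow • star x}
  add_mem' := by
    rintro _ _ ⟨x, rfl⟩ ⟨y, rfl⟩
    exact ⟨x + y, by rw [star_add, smul_add]; abel⟩
  zero_mem' := ⟨0, by simp⟩
  neg_mem' := by
    rintro _ ⟨x, rfl⟩
    exact ⟨-x, by rw [star_neg, smul_neg]; abel⟩

theorem star_star_units (e : ℤˣ) (c : A) : star (e • c) = e • star c := by
  rcases Int.units_eq_one_or e with rfl | rfl <;> simp

theorem sub_skew (c : A) : c - n.negOnePow • star c ∈ skew A n := ⟨c, rfl⟩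

theorem skew_sub (c : A) : n.negOnePow • c - star c ∈ skew A n :=
  ⟨n.negOnePow • c, by rw [star_star_units, smul_smul, Int.units_mul_self, one_smul]⟩

/-- The correction term of the equivalence relation. -/
def corr (b b' : β.B.X n) (y : β.B.X (n + 1)) : A :=
  n.negOnePow • β.β (-2 * n - 1) n (n + 1) b y + β.β (-2 * n - 1) (n + 1) n y b'
    + n.negOnePow • β.β (-2 * n - 2) (n + 1) (n + 1) y y

theorem rel_iff (p q : QPair β n) : p.Rel q ↔ ∃ y : β.B.X (n + 1),
    q.b - p.b = β.B.d (n + 1) n y ∧ q.a - p.a + corr p.b q.b y ∈ skew A n := by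
  constructor
  · rintro ⟨x, y, h, h'⟩
    refine ⟨y, h, x, ?_⟩
    rw [h', corr]; abel
  · rintro ⟨y, h, x, h'⟩
    refine ⟨x, y, h, ?_⟩
    rw [← h', corr]; abel

theorem QPair.equivalence : Equivalence (QPair.Rel (β := β) (n := n)) where
  refl p := ⟨0, 0, by simp, by simp⟩
  symm := by
    intro p q h
    rw [rel_iff] at h ⊢
    obtain ⟨y, h, h'⟩ := h
    refine ⟨-y, by rw [map_neg, ← h]; abel, ?_⟩
    have h2 := cyc2 y y
    rw [← h] at h2
    have := (skew A n).add_mem ((skew A n).neg_mem h')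
      (skew_sub (n := n) (β.β (-2 * n - 2) (n + 1) (n + 1) y y))
    convert this using 1
    simp only [corr, map_neg, InvDual.neg_apply, LinearMap.neg_apply, map_sub, InvDual.sub_apply,
      LinearMap.sub_apply, smul_neg, smul_sub, neg_neg] at h2 ⊢
    rw [← sub_eq_zero] at h2 ⊢
    rw [← h2, Units.neg_smul]
    abel
  trans := by
    intro p q r h k
    rw [rel_iff] at h k ⊢
    obtain ⟨y, h, h'⟩ := h
    obtain ⟨z, k, k'⟩ := k
    refine ⟨y + z, by rw [map_add, ← h, ← k]; abel, ?_⟩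
    have h2 := cyc2 y z
    rw [← h, ← k] at h2
    have := (skew A n).add_mem ((skew A n).add_mem h' k')
      (skew_sub (n := n) (β.β (-2 * n - 2) (n + 1) (n + 1) z y))
    convert this using 1
    simp only [corr, map_add, InvDual.add_apply, LinearMap.add_apply, map_sub, InvDual.sub_apply,
      LinearMap.sub_apply, smul_add, smul_sub, neg_neg] at h2 ⊢
    rw [← sub_eq_zero] at h2 ⊢
    rw [← h2, Units.neg_smul]
    abel

/-- The equivalence relation on pairs. -/
instance QPair.setoid (β : ChainBundle A) (n : ℤ) : Setoid (QPair β n) :=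
  ⟨QPair.Rel, QPair.equivalence⟩

/-- Addition `(a, b) + (a', b') = (a + a' - β_{-2n}(b)(b'), b + b')`. -/
instance : Add (QPair β n) :=
  ⟨fun p q => ⟨p.a + q.a - β.β (-2 * n) n n p.b q.b, p.b + q.b, by
    rw [map_add, p.db, q.db, add_zero]⟩⟩

instance : Zero (QPair β n) := ⟨⟨0, 0, by simp⟩⟩

instance : Neg (QPair β n) :=
  ⟨fun p => ⟨-p.a - β.β (-2 * n) n n p.b p.b, -p.b, by rw [map_neg, p.db, neg_zero]⟩⟩

/-- The action `c (a, b) = (c a c̄, c b)`. -/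
instance : SMul A (QPair β n) :=
  ⟨fun c p => ⟨c * p.a * star c, c • p.b, by rw [map_smul, p.db, smul_zero]⟩⟩

theorem QPair.add_a (p q : QPair β n) : (p + q).a = p.a + q.a - β.β (-2 * n) n n p.b q.b := rfl
theorem QPair.add_b (p q : QPair β n) : (p + q).b = p.b + q.b := rfl
theorem QPair.neg_a (p : QPair β n) : (-p).a = -p.a - β.β (-2 * n) n n p.b p.b := rfl
theorem QPair.neg_b (p : QPair β n) : (-p).b = -p.b := rfl
theorem QPair.smul_a (c : A) (p : QPair β n) : (c • p).a = c * p.a * star c := rfl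
theorem QPair.smul_b (c : A) (p : QPair β n) : (c • p).b = c • p.b := rfl
theorem QPair.zero_a : (0 : QPair β n).a = 0 := rfl
theorem QPair.zero_b : (0 : QPair β n).b = 0 := rfl

theorem QPair.add_assoc' (p q r : QPair β n) : p + q + r = p + (q + r) := by
  ext
  · simp only [QPair.add_a, QPair.add_b, map_add, InvDual.add_apply, LinearMap.add_apply]; abel
  · simp only [QPair.add_b]; abel

theorem QPair.zero_add' (p : QPair β n) : 0 + p = p := by
  ext <;> simp [QPair.add_a, QPair.add_b, QPair.zero_a, QPair.zero_b]

theorem QPair.add_zero' (p : QPair β n) : p + 0 = p := by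
  ext <;> simp [QPair.add_a, QPair.add_b, QPair.zero_a, QPair.zero_b]

theorem QPair.neg_add' (p : QPair β n) : -p + p = 0 := by
  ext
  · simp only [QPair.add_a, QPair.neg_a, QPair.neg_b, map_neg, LinearMap.neg_apply,
      InvDual.neg_apply, QPair.zero_a]
    abel
  · simp [QPair.add_b, QPair.neg_b, QPair.zero_b]

theorem QPair.add_neg' (p : QPair β n) : p + -p = 0 := by
  ext
  · simp only [QPair.add_a, QPair.neg_a, QPair.neg_b, map_neg, InvDual.neg_apply, QPair.zero_a]
    abel
  · simp [QPair.add_b, QPair.neg_b, QPair.zero_b]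

theorem QPair.add_comm_rel (p q : QPair β n) : (p + q).Rel (q + p) := by
  rw [rel_iff]
  refine ⟨0, by simp [QPair.add_b, add_comm], ?_⟩
  have h := cyc0 p.b q.b p.db q.db
  have := (skew A n).neg_mem (sub_skew (n := n) (β.β (-2 * n) n n q.b p.b))
  convert this using 1
  rw [QPair.add_a, QPair.add_a, h]
  simp [corr]
  abel

theorem QPair.add_rel_right (p q r : QPair β n) (h : p.Rel q) : (p + r).Rel (q + r) := by
  rw [rel_iff] at h ⊢
  obtain ⟨y, h, h'⟩ := h
  refine ⟨y, by rw [← h, QPair.add_b, QPair.add_b]; abel, ?_⟩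
  have h1 := cyc1 y r.b r.db
  rw [← h] at h1
  have := (skew A n).add_mem h'
    (skew_sub (n := n) (β.β (-2 * n - 1) n (n + 1) r.b y))
  convert this using 1
  simp only [QPair.add_a, QPair.add_b, corr, map_add, InvDual.add_apply, LinearMap.add_apply,
    map_sub, InvDual.sub_apply, LinearMap.sub_apply, smul_add, smul_sub] at h1 ⊢
  rw [← sub_eq_zero] at h1 ⊢
  rw [← neg_eq_zero, ← h1]
  abel

theorem QPair.add_rel (p q p' q' : QPair β n) (h : p.Rel p') (k : q.Rel q') :
    (p + q).Rel (p' + q') :=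
  equivalence.trans (add_rel_right _ _ _ h) (equivalence.trans (add_comm_rel _ _)
    (equivalence.trans (add_rel_right _ _ _ k) (add_comm_rel _ _)))

theorem QPair.smul_rel (c : A) (p q : QPair β n) (h : p.Rel q) : (c • p).Rel (c • q) := by
  obtain ⟨x, y, h, h'⟩ := h
  refine ⟨c * x * star c, c • y, by rw [smul_b, smul_b, ← smul_sub, h, map_smul], ?_⟩
  rw [smul_a, smul_a, smul_b, smul_b, ← sub_mul, ← mul_sub, h']
  rcases Int.units_eq_one_or n.negOnePow with e | e <;> rw [e] <;>
    simp only [map_smul, LinearMap.smul_apply, InvDual.smul_apply, smul_eq_mul, star_mul,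
      star_star, one_smul, Units.neg_smul, mul_sub, sub_mul, mul_add, add_mul, mul_assoc, mul_neg,
      neg_mul, sub_neg_eq_add]

variable (β n) in
/-- The group `Q(n) = Q⟨B, β⟩^{2n}(S^n A)`. -/
def Qn : Type u := Quotient (QPair.setoid β n)

/-- The class of a pair in `Q(n)`. -/
def Qn.mk (a : A) (b : β.B.X n) (db : β.B.d n (n - 1) b = 0) : Qn β n :=
  Quotient.mk _ ⟨a, b, db⟩

instance : Add (Qn β n) :=
  ⟨Quotient.map₂ (· + ·) fun p p' h q q' k => QPair.add_rel p q p' q' h k⟩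

instance : Zero (Qn β n) := ⟨Quotient.mk _ 0⟩

instance : Neg (Qn β n) :=
  ⟨Quotient.map (- ·) fun p q h => by
    have h1 := QPair.add_rel _ _ _ _ (QPair.equivalence.refl (-p)) (QPair.equivalence.symm h)
    have h2 := QPair.add_rel _ _ _ _ h1 (QPair.equivalence.refl (-q))
    rw [QPair.add_assoc', QPair.add_neg', QPair.add_zero', QPair.neg_add', QPair.zero_add'] at h2
    exact h2⟩

instance : AddCommGroup (Qn β n) where
  add_assoc := by
    rintro ⟨p⟩ ⟨q⟩ ⟨r⟩
    exact congrArg (Quotient.mk _) (QPair.add_assoc' p q r)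
  add_comm := by
    rintro ⟨p⟩ ⟨q⟩
    exact Quotient.sound (QPair.add_comm_rel p q)
  zero_add := by
    rintro ⟨p⟩
    exact congrArg (Quotient.mk _) (QPair.zero_add' p)
  add_zero := by
    rintro ⟨p⟩
    exact congrArg (Quotient.mk _) (QPair.add_zero' p)
  neg_add_cancel := by
    rintro ⟨p⟩
    exact congrArg (Quotient.mk _) (QPair.neg_add' p)
  nsmul := nsmulRec
  zsmul := zsmulRec

instance : DistribMulAction A (Qn β n) where
  smul c := Quotient.map (c • ·) fun p q h => QPair.smul_rel c p q h
  one_smul := by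
    rintro ⟨p⟩
    refine congrArg (Quotient.mk _) (QPair.ext ?_ ?_)
    · simp [QPair.smul_a]
    · simp [QPair.smul_b]
  mul_smul := by
    rintro c d ⟨p⟩
    refine congrArg (Quotient.mk _) (QPair.ext ?_ ?_)
    · simp [QPair.smul_a, mul_assoc]
    · simp [QPair.smul_b, mul_smul]
  smul_zero c := by
    refine congrArg (Quotient.mk _) (QPair.ext ?_ ?_)
    · simp [QPair.smul_a, QPair.zero_a]
    · simp [QPair.smul_b, QPair.zero_b]
  smul_add := by
    rintro c ⟨p⟩ ⟨q⟩
    refine congrArg (Quotient.mk _) (QPair.ext ?_ ?_)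
    · simp [QPair.smul_a, QPair.add_a, QPair.smul_b, mul_add, add_mul, mul_sub, sub_mul, mul_assoc]
    · simp [QPair.smul_b, QPair.add_b]

/-- `r(a, b) = a + (-1)^n ā + β_{-2n}(b)(b)` on pairs. -/
def QPair.r (p : QPair β n) : A :=
  p.a + n.negOnePow • star p.a + β.β (-2 * n) n n p.b p.b

theorem QPair.r_rel (p q : QPair β n) (h : p.Rel q) : p.r = q.r := by
  rw [rel_iff] at h
  obtain ⟨y, h, c, h'⟩ := h
  have hb : q.b = p.b + β.B.d (n + 1) n y := by rw [← h]; abel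
  have ha : q.a = p.a + c - n.negOnePow • star c - corr p.b q.b y := by
    rw [← sub_eq_zero] at h' ⊢
    rw [← h']; abel
  have h1 := cyc1 y p.b p.db
  have h1' := cyc1 y q.b q.db
  have hd : β.B.d n (n - 1) (β.B.d (n + 1) n y) = 0 := by
    rw [← ModuleCat.comp_apply, β.B.d_comp_d]; rfl
  have h2 := cyc2 y y
  have h0 := cyc0 p.b (β.B.d (n + 1) n y) p.db hd
  have h3 := congrArg star h2
  simp only [QPair.r]
  rw [ha]
  have e1 : β.β (-2 * n) n n q.b q.b = β.β (-2 * n) n n p.b p.b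
      + β.β (-2 * n) n n p.b (β.B.d (n + 1) n y)
      + β.β (-2 * n) n n (β.B.d (n + 1) n y) q.b := by
    rw [hb]; simp only [map_add, InvDual.add_apply, LinearMap.add_apply]; abel
  rw [e1, h0, h1, h1', corr, ← sub_eq_zero]
  rw [← sub_eq_zero] at h3
  rw [hb]
  rcases Int.units_eq_one_or n.negOnePow with e | e <;> rw [e] at h3 ⊢ <;>
  simp only [one_smul, Units.neg_smul, star_add, star_sub, star_neg, star_star, map_add,
    InvDual.add_apply, LinearMap.add_apply, smul_add, smul_sub] at h3 ⊢
  · rw [← h3]; abel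
  · rw [← neg_eq_zero, ← h3]; abel

theorem QPair.r_add (p q : QPair β n) : (p + q).r = p.r + q.r := by
  have h0 := cyc0 q.b p.b q.db p.db
  simp only [QPair.r, QPair.add_a, QPair.add_b, map_add, InvDual.add_apply, LinearMap.add_apply,
    star_add, star_sub, smul_add, smul_sub]
  rw [h0]
  abel

variable (β n) in
/-- `Q(n)` with `r(a, b) = a + (-1)^n ā + β_{-2n}(b)(b)` and `s(a) = (a, 0)`. -/
def Q : QGroup A n.negOnePow where
  carrier := Qn β n
  r :=
    { toFun := Quotient.lift QPair.r QPair.r_rel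
      map_zero' := by
        show QPair.r 0 = 0
        simp [QPair.r, QPair.zero_a, QPair.zero_b]
      map_add' := by
        rintro ⟨p⟩ ⟨q⟩
        exact QPair.r_add p q }
  s :=
    { toFun := fun a => Qn.mk a 0 (by simp)
      map_zero' := rfl
      map_add' := fun a b => congrArg (Quotient.mk _)
        (QPair.ext (by simp [QPair.add_a]) (by simp [QPair.add_b])) }
  r_symm := by
    rintro ⟨p⟩
    have h0 := cyc0 p.b p.b p.db p.db
    show n.negOnePow • star p.r = p.r
    simp only [QPair.r, star_add, smul_add, star_star_units, star_star, smul_smul,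
      Int.units_mul_self, one_smul]
    rw [← h0]
    abel
  r_smul := by
    rintro c ⟨p⟩
    show (c • p).r = c * p.r * star c
    rcases Int.units_eq_one_or n.negOnePow with e | e <;>
    simp [QPair.r, QPair.smul_a, QPair.smul_b, e, mul_add, add_mul, mul_assoc]
  s_symm b := by
    refine Quotient.sound (QPair.equivalence.symm ⟨b, 0, ?_, ?_⟩) <;>
    simp [QPair.zero_a, QPair.zero_b]
  s_smul a b := congrArg (Quotient.mk _)
    (QPair.ext (by simp [QPair.smul_a]) (by simp [QPair.smul_b]))
  r_s b := by
    show QPair.r _ = _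
    simp [QPair.r]

end Qn

/-! ### Chain complexes, duality and hyperquadratic chains -/

section Cones

variable {A : Type u} [Ring A]

/-- The direct sum of chain complexes. -/
@[reducible] def dsum (C D : ChainComplex (ModuleCat.{u} A) ℤ) : ChainComplex (ModuleCat.{u} A) ℤ where
  X r := ModuleCat.of A (C.X r × D.X r)
  d r s := ModuleCat.ofHom (LinearMap.prodMap (C.d r s).hom (D.d r s).hom)
  shape r s h := by
    rw [C.shape _ _ h, D.shape _ _ h]
    rfl
  d_comp_d' p q r _ _ := by
    refine ModuleCat.hom_ext (LinearMap.ext fun (x : C.X p × D.X p) => ?_)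
    show (C.d q r (C.d p q x.1), D.d q r (D.d p q x.2)) = 0
    rw [← ModuleCat.comp_apply, ← ModuleCat.comp_apply, C.d_comp_d, D.d_comp_d]
    rfl

/-- The inclusion `C → C ⊕ D`. -/
def dinl (C D : ChainComplex (ModuleCat.{u} A) ℤ) : C ⟶ dsum C D where
  f r := ModuleCat.ofHom (LinearMap.inl A (C.X r) (D.X r))
  comm' r s _ := by
    refine ModuleCat.hom_ext (LinearMap.ext fun (x : C.X r) => ?_)
    show (C.d r s x, D.d r s 0) = (C.d r s x, 0)
    rw [map_zero]

/-- The inclusion `D → C ⊕ D`. -/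
def dinr (C D : ChainComplex (ModuleCat.{u} A) ℤ) : D ⟶ dsum C D where
  f r := ModuleCat.ofHom (LinearMap.inr A (C.X r) (D.X r))
  comm' r s _ := by
    refine ModuleCat.hom_ext (LinearMap.ext fun (x : D.X r) => ?_)
    show (C.d r s 0, D.d r s x) = (0, D.d r s x)
    rw [map_zero]

/-- The projection `C ⊕ D → C`. -/
def dfst (C D : ChainComplex (ModuleCat.{u} A) ℤ) : dsum C D ⟶ C where
  f r := ModuleCat.ofHom (LinearMap.fst A (C.X r) (D.X r))
  comm' r s _ := rfl

/-- The projection `C ⊕ D → D`. -/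
def dsnd (C D : ChainComplex (ModuleCat.{u} A) ℤ) : dsum C D ⟶ D where
  f r := ModuleCat.ofHom (LinearMap.snd A (C.X r) (D.X r))
  comm' r s _ := rfl

theorem dinl_dfst (C D : ChainComplex (ModuleCat.{u} A) ℤ) : dinl C D ≫ dfst C D = 𝟙 C := rfl
theorem dinl_dsnd (C D : ChainComplex (ModuleCat.{u} A) ℤ) : dinl C D ≫ dsnd C D = 0 := rfl
theorem dinr_dfst (C D : ChainComplex (ModuleCat.{u} A) ℤ) : dinr C D ≫ dfst C D = 0 := rfl
theorem dinr_dsnd (C D : ChainComplex (ModuleCat.{u} A) ℤ) : dinr C D ≫ dsnd C D = 𝟙 D := rfl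
theorem dsum_total (C D : ChainComplex (ModuleCat.{u} A) ℤ) :
    dfst C D ≫ dinl C D + dsnd C D ≫ dinr C D = 𝟙 (dsum C D) := by
  refine HomologicalComplex.hom_ext _ _ fun r => ModuleCat.hom_ext
    (LinearMap.ext fun (x : C.X r × D.X r) => ?_)
  show ((x.1 + 0, 0 + x.2) : C.X r × D.X r) = x
  simp

/-- The component `C_{r-1} → D_s` of a chain map `f` (zero unless `s = r - 1`). -/
def coneComp {C D : ChainComplex (ModuleCat.{u} A) ℤ} (f : C ⟶ D) (r s : ℤ) :
    C.X (r - 1) ⟶ D.X s :=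
  if h : r - 1 = s then (C.XIsoOfEq h).hom ≫ f.f s else 0

theorem coneComp_self {C D : ChainComplex (ModuleCat.{u} A) ℤ} (f : C ⟶ D) (r : ℤ) :
    coneComp f r (r - 1) = f.f (r - 1) := by
  simp [coneComp]

/-- The algebraic mapping cone, `C(f)_r = D_r ⊕ C_{r-1}` with
`d(x, c) = (d x + (-1)^{r-1} f(c), d c)`. -/
@[reducible] def cone {C D : ChainComplex (ModuleCat.{u} A) ℤ} (f : C ⟶ D) :
    ChainComplex (ModuleCat.{u} A) ℤ where
  X r := ModuleCat.of A (D.X r × C.X (r - 1))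
  d r s := ModuleCat.ofHom (LinearMap.prod
    ((D.d r s).hom ∘ₗ LinearMap.fst A _ _
      + (r - 1).negOnePow • (coneComp f r s).hom ∘ₗ LinearMap.snd A _ _)
    ((C.d (r - 1) (s - 1)).hom ∘ₗ LinearMap.snd A _ _))
  shape r s h := by
    have h1 : ¬ r - 1 = s := fun h' => h (by simp; omega)
    rw [D.shape _ _ h, C.shape _ _ (fun h' => h (by simp at h' ⊢; omega))]
    simp only [coneComp, dif_neg h1]
    refine ModuleCat.hom_ext (LinearMap.ext fun (x : D.X r × C.X (r - 1)) => Prod.ext ?_ ?_)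
    · show (0 : D.X s) + (r - 1).negOnePow • (0 : D.X s) = 0
      rw [smul_zero, add_zero]
    · rfl
  d_comp_d' p q r hpq hqr := by
    obtain rfl : q = p - 1 := by simp at hpq; omega
    obtain rfl : r = p - 1 - 1 := by simp at hqr; omega
    rw [coneComp_self, coneComp_self]
    refine ModuleCat.hom_ext (LinearMap.ext fun (x : D.X p × C.X (p - 1)) => Prod.ext ?_ ?_)
    · show D.d (p - 1) (p - 1 - 1) (D.d p (p - 1) x.1 + (p - 1).negOnePow • f.f (p - 1) x.2)
        + (p - 1 - 1).negOnePow • f.f (p - 1 - 1) (C.d (p - 1) (p - 1 - 1) x.2) = 0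
      have h1 : D.d (p - 1) (p - 1 - 1) (D.d p (p - 1) x.1) = 0 := by
        rw [← ModuleCat.comp_apply, D.d_comp_d]; rfl
      have h2 : D.d (p - 1) (p - 1 - 1) (f.f (p - 1) x.2)
          = f.f (p - 1 - 1) (C.d (p - 1) (p - 1 - 1) x.2) := by
        rw [← ModuleCat.comp_apply, ← ModuleCat.comp_apply, f.comm]
      rw [Int.negOnePow_sub (p - 1) 1, Int.negOnePow_one, mul_neg, mul_one, map_add, h1]
      rcases Int.units_eq_one_or (p - 1).negOnePow with e | e <;>
      simp only [e, one_smul, neg_smul, Units.neg_smul, map_neg, h2, neg_neg] <;> abel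
    · show C.d (p - 1 - 1) (p - 1 - 1 - 1) (C.d (p - 1) (p - 1 - 1) x.2) = 0
      rw [← ModuleCat.comp_apply, C.d_comp_d]
      rfl

/-- `C` is `m`-dimensional: each `C_r` is f.g. projective, and `C_r = 0` unless `0 ≤ r ≤ m`. -/
structure IsDim (m : ℤ) (C : ChainComplex (ModuleCat.{u} A) ℤ) : Prop where
  fin : ∀ r, Module.Finite A (C.X r)
  proj : ∀ r, Module.Projective A (C.X r)
  zero : ∀ r, r < 0 ∨ m < r → Subsingleton (C.X r)

theorem IsDim.dsum {m : ℤ} {C D : ChainComplex (ModuleCat.{u} A) ℤ} (hC : IsDim m C)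
    (hD : IsDim m D) : IsDim m (dsum C D) where
  fin r := by
    have := hC.fin r
    have := hD.fin r
    exact inferInstanceAs (Module.Finite A (C.X r × D.X r))
  proj r := by
    have := hC.proj r
    have := hD.proj r
    exact inferInstanceAs (Module.Projective A (C.X r × D.X r))
  zero r h := by
    have := hC.zero r h
    have := hD.zero r h
    exact inferInstanceAs (Subsingleton (C.X r × D.X r))

end Cones

section Complexes

variable {A : Type u} [Ring A] [StarRing A]

/-- The cochain complex `C^p = (C_p)^*` with differential `d^*`. -/
@[reducible] def dualCx (C : ChainComplex (ModuleCat.{u} A) ℤ) : CochainComplex (ModuleCat.{u} A) ℤ where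
  X p := ModuleCat.of A (InvDual A (C.X p))
  d p q := ModuleCat.ofHom (dualMap (C.d q p).hom)
  shape p q h := by
    rw [C.shape q p (by simpa using h)]
    exact ModuleCat.hom_ext (LinearMap.ext fun f => InvDual.ext fun x => map_zero f)
  d_comp_d' p q r _ _ := by
    refine ModuleCat.hom_ext (LinearMap.ext fun (f : InvDual A (C.X p)) =>
      InvDual.ext fun x => ?_)
    show f (C.d q p (C.d r q x)) = 0
    rw [← ModuleCat.comp_apply, C.d_comp_d]
    exact map_zero f

/-- The cochain map `f^* : D^* → C^*`. -/
def dualCxMap {C D : ChainComplex (ModuleCat.{u} A) ℤ} (f : C ⟶ D) : dualCx D ⟶ dualCx C where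
  f p := ModuleCat.ofHom (dualMap (f.f p).hom)
  comm' p q _ := by
    refine ModuleCat.hom_ext (LinearMap.ext fun (g : InvDual A (D.X p)) =>
      InvDual.ext fun x => ?_)
    show g (f.f p (C.d q p x)) = g (D.d q p (f.f q x))
    rw [← ModuleCat.comp_apply, ← ModuleCat.comp_apply, f.comm]

/-- The `m`-dual chain complex `C^{m-*}`, with `d = (-1)^r d^* : C^{m-r} → C^{m-r+1}`. -/
@[reducible] def ndual (m : ℤ) (C : ChainComplex (ModuleCat.{u} A) ℤ) : ChainComplex (ModuleCat.{u} A) ℤ where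
  X r := ModuleCat.of A (InvDual A (C.X (m - r)))
  d r s := r.negOnePow • ModuleCat.ofHom (dualMap (C.d (m - s) (m - r)).hom)
  shape r s h := by
    rw [C.shape _ _ (fun h' => h (by simp at h' ⊢; omega))]
    have : ModuleCat.ofHom (dualMap (ModuleCat.Hom.hom (0 : C.X (m - s) ⟶ C.X (m - r)))) = 0 :=
      ModuleCat.hom_ext (LinearMap.ext fun f => InvDual.ext fun x => map_zero f)
    rw [this, smul_zero]
  d_comp_d' p q r _ _ := by
    rw [Linear.units_smul_comp, Linear.comp_units_smul]
    have : ModuleCat.ofHom (dualMap (C.d (m - q) (m - p)).hom) ≫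
        ModuleCat.ofHom (dualMap (C.d (m - r) (m - q)).hom) = 0 := by
      refine ModuleCat.hom_ext (LinearMap.ext fun (f : InvDual A (C.X (m - p))) =>
        InvDual.ext fun x => ?_)
      show f (C.d (m - q) (m - p) (C.d (m - r) (m - q) x)) = 0
      rw [← ModuleCat.comp_apply, C.d_comp_d]
      exact map_zero f
    rw [this, smul_zero, smul_zero]

/-- The dual of the chain complex `B^{m-*}`, with the identification `B^{**} = B`: the cochain
complex with `B_{m-p}` in degree `p` and differential `(-1)^{p+1} d_B`. -/
@[reducible] def bundleCx (m : ℤ) (B : ChainComplex (ModuleCat.{u} A) ℤ) :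
    CochainComplex (ModuleCat.{u} A) ℤ where
  X p := B.X (m - p)
  d p q := (p + 1).negOnePow • B.d (m - p) (m - q)
  shape p q h := by
    rw [B.shape _ _ (fun h' => h (by simp at h' ⊢; omega))]
    exact smul_zero _
  d_comp_d' p q r _ _ := by
    rw [Linear.units_smul_comp, Linear.comp_units_smul, B.d_comp_d, smul_zero, smul_zero]

/-- Families of morphisms `θ_s : X^p → (X^q)^*` (`s, p, q ∈ ℤ`).  For `X = C^*` one has
`(X^q)^* = C_q`, and the `m`-chains of `Ŵ^% C` are the families such that `θ_s : C^p → C_q` is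
zero unless `p + q = m + s`; those of `W^% C` are in addition zero for `s < 0`. -/
abbrev Hyp (X : CochainComplex (ModuleCat.{u} A) ℤ) : Type u :=
  ∀ s p q : ℤ, X.X p →ₗ[A] InvDual A (X.X q)

variable {X Y : CochainComplex (ModuleCat.{u} A) ℤ}

/-- The condition to be an `m`-chain of `Ŵ^%`. -/
def IsChain (m : ℤ) (θ : Hyp X) : Prop := ∀ s p q : ℤ, p + q ≠ m + s → θ s p q = 0

/-- The condition to be in the image of `J : W^% → Ŵ^%`. -/
def IsSymm (θ : Hyp X) : Prop := ∀ s p q : ℤ, s < 0 → θ s p q = 0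

/-- The transposition `T φ = (-1)^{pq} φ^*`. -/
def hypT (θ : Hyp X) : Hyp X := fun s p q => (p * q).negOnePow • transpose (θ s q p)

/-- The differential of an `m`-chain,
`(dθ)_s = d θ_s + (-1)^q θ_s d^* + (-1)^{m+s-1} (θ_{s-1} + (-1)^s T θ_{s-1}) : X^p → (X^q)^*`. -/
def hypD (m : ℤ) (θ : Hyp X) : Hyp X := fun s p q =>
  dualMap (X.d q (q + 1)).hom ∘ₗ θ s p (q + 1)
    + q.negOnePow • θ s (p + 1) q ∘ₗ (X.d p (p + 1)).hom
    + (m + s - 1).negOnePow • (θ (s - 1) p q + s.negOnePow • hypT θ (s - 1) p q)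

/-- The family `v^* θ u`, that is the pairings `θ(u x, v y)`. -/
def hypCross (u v : X ⟶ Y) (θ : Hyp Y) : Hyp X := fun s p q =>
  pullPair (θ s p q) (u.f p).hom (v.f q).hom

/-- The induced map of `Ŵ^%`, given by the pairings `θ(u x, u y)`. -/
def hypPull (u : X ⟶ Y) (θ : Hyp Y) : Hyp X := hypCross u u θ

/-- The chain `[u, v](θ)`, `[u, v](θ)_s = -T(v^* θ_{s+1} u)`.  If `θ` is a cycle of even dimension,
its boundary is `hypPull u θ + hypPull v θ - hypPull (u + v) θ`. -/
def hypBracket (u v : X ⟶ Y) (θ : Hyp Y) : Hyp X :=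
  fun s p q => - hypT (hypCross u v θ) (s + 1) p q

/-- The chain homotopy `(h; u, u')^%` between `hypPull u` and `hypPull u'` on `m`-chains
determined by `h : X^p → Y^{p-1}` with `u' - u = h d + d h`:
`θ_s(u x, h y) + (-1)^q θ_s(h x, u' y) + (-1)^{m-1+q} (T θ_{s-1})(h x, h y)`. -/
def hypHtpy (m : ℤ) (u u' : X ⟶ Y) (h : ∀ p, X.X p →ₗ[A] Y.X (p - 1)) (θ : Hyp Y) : Hyp X :=
  fun s p q =>
    pullPair (θ s p (q - 1)) (u.f p).hom (h q)
      + q.negOnePow • pullPair (θ s (p - 1) q) (h p) (u'.f q).hom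
      + (m - 1 + q).negOnePow • pullPair (hypT θ (s - 1) (p - 1) (q - 1)) (h p) (h q)

end Complexes

/-! ### Symmetric `(B, β)`-structures -/

section Structures

variable {A : Type u} [Ring A] [StarRing A] {X Y : CochainComplex (ModuleCat.{u} A) ℤ}
  {C D : ChainComplex (ModuleCat.{u} A) ℤ}

theorem hypD_apply (m : ℤ) (θ : Hyp X) (s p q : ℤ) (x : X.X p) (y : X.X q) :
    hypD m θ s p q x y = θ s p (q + 1) x (X.d q (q + 1) y)
      + q.negOnePow • θ s (p + 1) q (X.d p (p + 1) x) y
      + (m + s - 1).negOnePow • (θ (s - 1) p q x y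
        + s.negOnePow • (p * q).negOnePow • star (θ (s - 1) q p y x)) := by
  simp only [hypD, hypT]
  rcases Int.units_eq_one_or q.negOnePow with e1 | e1 <;>
  rcases Int.units_eq_one_or (m + s - 1).negOnePow with e2 | e2 <;>
  rcases Int.units_eq_one_or s.negOnePow with e3 | e3 <;>
  rcases Int.units_eq_one_or (p * q).negOnePow with e4 | e4 <;>
  rw [e1, e2, e3, e4] <;> simp

theorem hyp_ext {θ θ' : Hyp X} (h : ∀ s p q x y, θ s p q x y = θ' s p q x y) : θ = θ' :=
  funext fun s => funext fun p => funext fun q => LinearMap.ext fun x =>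
    InvDual.ext fun y => h s p q x y

theorem cochain_comm (u : X ⟶ Y) (p q : ℤ) (x : X.X p) :
    Y.d p q (u.f p x) = u.f q (X.d p q x) := by
  rw [← ModuleCat.comp_apply, ← ModuleCat.comp_apply, u.comm]

theorem hypD_pull (m : ℤ) (u : X ⟶ Y) (θ : Hyp Y) : hypD m (hypPull u θ) = hypPull u (hypD m θ) := by
  refine hyp_ext fun s p q x y => ?_
  rw [hypD_apply]
  simp only [hypPull, hypCross, pullPair_apply]
  rw [hypD_apply, cochain_comm, cochain_comm]

theorem hypD_add (m : ℤ) (θ θ' : Hyp X) : hypD m (θ + θ') = hypD m θ + hypD m θ' := by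
  refine hyp_ext fun s p q x y => ?_
  simp only [hypD_apply, Pi.add_apply, LinearMap.add_apply, InvDual.add_apply, smul_add, star_add]
  abel

theorem hypD_sub (m : ℤ) (θ θ' : Hyp X) : hypD m (θ - θ') = hypD m θ - hypD m θ' := by
  rw [eq_sub_iff_add_eq, ← hypD_add, sub_add_cancel]

theorem hypD_neg (m : ℤ) (θ : Hyp X) : hypD m (-θ) = -hypD m θ := by
  rw [eq_neg_iff_add_eq_zero, ← hypD_add, neg_add_cancel]
  refine hyp_ext fun s p q x y => ?_
  simp [hypD_apply]

variable (β : ChainBundle A)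

/-- The even suspension `S^m β`, `(S^m β)_s = β_{s-m}`. -/
def susp (m : ℤ) : Hyp (bundleCx m β.B) := fun s p q => β.β (s - m) (m - p) (m - q)

/-- The data `(φ, θ, f)` of a `2n`-dimensional symmetric `(B, β)`-structure on `C`: a
`2n`-chain `φ` of `W^% C`, a `(2n+1)`-chain `θ` of `Ŵ^% C`, and `f : B^{2n-*} → C` given by its
dual `f^* : C^{2n-*} → B`. -/
structure StrData (n : ℤ) (C : ChainComplex (ModuleCat.{u} A) ℤ) where
  φ : Hyp (dualCx C)
  θ : Hyp (dualCx C)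
  f : dualCx C ⟶ bundleCx (2 * n) β.B

variable {β} {n : ℤ}

/-- `(φ, θ, f)` is a symmetric `(B, β)`-structure: `dφ = 0` and `J(φ) - f^%(S^{2n} β) = dθ`. -/
structure StrData.IsStr (S : StrData β n C) : Prop where
  φ_chain : IsChain (2 * n) S.φ
  φ_symm : IsSymm S.φ
  θ_chain : IsChain (2 * n + 1) S.θ
  φ_cycle : hypD (2 * n) S.φ = 0
  eq : S.φ - hypPull S.f (susp β (2 * n)) = hypD (2 * n + 1) S.θ

instance : Zero (StrData β n C) := ⟨⟨0, 0, 0⟩⟩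

/-- `(φ, θ, f) + (φ', θ', f') = (φ + φ', θ + θ' + [f, f'](S^{2n} β), f + f')`. -/
instance : Add (StrData β n C) :=
  ⟨fun S S' => ⟨S.φ + S'.φ, S.θ + S'.θ + hypBracket S.f S'.f (susp β (2 * n)), S.f + S'.f⟩⟩

/-- `-(φ, θ, f) = (-φ, -θ - [f, -f](S^{2n} β), -f)`. -/
instance : Neg (StrData β n C) :=
  ⟨fun S => ⟨-S.φ, -S.θ - hypBracket S.f (-S.f) (susp β (2 * n)), -S.f⟩⟩

/-- The pushforward of a structure along a chain map `v : C → D`. -/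
def StrData.push (v : C ⟶ D) (S : StrData β n C) : StrData β n D :=
  ⟨hypPull (dualCxMap v) S.φ, hypPull (dualCxMap v) S.θ, dualCxMap v ≫ S.f⟩

/-- An equivalence `(ξ, η, h) : (φ, θ, f) → (φ', θ', f')`: a `(2n+1)`-chain `ξ` of `W^% C` with
`φ' - φ = dξ`, a chain homotopy `h : f ≃ f'` (given by its dual) and a `(2n+2)`-chain `η` of
`Ŵ^% C` with `J(ξ) - (h; f, f')^%(S^{2n} β) - θ' + θ = dη`. -/
structure StrEquiv (S S' : StrData β n C) where
  ξ : Hyp (dualCx C)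
  η : Hyp (dualCx C)
  h : ∀ p : ℤ, (dualCx C).X p →ₗ[A] (bundleCx (2 * n) β.B).X (p - 1)
  ξ_chain : IsChain (2 * n + 1) ξ
  ξ_symm : IsSymm ξ
  η_chain : IsChain (2 * n + 2) η
  h_eq : ∀ (p : ℤ) (x : (dualCx C).X p),
    S'.f.f p x - S.f.f p x
      = (bundleCx (2 * n) β.B).d (p - 1) p (h p x)
        + (ModuleCat.Hom.hom ((bundleCx (2 * n) β.B).XIsoOfEq (add_sub_cancel_right p 1)).hom)
            (h (p + 1) ((dualCx C).d p (p + 1) x))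
  ξ_eq : S'.φ - S.φ = hypD (2 * n + 1) ξ
  η_eq : ξ - hypHtpy (2 * n) S.f S'.f h (susp β (2 * n)) - S'.θ + S.θ = hypD (2 * n + 2) η

/-- The structure is Poincaré: `φ_0 : C^{2n-*} → C` is a chain equivalence. -/
def StrData.IsPoincare (S : StrData β n C) : Prop :=
  ∃ e : HomotopyEquiv (ndual (2 * n) C) C,
    ∀ (r : ℤ) (x : InvDual A (C.X (2 * n - r))) (y : InvDual A (C.X r)),
      S.φ 0 (2 * n - r) r x y = star (y (e.hom.f r x))

/-- `(C, φ, θ, f)` is the boundary of a `(2n+1)`-dimensional symmetric `(B, β)`-structure Poincaré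
pair: there are a `(2n+1)`-dimensional complex `D`, a chain map `i : C → D`, an equivalence
`(δφ, δθ, δf)` from the pushforward of `(φ, θ, f)` to `0`, such that the duality map
`x ↦ (δφ_0(x), (-1)^{r-1} φ_0(i^* x)) : D^{2n+1-r} → C(i)_r = D_r ⊕ C_{r-1}` is a chain
equivalence. -/
def StrData.IsBoundary (S : StrData β n C) : Prop :=
  ∃ (D : ChainComplex (ModuleCat.{u} A) ℤ) (_ : IsDim (2 * n + 1) D) (i : C ⟶ D)
    (E : StrEquiv (S.push i) 0) (e : HomotopyEquiv (ndual (2 * n + 1) D) (cone i)),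
    ∀ (r : ℤ) (x : InvDual A (D.X (2 * n + 1 - r))),
      (∀ y : InvDual A (D.X r), E.ξ 0 (2 * n + 1 - r) r x y
        = star (y (show D.X r × C.X (r - 1) from e.hom.f r x).1)) ∧
      (∀ y : InvDual A (C.X (r - 1)),
        (r - 1).negOnePow •
            S.φ 0 (2 * n + 1 - r) (r - 1) (dualMap (i.f (2 * n + 1 - r)).hom x) y
          = star (y (show D.X r × C.X (r - 1) from e.hom.f r x).2))

end Structures

section Lemmas

variable {A : Type u} [Ring A] [StarRing A] {X Y : CochainComplex (ModuleCat.{u} A) ℤ}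
  {C D : ChainComplex (ModuleCat.{u} A) ℤ} {β : ChainBundle A} {n : ℤ}

theorem bundleCx_d (m : ℤ) (B : ChainComplex (ModuleCat.{u} A) ℤ) (p q : ℤ)
    (x : B.X (m - p)) :
    (bundleCx m B).d p q x = (p + 1).negOnePow • B.d (m - p) (m - q) x := by
  rcases Int.units_eq_one_or (p + 1).negOnePow with e | e <;> simp only [bundleCx, e] <;> rfl

theorem negOnePow_congr {a b : ℤ} (h : Even (a - b)) : a.negOnePow = b.negOnePow :=
  (Int.negOnePow_eq_iff a b).2 h

theorem hypD_susp (n : ℤ) : hypD (2 * n) (susp β (2 * n)) = 0 := by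
  refine hyp_ext fun s p q (x : β.B.X (2 * n - p)) (y : β.B.X (2 * n - q)) => ?_
  rw [hypD_apply]
  by_cases hs : p + q + 1 = 2 * n + s
  · have h := β.cycle (s - 2 * n) (2 * n - p) (2 * n - q) x y
    rw [bundleCx_d, bundleCx_d]
    have key : ∀ k, k = 2 * n - q - 1 → β.β (s - 2 * n) (2 * n - p) k x
        (β.B.d (2 * n - q) k y) = β.β (s - 2 * n) (2 * n - p) (2 * n - q - 1) x
        (β.B.d (2 * n - q) (2 * n - q - 1) y) := by rintro k rfl; rfl
    have key' : ∀ k, k = 2 * n - p - 1 → β.β (s - 2 * n) k (2 * n - q)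
        (β.B.d (2 * n - p) k x) y = β.β (s - 2 * n) (2 * n - p - 1) (2 * n - q)
        (β.B.d (2 * n - p) (2 * n - p - 1) x) y := by rintro k rfl; rfl
    have key'' : ∀ k, k = s - 2 * n - 1 → β.β k (2 * n - p) (2 * n - q) x y
        + s.negOnePow • (p * q).negOnePow • star (β.β k (2 * n - q) (2 * n - p) y x)
        = β.β (s - 2 * n - 1) (2 * n - p) (2 * n - q) x y
        + s.negOnePow • (p * q).negOnePow •
          star (β.β (s - 2 * n - 1) (2 * n - q) (2 * n - p) y x) := by rintro k rfl; rfl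
    have a1 : (2 * n - q + 1).negOnePow = (q + 1).negOnePow :=
      negOnePow_congr ⟨n - q, by ring⟩
    have a2 : (s - 2 * n).negOnePow = q.negOnePow * (p + 1).negOnePow := by
      rw [← Int.negOnePow_add]; exact negOnePow_congr ⟨-2 * n, by linarith⟩
    have a2' : (s - 2 * n).negOnePow = s.negOnePow := negOnePow_congr ⟨-n, by ring⟩
    have a3 : (s - 2 * n - 1).negOnePow = (2 * n + s - 1).negOnePow :=
      negOnePow_congr ⟨-2 * n, by ring⟩
    have a4 : ((2 * n - p) * (2 * n - q)).negOnePow = (p * q).negOnePow :=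
      negOnePow_congr ⟨2 * n * n - n * p - n * q, by ring⟩
    rw [a1, a3, a4, a2'] at h
    rw [← key'' (s - 1 - 2 * n) (by ring), ← key (2 * n - (q + 1)) (by ring),
      ← key' (2 * n - (p + 1)) (by ring), ← a2', a2, mul_smul] at h
    rw [← a2', a2]
    simp only [susp]
    have e1 : ∀ (e : ℤˣ) (i j k : ℤ) (x : β.B.X i) (y : β.B.X j),
      β.β k i j x (e • y) = e • β.β k i j x y := by
      intro e i j k x y
      rcases Int.units_eq_one_or e with rfl | rfl <;> simp
    have e2 : ∀ (e : ℤˣ) (i j k : ℤ) (x : β.B.X i) (y : β.B.X j),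
      β.β k i j (e • x) y = e • β.β k i j x y := by
      intro e i j k x y
      rcases Int.units_eq_one_or e with rfl | rfl <;> simp
    erw [e1, e2]
    exact h
  · have z : ∀ k i j, i + j ≠ -k → ∀ (x : β.B.X i) (y : β.B.X j), β.β k i j x y = 0 := by
      intro k i j h x y
      rw [β.β_deg k i j h]; rfl
    simp only [susp]
    erw [z _ _ _ (by omega), z _ _ _ (by omega), z _ _ _ (by omega), z _ _ _ (by omega)]
    simp

theorem negOnePow_ite (k : ℤ) : k.negOnePow = if Even k then 1 else -1 := by
  split_ifs with h
  · exact Int.negOnePow_even _ h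
  · exact Int.negOnePow_odd _ (Int.not_even_iff_odd.1 h)

theorem hypBracket_apply (u v : X ⟶ Y) (θ : Hyp Y) (s p q : ℤ) (x : X.X p)
    (y : X.X q) : hypBracket u v θ s p q x y
      = - ((p * q).negOnePow • star (θ (s + 1) q p (u.f q y) (v.f p x))) := by
  simp only [hypBracket, hypT]
  rcases Int.units_eq_one_or (p * q).negOnePow with e | e <;> rw [e] <;> simp [hypCross]

theorem hypCross_apply (u v : X ⟶ Y) (θ : Hyp Y) (s p q : ℤ) (x : X.X p) (y : X.X q) :
    hypCross u v θ s p q x y = θ s p q (u.f p x) (v.f q y) := rfl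

theorem add_f_apply (u v : X ⟶ Y) (p : ℤ) (x : X.X p) :
    (u + v).f p x = u.f p x + v.f p x := rfl

theorem hypD_bracket (n : ℤ) (u v : X ⟶ Y) (θ : Hyp Y) (hθ : hypD (2 * n) θ = 0) :
    hypD (2 * n + 1) (hypBracket u v θ)
      = hypPull u θ + hypPull v θ - hypPull (u + v) θ := by
  refine hyp_ext fun s p q x y => ?_
  rw [hypD_apply]
  have h : hypD (2 * n) θ (s + 1) q p (u.f q y) (v.f p x) = 0 := by
    rw [hθ]; rfl
  have h := congrArg star h
  rw [hypD_apply] at h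
  simp only [hypPull, hypBracket_apply, cochain_comm, Pi.add_apply, Pi.sub_apply,
    LinearMap.add_apply, LinearMap.sub_apply, InvDual.add_apply, InvDual.sub_apply,
    hypCross_apply, add_f_apply, map_add] at h ⊢
  have e : s + 1 - 1 = s := by ring
  have e' : s - 1 + 1 = s := by ring
  rw [e] at h
  rw [e']
  by_cases hp : Even p <;> by_cases hq : Even q <;> by_cases hs : Even s <;>
  simp only [negOnePow_ite, Int.even_add, Int.even_sub, Int.even_mul, hp, hq, hs,
    even_two, true_or, or_true, or_false, or_self, iff_true, true_iff, iff_false, false_iff,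
    if_true, if_false, Int.not_even_one, not_true, not_false_iff, iff_self, one_smul,
    Units.neg_smul, star_add, star_neg, star_star, star_zero] at h ⊢ <;>
  · rw [← sub_eq_zero] at h ⊢
    first
    | (rw [← h]; abel; done)
    | (rw [← neg_eq_zero, ← h]; abel; done)

theorem hypCross_comp {Z : CochainComplex (ModuleCat.{u} A) ℤ} (w : Z ⟶ X) (u v : X ⟶ Y)
    (θ : Hyp Y) : hypCross (w ≫ u) (w ≫ v) θ = hypPull w (hypCross u v θ) := rfl

theorem StrData.IsStr.push {S : StrData β n C} (hS : S.IsStr) (v : C ⟶ D) :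
    (S.push v).IsStr where
  φ_chain s p q h := by
    show hypPull _ S.φ s p q = 0
    rw [hypPull, hypCross, hS.φ_chain s p q h]; rfl
  φ_symm s p q h := by
    show hypPull _ S.φ s p q = 0
    rw [hypPull, hypCross, hS.φ_symm s p q h]; rfl
  θ_chain s p q h := by
    show hypPull _ S.θ s p q = 0
    rw [hypPull, hypCross, hS.θ_chain s p q h]; rfl
  φ_cycle := by
    show hypD _ (hypPull _ S.φ) = 0
    rw [hypD_pull, hS.φ_cycle]; rfl
  eq := by
    show hypPull _ S.φ - hypPull _ _ = hypD _ (hypPull _ S.θ)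
    rw [hypD_pull, ← hS.eq]; rfl

theorem StrData.IsStr.add {S S' : StrData β n C} (hS : S.IsStr) (hS' : S'.IsStr) :
    (S + S').IsStr where
  φ_chain s p q h := by
    show S.φ s p q + S'.φ s p q = 0
    rw [hS.φ_chain s p q h, hS'.φ_chain s p q h, add_zero]
  φ_symm s p q h := by
    show S.φ s p q + S'.φ s p q = 0
    rw [hS.φ_symm s p q h, hS'.φ_symm s p q h, add_zero]
  θ_chain s p q h := by
    show S.θ s p q + S'.θ s p q + hypBracket S.f S'.f (susp β (2 * n)) s p q = 0
    rw [hS.θ_chain s p q h, hS'.θ_chain s p q h, add_zero, zero_add]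
    refine LinearMap.ext fun x => InvDual.ext fun y => ?_
    rw [hypBracket_apply, susp, β.β_deg _ _ _ (by omega)]
    simp
  φ_cycle := by
    show hypD _ (S.φ + S'.φ) = 0
    rw [hypD_add, hS.φ_cycle, hS'.φ_cycle, add_zero]
  eq := by
    show S.φ + S'.φ - hypPull (S.f + S'.f) (susp β (2 * n))
      = hypD _ (S.θ + S'.θ + hypBracket S.f S'.f (susp β (2 * n)))
    rw [hypD_add, hypD_add, hypD_bracket _ _ _ _ (hypD_susp n), ← hS.eq, ← hS'.eq]
    abel

end Lemmas

/-! ### Poincaré complexes and the `L`-groups -/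

section Poincare

variable {A : Type u} [Ring A] [StarRing A] {β : ChainBundle A} {n : ℤ}

/-- The chain map `f^* : D^{m-*} → C^{m-*}`. -/
def ndualMap (m : ℤ) {C D : ChainComplex (ModuleCat.{u} A) ℤ} (f : C ⟶ D) :
    ndual m D ⟶ ndual m C where
  f r := ModuleCat.ofHom (dualMap (f.f (m - r)).hom)
  comm' r s _ := by
    show _ ≫ (r.negOnePow • _) = (r.negOnePow • _) ≫ _
    rw [Linear.units_smul_comp, Linear.comp_units_smul]
    congr 1
    refine ModuleCat.hom_ext (LinearMap.ext fun (g : InvDual A (D.X (m - r))) =>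
      InvDual.ext fun x => ?_)
    show g (f.f (m - r) (C.d _ _ x)) = g (D.d _ _ (f.f (m - s) x))
    rw [← ModuleCat.comp_apply, ← ModuleCat.comp_apply, f.comm]

theorem ndualMap_comp (m : ℤ) {C D E : ChainComplex (ModuleCat.{u} A) ℤ} (f : C ⟶ D)
    (g : D ⟶ E) : ndualMap m g ≫ ndualMap m f = ndualMap m (f ≫ g) := rfl

theorem ndualMap_id (m : ℤ) (C : ChainComplex (ModuleCat.{u} A) ℤ) :
    ndualMap m (𝟙 C) = 𝟙 _ := rfl

theorem ndualMap_zero (m : ℤ) (C D : ChainComplex (ModuleCat.{u} A) ℤ) :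
    ndualMap m (0 : C ⟶ D) = 0 := by
  refine HomologicalComplex.hom_ext _ _ fun r => ModuleCat.hom_ext
    (LinearMap.ext fun (g : InvDual A (D.X (m - r))) => InvDual.ext fun x => ?_)
  exact map_zero g

theorem ndualMap_add (m : ℤ) {C D : ChainComplex (ModuleCat.{u} A) ℤ} (f g : C ⟶ D) :
    ndualMap m (f + g) = ndualMap m f + ndualMap m g := by
  refine HomologicalComplex.hom_ext _ _ fun r => ModuleCat.hom_ext
    (LinearMap.ext fun (h : InvDual A (D.X (m - r))) => InvDual.ext fun x => ?_)
  exact map_add h _ _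

/-- The direct sum of two homotopy equivalences `C^{m-*} → C`, `D^{m-*} → D`. -/
def dualSum (m : ℤ) {C D : ChainComplex (ModuleCat.{u} A) ℤ} (e : HomotopyEquiv (ndual m C) C)
    (e' : HomotopyEquiv (ndual m D) D) : HomotopyEquiv (ndual m (dsum C D)) (dsum C D) where
  hom := ndualMap m (dinl C D) ≫ e.hom ≫ dinl C D + ndualMap m (dinr C D) ≫ e'.hom ≫ dinr C D
  inv := dfst C D ≫ e.inv ≫ ndualMap m (dfst C D) + dsnd C D ≫ e'.inv ≫ ndualMap m (dsnd C D)
  homotopyHomInvId := by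
    have h := ((e.homotopyHomInvId.compRight (ndualMap m (dfst C D))).compLeft
      (ndualMap m (dinl C D))).add
      ((e'.homotopyHomInvId.compRight (ndualMap m (dsnd C D))).compLeft
      (ndualMap m (dinr C D)))
    refine (Homotopy.ofEq ?_).trans (h.trans (Homotopy.ofEq ?_))
    · simp only [Preadditive.add_comp, Preadditive.comp_add, Category.assoc]
      rw [reassoc_of% (dinl_dfst C D), reassoc_of% (dinl_dsnd C D),
        reassoc_of% (dinr_dfst C D), reassoc_of% (dinr_dsnd C D)]
      simp
    · rw [Category.id_comp, Category.id_comp, ndualMap_comp, ndualMap_comp, ← ndualMap_add,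
        dsum_total, ndualMap_id]
  homotopyInvHomId := by
    have h := ((e.homotopyInvHomId.compRight (dinl C D)).compLeft (dfst C D)).add
      ((e'.homotopyInvHomId.compRight (dinr C D)).compLeft (dsnd C D))
    refine (Homotopy.ofEq ?_).trans (h.trans (Homotopy.ofEq ?_))
    · have h1 := ndualMap_comp m (dinl C D) (dfst C D)
      have h2 := ndualMap_comp m (dinr C D) (dfst C D)
      have h3 := ndualMap_comp m (dinl C D) (dsnd C D)
      have h4 := ndualMap_comp m (dinr C D) (dsnd C D)
      rw [dinl_dfst, ndualMap_id] at h1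
      rw [dinr_dfst, ndualMap_zero] at h2
      rw [dinl_dsnd, ndualMap_zero] at h3
      rw [dinr_dsnd, ndualMap_id] at h4
      simp only [Preadditive.add_comp, Preadditive.comp_add, Category.assoc]
      rw [reassoc_of% h1, reassoc_of% h2, reassoc_of% h3, reassoc_of% h4]
      simp
    · rw [Category.id_comp, Category.id_comp, dsum_total]

theorem StrData.IsPoincare.dsum {C D : ChainComplex (ModuleCat.{u} A) ℤ} {S : StrData β n C}
    {S' : StrData β n D} (hS : S.IsPoincare) (hS' : S'.IsPoincare) :
    (S.push (dinl C D) + S'.push (dinr C D)).IsPoincare := by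
  obtain ⟨e, he⟩ := hS
  obtain ⟨e', he'⟩ := hS'
  refine ⟨dualSum (2 * n) e e', fun r x y => ?_⟩
  show S.φ 0 (2 * n - r) r (dualMap (LinearMap.inl A _ _) x) (dualMap (LinearMap.inl A _ _) y)
    + S'.φ 0 (2 * n - r) r (dualMap (LinearMap.inr A _ _) x) (dualMap (LinearMap.inr A _ _) y)
    = star (y ((e.hom.f r (dualMap (LinearMap.inl A _ _) x), (0 : D.X r))
      + ((0 : C.X r), e'.hom.f r (dualMap (LinearMap.inr A _ _) x))))
  rw [he, he', map_add, star_add]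
  rfl

variable (β n) in
/-- A `2n`-dimensional symmetric `(B, β)`-structure Poincaré complex `(C, φ, θ, f)`. -/
structure PoincareCx where
  C : ChainComplex (ModuleCat.{u} A) ℤ
  dim : IsDim (2 * n) C
  S : StrData β n C
  isStr : S.IsStr
  poincare : S.IsPoincare

/-- The direct sum of Poincaré complexes. -/
def PoincareCx.sum (E E' : PoincareCx β n) : PoincareCx β n where
  C := dsum E.C E'.C
  dim := E.dim.dsum E'.dim
  S := E.S.push (dinl E.C E'.C) + E'.S.push (dinr E.C E'.C)
  isStr := (E.isStr.push _).add (E'.isStr.push _)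
  poincare := E.poincare.dsum E'.poincare

/-- `E` and `E'` are cobordant if `E ⊕ -E'` is the boundary of a Poincaré pair. -/
def PoincareCx.Cobordant (E E' : PoincareCx β n) : Prop :=
  (E.S.push (dinl E.C E'.C) + (-E'.S).push (dinr E.C E'.C)).IsBoundary

variable (β n) in
/-- The set of cobordism classes of `2n`-dimensional symmetric `(B, β)`-structure Poincaré
complexes: the underlying set of `L⟨B, β⟩^{2n}(A)`. -/
def LSet : Type (u + 1) := Quot (PoincareCx.Cobordant (β := β) (n := n))

/-- The cobordism class of a Poincaré complex. -/
def LSet.mk (E : PoincareCx β n) : LSet β n := Quot.mk _ E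

end Poincare

/-! ### Forms and Witt groups -/

section Forms

variable {A : Type u} [Ring A] [StarRing A] {ε : ℤˣ}

/-- A nonsingular `Q(ε)`-quadratic form `(M, λ, μ)`. -/
structure QForm (Q : QGroup A ε) where
  M : Type u
  [grp : AddCommGroup M]
  [mod : Module A M]
  [fin : Module.Finite A M]
  [proj : Module.Projective A M]
  lam : M →ₗ[A] InvDual A M
  lam_symm : ∀ x y, ε • star (lam y x) = lam x y
  nonsing : Function.Bijective lam
  mu : M → Q.carrier
  mu_smul : ∀ (a : A) x, mu (a • x) = a • mu x
  r_mu : ∀ x, Q.r (mu x) = lam x x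
  mu_add : ∀ x y, mu (x + y) - mu x - mu y = Q.s (lam x y)

attribute [instance] QForm.grp QForm.mod QForm.fin QForm.proj

variable {Q : QGroup A ε}

/-- The direct sum of forms. -/
def QForm.sum (F G : QForm Q) : QForm Q where
  M := F.M × G.M
  lam := dualMap (LinearMap.fst A _ _) ∘ₗ F.lam ∘ₗ LinearMap.fst A _ _
    + dualMap (LinearMap.snd A _ _) ∘ₗ G.lam ∘ₗ LinearMap.snd A _ _
  lam_symm x y := by
    show ε • star (F.lam y.1 x.1 + G.lam y.2 x.2) = F.lam x.1 y.1 + G.lam x.2 y.2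
    rw [star_add, smul_add, F.lam_symm, G.lam_symm]
  nonsing := by
    constructor
    · intro x y h
      refine Prod.ext (F.nonsing.1 (InvDual.ext fun z => ?_)) (G.nonsing.1 (InvDual.ext fun z => ?_))
      · have h1 : F.lam x.1 z + G.lam x.2 0 = F.lam y.1 z + G.lam y.2 0 :=
          congrArg (fun f : InvDual A (F.M × G.M) => f (z, 0)) h
        simpa using h1
      · have h1 : F.lam x.1 0 + G.lam x.2 z = F.lam y.1 0 + G.lam y.2 z :=
          congrArg (fun f : InvDual A (F.M × G.M) => f (0, z)) h
        simpa using h1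
    · intro f
      obtain ⟨x, hx⟩ := F.nonsing.2 (dualMap (LinearMap.inl A F.M G.M) f)
      obtain ⟨y, hy⟩ := G.nonsing.2 (dualMap (LinearMap.inr A F.M G.M) f)
      refine ⟨(x, y), InvDual.ext fun z => ?_⟩
      show F.lam x z.1 + G.lam y z.2 = f z
      rw [hx, hy]
      show f (z.1, 0) + f (0, z.2) = f z
      rw [← map_add]
      simp
  mu x := F.mu x.1 + G.mu x.2
  mu_smul a x := by
    show F.mu (a • x.1) + G.mu (a • x.2) = _
    rw [F.mu_smul, G.mu_smul, smul_add]
  r_mu x := by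
    show Q.r _ = F.lam x.1 x.1 + G.lam x.2 x.2
    rw [map_add, F.r_mu, G.r_mu]
  mu_add x y := by
    show F.mu (x.1 + y.1) + G.mu (x.2 + y.2) - _ - _ = Q.s (F.lam x.1 y.1 + G.lam x.2 y.2)
    rw [map_add, ← F.mu_add, ← G.mu_add]
    abel

/-- Isomorphism of forms. -/
def QForm.Iso (F G : QForm Q) : Prop :=
  ∃ e : F.M ≃ₗ[A] G.M, (∀ x y, G.lam (e x) (e y) = F.lam x y) ∧ ∀ x, G.mu (e x) = F.mu x

/-- `(M, λ, μ)` is hyperbolic: there is a direct summand `j : L ⊂ M` with `μ j = 0` and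
`0 → L → M → L^* → 0` exact, where the maps are `j` and `j^* λ`. -/
def QForm.IsHyperbolic (F : QForm Q) : Prop :=
  ∃ L : Submodule A F.M, (∃ L' : Submodule A F.M, IsCompl L L') ∧
    Function.Exact L.subtype (dualMap L.subtype ∘ₗ F.lam) ∧
    Function.Surjective (dualMap L.subtype ∘ₗ F.lam) ∧
    ∀ x ∈ L, F.mu x = 0

/-- Stable isomorphism of forms, up to adding hyperbolic forms. -/
def QForm.StablyIso (F G : QForm Q) : Prop :=
  ∃ H K : QForm Q, H.IsHyperbolic ∧ K.IsHyperbolic ∧ (F.sum H).Iso (G.sum K)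

/-- The set of stable isomorphism classes of nonsingular `Q(ε)`-quadratic forms: the underlying
set of the Witt group `W_{Q(ε)}(A)`. -/
def WSet (Q : QGroup A ε) : Type (u + 1) := Quot (QForm.StablyIso (Q := Q))

/-- The Witt class of a form. -/
def WSet.mk (F : QForm Q) : WSet Q := Quot.mk _ F

end Forms

/-! ### The relation between forms and Poincaré complexes -/

section Relation

variable {A : Type u} [Ring A] [StarRing A] {β : ChainBundle A} {n : ℤ}

/-- The component `f^* : C^n → B_n`. -/
def StrData.fn {C : ChainComplex (ModuleCat.{u} A) ℤ} (S : StrData β n C) :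
    InvDual A (C.X n) →ₗ[A] β.B.X n :=
  (S.f.f n ≫ (β.B.XIsoOfEq (show 2 * n - n = n by ring)).hom).hom

theorem StrData.d_fn {C : ChainComplex (ModuleCat.{u} A) ℤ} (S : StrData β n C)
    (z : InvDual A (C.X n)) (hz : dualMap (C.d (n + 1) n).hom z = 0) :
    β.B.d n (n - 1) (S.fn z) = 0 := by
  have h := cochain_comm S.f n (n + 1) z
  have h0 : (dualCx C).d n (n + 1) z = 0 := hz
  rw [h0, map_zero] at h
  have h1 := bundleCx_d (2 * n) β.B n (n + 1) (S.f.f n z)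
  rw [h] at h1
  have h2 : β.B.d (2 * n - n) (2 * n - (n + 1)) (S.f.f n z) = 0 := by
    rcases Int.units_eq_one_or (n + 1).negOnePow with e | e <;> rw [e] at h1
    · simpa using h1.symm
    · simpa using h1.symm
  have key : ∀ (k l : ℤ) (hk : k = n) (_ : l = n - 1) (x : β.B.X k), β.B.d k l x = 0 →
      β.B.d n (n - 1) ((β.B.XIsoOfEq hk).hom x) = 0 := by
    rintro k l rfl rfl x hx
    simpa [HomologicalComplex.XIsoOfEq] using hx
  exact key _ _ (by ring) (by ring) _ h2

/-- The normal Wu class `v_n(φ, θ, f)(z) = (θ_{-1}(z)(z), f^*(z)) ∈ Q(n)` of a cocycle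
`z ∈ C^n`. -/
def StrData.wu {C : ChainComplex (ModuleCat.{u} A) ℤ} (S : StrData β n C)
    (z : InvDual A (C.X n)) (hz : dualMap (C.d (n + 1) n).hom z = 0) : (Q β n).carrier :=
  Qn.mk (S.θ (-1) n n z z) (S.fn z) (S.d_fn z hz)

/-- `F` is the form `(H^n(C), φ_0, v_n(φ, θ, f))` of `E = (C, φ, θ, f)`: the module of `F` is
identified with `H^n(C)` by a surjection `π` from the cocycles `z ∈ C^n` with kernel the
coboundaries. -/
def IsCohomologyForm (E : PoincareCx β n) (F : QForm (Q β n)) : Prop :=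
  ∃ π : LinearMap.ker (dualMap (E.C.d (n + 1) n).hom) →ₗ[A] F.M,
    Function.Surjective π ∧
    (∀ z, π z = 0 ↔ ∃ w, dualMap (E.C.d n (n - 1)).hom w = z.1) ∧
    (∀ z w, F.lam (π z) (π w) = E.S.φ 0 n n z.1 w.1) ∧
    ∀ z, F.mu (π z) = E.S.wu z.1 z.2

/-- `E` is a complex associated to the form `F = (M, λ, μ)`: `C_r = 0` for `r ≠ n`, and
`(H^n(C), φ_0, v_n(φ, θ, f)) = (M, λ, μ)` with `H^n(C) = C^n`. -/
def IsFormCx (F : QForm (Q β n)) (E : PoincareCx β n) : Prop :=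
  (∀ r, r ≠ n → Subsingleton (E.C.X r)) ∧
  ∃ e : F.M ≃ₗ[A] LinearMap.ker (dualMap (E.C.d (n + 1) n).hom),
    (∀ x y, E.S.φ 0 n n (e x).1 (e y).1 = F.lam x y) ∧
    ∀ x, E.S.wu (e x).1 (e x).2 = F.mu x

end Relation

end ChainBundleL

/-! A quadratic form is the same thing as a structure on a complex with a single nonzero module. On
a f.g. projective `M`, every `Q(n)`-quadratic form lifts to a linear map `f : M → ker d ⊂ B_n` and a
pairing `θ` with `λ - β_{-2n}(f, f) = θ + ε θ^*` and `μ(x) = [θ(x)(x), f(x)]` (`exists_presents`):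
representatives are chosen on a basis of a free module covering `M`, and two quadratic functions
with the same polarization differ by an additive equivariant map, which vanishes once it vanishes on
a basis. For a complex concentrated in degree `n` such a lift is a structure with `φ_0 = λ` and
`θ_{-1} = θ`, Poincaré because `λ` is an isomorphism. So every form is realized (`exists_isFormCx`).

On a lagrangian `L` the lift presents the zero form. Unwinding the relation that defines `Q(n)`
gives a null-homotopy of `f` and a chain bounding `θ` on `L` (`Presents.exists_null`), and these
turn the dual of `L → M` into a Poincaré pair (`IsFormCx.isBoundary`). If `E` and `E'` realize the
same form `F`, then `E ⊕ -E'` realizes `F ⊕ -F`, whose diagonal is a lagrangian. Hence the cobordism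
class depends on `F` alone, only on its Witt class, and `wittToL` exists.

A left inverse exists as soon as every Poincaré complex has a cohomology form and the forms of
boundaries vanish in the Witt group (`exists_splitting`). Over a semisimple ring `H^n(C)` is dual to
`H_n(C)`, so `φ_0` is nonsingular on it; coboundaries have zero Wu class; and for a pair `C → D` the
image of `H^n(D)` in `H^n(C)` is a lagrangian (`IsCohomologyForm.isHyperbolic`). In dimension zero
over any ring, `C` lives in degree `0` and `D` in degrees `0` and `1`, but the image of `H^0(D)`
need not be a direct summand. The lagrangian is found after stabilization: `D^0` embeds by `x ↦ (i^*
x, d^* x, ξ_0 x)` into `F ⊕ H`, where `H` is a hyperbolic form on `D^1 ⊕ D_1` built from `ξ_1`,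
`η_0` and the null-homotopy. Exactness is the duality of the pair, and `μ` vanishes by
`StrEquiv.wu_add_eq_zero`. Surjectivity holds because every `0`-dimensional complex is concentrated
in degree `0`.

All complexes in sight are projective and bounded below, so chain equivalences are replaced
throughout by isomorphisms in homology, stated on elements. -/

namespace ChainBundleL

/-! ### The Witt group of nonsingular `Q`-quadratic forms. -/

section WittGroup

variable {A : Type u} [Ring A] [StarRing A] {ε : ℤˣ} {Q : QGroup A ε}

/-- The form `(M, -λ, -μ)`. -/
def QForm.neg (F : QForm Q) : QForm Q where
  M := F.M
  lam := -F.lam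
  lam_symm x y := by
    show ε • star (-(F.lam y x)) = -(F.lam x y)
    rw [star_neg, smul_neg, F.lam_symm]
  nonsing := by
    constructor
    · intro x y h
      exact F.nonsing.1 (neg_injective h)
    · intro f
      obtain ⟨x, hx⟩ := F.nonsing.2 (-f)
      exact ⟨x, by rw [LinearMap.neg_apply, hx, neg_neg]⟩
  mu x := -F.mu x
  mu_smul a x := by rw [F.mu_smul, smul_neg]
  r_mu x := by
    rw [map_neg, F.r_mu]; rfl
  mu_add x y := by
    show _ = Q.s (-(F.lam x y))
    rw [map_neg, ← F.mu_add]
    abel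

theorem QForm.Iso.refl (F : QForm Q) : F.Iso F :=
  ⟨LinearEquiv.refl _ _, fun _ _ => rfl, fun _ => rfl⟩

theorem QForm.Iso.symm {F G : QForm Q} (h : F.Iso G) : G.Iso F := by
  obtain ⟨e, h1, h2⟩ := h
  exact ⟨e.symm, fun x y => by rw [← h1]; simp, fun x => by rw [← h2]; simp⟩

theorem QForm.Iso.trans {F G H : QForm Q} (h : F.Iso G) (k : G.Iso H) : F.Iso H := by
  obtain ⟨e, h1, h2⟩ := h
  obtain ⟨e', h1', h2'⟩ := k
  exact ⟨e.trans e', fun x y => by rw [← h1, ← h1']; rfl, fun x => by rw [← h2, ← h2']; rfl⟩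

theorem QForm.Iso.sum {F F' G G' : QForm Q} (h : F.Iso F') (k : G.Iso G') :
    (F.sum G).Iso (F'.sum G') := by
  obtain ⟨e, h1, h2⟩ := h
  obtain ⟨e', h1', h2'⟩ := k
  refine ⟨e.prodCongr e', fun x y => ?_, fun x => ?_⟩
  · show F'.lam (e x.1) (e y.1) + G'.lam (e' x.2) (e' y.2) = _
    rw [h1, h1']; rfl
  · show F'.mu (e x.1) + G'.mu (e' x.2) = _
    rw [h2, h2']; rfl

theorem QForm.sum_comm_iso (F G : QForm Q) : (F.sum G).Iso (G.sum F) :=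
  ⟨LinearEquiv.prodComm A F.M G.M, fun _ _ => add_comm _ _, fun _ => add_comm _ _⟩

theorem QForm.sum_assoc_iso (F G H : QForm Q) : ((F.sum G).sum H).Iso (F.sum (G.sum H)) :=
  ⟨LinearEquiv.prodAssoc A F.M G.M H.M, fun _ _ => (add_assoc _ _ _).symm,
    fun _ => (add_assoc _ _ _).symm⟩

/-- Hyperbolicity in terms of an injection `j : L → M` with a complement, instead of a submodule. -/
theorem QForm.isHyperbolic_of_injection (F : QForm Q) {L : Type*} [AddCommGroup L] [Module A L]
    (j : L →ₗ[A] F.M) (hj : ∃ p : F.M →ₗ[A] L, p ∘ₗ j = LinearMap.id)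
    (hex : ∀ x, (∀ l, F.lam x (j l) = 0) ↔ x ∈ LinearMap.range j)
    (hsurj : ∀ g : L →ₗ[A] A, ∃ x, ∀ l, F.lam x (j l) = g l)
    (hmu : ∀ l, F.mu (j l) = 0) : F.IsHyperbolic := by
  obtain ⟨p, hp⟩ := hj
  refine ⟨LinearMap.range j, ⟨LinearMap.ker p, ?_⟩, ?_, ?_, ?_⟩
  · constructor
    · rw [Submodule.disjoint_def]
      rintro _ ⟨l, rfl⟩ h
      have : p (j l) = l := LinearMap.congr_fun hp l
      rw [LinearMap.mem_ker, this] at h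
      rw [h, map_zero]
    · rw [codisjoint_iff, eq_top_iff]
      intro x _
      rw [Submodule.mem_sup]
      refine ⟨j (p x), ⟨_, rfl⟩, x - j (p x), ?_, by abel⟩
      have : p (j (p x)) = p x := LinearMap.congr_fun hp _
      rw [LinearMap.mem_ker, map_sub, this, sub_self]
  · intro x
    constructor
    · intro h
      have := (hex x).1 fun l =>
        congrArg (fun f : InvDual A (LinearMap.range j) => f ⟨j l, l, rfl⟩) h
      exact ⟨⟨x, this⟩, rfl⟩
    · rintro ⟨⟨_, l, rfl⟩, rfl⟩
      refine InvDual.ext ?_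
      rintro ⟨_, l', rfl⟩
      exact (hex (j l)).2 ⟨l, rfl⟩ l'
  · intro g
    obtain ⟨x, hx⟩ := hsurj (LinearMap.comp (show LinearMap.range j →ₗ[A] A from g) j.rangeRestrict)
    refine ⟨x, InvDual.ext ?_⟩
    rintro ⟨_, l, rfl⟩
    exact hx l
  · rintro _ ⟨l, rfl⟩
    exact hmu l

/-- A hyperbolic form has a split injection of a lagrangian. -/
theorem QForm.IsHyperbolic.exists_injection {F : QForm Q} (h : F.IsHyperbolic) :
    ∃ (L : Submodule A F.M) (p : F.M →ₗ[A] L), p ∘ₗ L.subtype = LinearMap.id ∧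
      (∀ x, (∀ l ∈ L, F.lam x l = 0) ↔ x ∈ L) ∧
      (∀ g : L →ₗ[A] A, ∃ x, ∀ l, F.lam x (L.subtype l) = g l) ∧ ∀ l ∈ L, F.mu l = 0 := by
  obtain ⟨L, ⟨L', hc⟩, hex, hs, hmu⟩ := h
  refine ⟨L, L.projectionOnto L' hc, ?_, ?_, ?_, hmu⟩
  · refine LinearMap.ext fun x => ?_
    simp
  · intro x
    have := hex x
    constructor
    · intro h
      obtain ⟨y, rfl⟩ := this.1 (InvDual.ext fun l => h l.1 l.2)
      exact y.2
    · intro h l hl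
      exact congrArg (fun f : InvDual A L => f ⟨l, hl⟩) (this.2 ⟨⟨x, h⟩, rfl⟩)
  · intro g
    obtain ⟨x, hx⟩ := hs g
    exact ⟨x, fun l => congrArg (fun f : InvDual A L => f l) hx⟩

/-- The diagonal is a lagrangian, split by the first projection. This gives inverses in the Witt
group. -/
theorem QForm.sum_neg_isHyperbolic (F : QForm Q) : (F.sum F.neg).IsHyperbolic := by
  refine (F.sum F.neg).isHyperbolic_of_injection (L := F.M)
    (LinearMap.prod LinearMap.id LinearMap.id) ⟨LinearMap.fst A F.M F.M, rfl⟩ ?_ ?_ ?_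
  · intro x
    constructor
    · intro h
      have : x.1 = x.2 := F.nonsing.1 (InvDual.ext fun z => by
        have : F.lam x.1 z + -F.lam x.2 z = 0 := h z
        rwa [← sub_eq_add_neg, sub_eq_zero] at this)
      exact ⟨x.1, Prod.ext rfl this⟩
    · rintro ⟨y, rfl⟩ l
      exact add_neg_cancel (F.lam y l)
  · intro g
    obtain ⟨x, hx⟩ := F.nonsing.2 g
    refine ⟨(x, (0 : F.M)), fun l => ?_⟩
    show F.lam x l + -(F.lam 0 l) = g l
    rw [hx, map_zero, InvDual.zero_apply, neg_zero, add_zero]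
    rfl
  · intro l
    exact add_neg_cancel (F.mu l)

variable (Q) in
/-- The zero form. -/
def QForm.zero : QForm Q where
  M := PUnit
  lam := 0
  lam_symm x y := by simp
  nonsing := ⟨fun _ _ _ => rfl, fun f => ⟨0, InvDual.ext fun x => by
    rw [show x = 0 from rfl, map_zero, map_zero]⟩⟩
  mu _ := 0
  mu_smul a x := (smul_zero a).symm
  r_mu x := by simp
  mu_add x y := by simp

theorem QForm.isHyperbolic_zero : (QForm.zero Q).IsHyperbolic := by
  refine (QForm.zero Q).isHyperbolic_of_injection (L := PUnit.{u + 1})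
    (0 : PUnit.{u + 1} →ₗ[A] PUnit.{u+1})
    ⟨0, rfl⟩ (fun x => ⟨fun _ => ⟨0, rfl⟩, fun _ _ => rfl⟩) (fun g => ⟨PUnit.unit, fun l => ?_⟩)
    (fun _ => rfl)
  rw [show l = 0 from rfl, map_zero]; rfl

theorem WSet.mk_eq_of_iso {F G : QForm Q} (h : F.Iso G) : WSet.mk F = WSet.mk G :=
  Quot.sound ⟨_, _, QForm.isHyperbolic_zero, QForm.isHyperbolic_zero, h.sum (.refl _)⟩

theorem QForm.sum_zero_iso (F : QForm Q) : (F.sum (QForm.zero Q)).Iso F :=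
  ⟨(LinearEquiv.prodUnique : (F.M × PUnit.{u + 1}) ≃ₗ[A] F.M),
    fun x y => (add_zero _).symm, fun _ => (add_zero _).symm⟩

/-- The stabilizing forms are `0` on the left and `F` itself on the right: `F ⊕ 0 ≅ 0 ⊕ F`. -/
theorem WSet.mk_eq_zero_of_isHyperbolic {F : QForm Q} (h : F.IsHyperbolic) :
    WSet.mk F = WSet.mk (QForm.zero Q) :=
  Quot.sound ⟨_, _, QForm.isHyperbolic_zero, h,
    (QForm.sum_zero_iso F).trans ((QForm.sum_zero_iso F).symm.trans (QForm.sum_comm_iso _ _))⟩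

theorem QForm.StablyIso.sum_right {F F' : QForm Q} (h : F.StablyIso F') (G : QForm Q) :
    (F.sum G).StablyIso (F'.sum G) := by
  obtain ⟨H, K, hH, hK, e⟩ := h
  have comm : ∀ F H : QForm Q, ((F.sum G).sum H).Iso ((F.sum H).sum G) := fun F H =>
    (QForm.sum_assoc_iso _ _ _).trans
      ((QForm.Iso.sum (.refl _) (QForm.sum_comm_iso _ _)).trans (QForm.sum_assoc_iso _ _ _).symm)
  exact ⟨H, K, hH, hK, (comm F H).trans ((e.sum (.refl G)).trans (comm F' K).symm)⟩

theorem QForm.StablyIso.sum_left {F F' : QForm Q} (h : F.StablyIso F') (G : QForm Q) :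
    (G.sum F).StablyIso (G.sum F') := by
  obtain ⟨H, K, hH, hK, e⟩ := h
  exact ⟨H, K, hH, hK, (QForm.sum_assoc_iso _ _ _).trans
    ((QForm.Iso.sum (.refl G) e).trans (QForm.sum_assoc_iso _ _ _).symm)⟩

/-- Addition of Witt classes. -/
scoped instance : Add (WSet Q) :=
  ⟨Quot.map₂ QForm.sum (fun F _ _ h => h.sum_left F) (fun _ _ G h => h.sum_right G)⟩

scoped instance : Zero (WSet Q) := ⟨WSet.mk (QForm.zero Q)⟩

-- Choosing a representative avoids a proof that negation respects the relation. Independence of the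
-- choice follows from uniqueness of inverses, in `WSet.mk_neg`.
noncomputable scoped instance : Neg (WSet Q) := ⟨fun w => WSet.mk (QForm.neg w.out)⟩

theorem WSet.mk_sum (F G : QForm Q) : WSet.mk (F.sum G) = WSet.mk F + WSet.mk G := rfl

/-- The Witt group. -/
noncomputable scoped instance addCommGroupWSet : AddCommGroup (WSet Q) where
  add_assoc := by
    rintro ⟨F⟩ ⟨G⟩ ⟨H⟩
    exact WSet.mk_eq_of_iso (QForm.sum_assoc_iso F G H)
  add_comm := by
    rintro ⟨F⟩ ⟨G⟩
    exact WSet.mk_eq_of_iso (QForm.sum_comm_iso F G)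
  zero_add := by
    rintro ⟨F⟩
    exact WSet.mk_eq_of_iso ((QForm.sum_comm_iso _ _).trans (QForm.sum_zero_iso F))
  add_zero := by
    rintro ⟨F⟩
    exact WSet.mk_eq_of_iso (QForm.sum_zero_iso F)
  neg_add_cancel w := by
    have h : WSet.mk w.out = w := Quot.out_eq w
    have h' : -w = WSet.mk (QForm.neg w.out) := rfl
    have h2 : -w + w = WSet.mk ((QForm.neg w.out).sum w.out) := by
      rw [WSet.mk_sum, h, h']
    rw [h2, WSet.mk_eq_of_iso (QForm.sum_comm_iso _ _)]
    exact WSet.mk_eq_zero_of_isHyperbolic w.out.sum_neg_isHyperbolic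
  nsmul := nsmulRec
  zsmul := zsmulRec

theorem WSet.mk_of_isHyperbolic {F : QForm Q} (h : F.IsHyperbolic) : WSet.mk F = 0 :=
  WSet.mk_eq_zero_of_isHyperbolic h

theorem WSet.mk_neg (F : QForm Q) : WSet.mk F.neg = -WSet.mk F := by
  rw [eq_neg_iff_add_eq_zero, add_comm, ← WSet.mk_sum]
  exact WSet.mk_of_isHyperbolic F.sum_neg_isHyperbolic

end WittGroup

/-! ### Quasi-isomorphisms of bounded below projective complexes are chain equivalences. -/

section Homotopy

variable {A : Type u} [Ring A]

/-- Cycles of a chain complex. -/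
def IsCyc (X : ChainComplex (ModuleCat.{u} A) ℤ) {r : ℤ} (x : X.X r) : Prop := ∀ j, X.d r j x = 0

/-- Boundaries of a chain complex. -/
def IsBd (X : ChainComplex (ModuleCat.{u} A) ℤ) {r : ℤ} (x : X.X r) : Prop :=
  ∃ (j : ℤ) (c : X.X j), X.d j r c = x

variable {X Y : ChainComplex (ModuleCat.{u} A) ℤ}

theorem d_eq_zero_of_ne (X : ChainComplex (ModuleCat.{u} A) ℤ) {i j : ℤ} (h : j + 1 ≠ i)
    (x : X.X i) : X.d i j x = 0 := by
  rw [X.shape i j (by simpa using h)]; rfl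

theorem d_d_apply (X : ChainComplex (ModuleCat.{u} A) ℤ) {i j k : ℤ} (x : X.X i) :
    X.d j k (X.d i j x) = 0 := by
  rw [← ModuleCat.comp_apply, X.d_comp_d]; rfl

theorem chain_comm (f : X ⟶ Y) (i j : ℤ) (x : X.X i) : Y.d i j (f.f i x) = f.f j (X.d i j x) := by
  rw [← ModuleCat.comp_apply, ← ModuleCat.comp_apply, f.comm]

theorem isCyc_iff {i j : ℤ} (h : j + 1 = i) (x : X.X i) : IsCyc X x ↔ X.d i j x = 0 := by
  refine ⟨fun h => h j, fun h' k => ?_⟩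
  by_cases hk : k + 1 = i
  · obtain rfl : k = j := by omega
    exact h'
  · exact d_eq_zero_of_ne X hk x

theorem isBd_iff {i j : ℤ} (h : i + 1 = j) (x : X.X i) : IsBd X x ↔ ∃ c, X.d j i c = x := by
  refine ⟨?_, fun ⟨c, hc⟩ => ⟨j, c, hc⟩⟩
  rintro ⟨k, c, hc⟩
  by_cases hk : i + 1 = k
  · obtain rfl : k = j := by omega
    exact ⟨c, hc⟩
  · rw [d_eq_zero_of_ne X hk] at hc
    exact ⟨0, by rw [map_zero, hc]⟩

theorem isBd_zero {r : ℤ} : IsBd X (0 : X.X r) := ⟨r, 0, map_zero _⟩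

theorem IsBd.add {r : ℤ} {x y : X.X r} (hx : IsBd X x) (hy : IsBd X y) : IsBd X (x + y) := by
  rw [isBd_iff rfl] at *
  obtain ⟨c, rfl⟩ := hx
  obtain ⟨c', rfl⟩ := hy
  exact ⟨c + c', map_add _ _ _⟩

theorem IsBd.neg {r : ℤ} {x : X.X r} (hx : IsBd X x) : IsBd X (-x) := by
  obtain ⟨j, c, rfl⟩ := hx
  exact ⟨j, -c, map_neg _ _⟩

theorem IsBd.sub {r : ℤ} {x y : X.X r} (hx : IsBd X x) (hy : IsBd X y) : IsBd X (x - y) := by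
  rw [sub_eq_add_neg]; exact hx.add hy.neg

theorem IsCyc.add {r : ℤ} {x y : X.X r} (hx : IsCyc X x) (hy : IsCyc X y) : IsCyc X (x + y) :=
  fun j => by rw [map_add, hx, hy, add_zero]

theorem IsCyc.map (f : X ⟶ Y) {r : ℤ} {x : X.X r} (hx : IsCyc X x) : IsCyc Y (f.f r x) :=
  fun j => by rw [chain_comm, hx, map_zero]

theorem IsBd.map (f : X ⟶ Y) {r : ℤ} {x : X.X r} (hx : IsBd X x) : IsBd Y (f.f r x) := by
  obtain ⟨j, c, rfl⟩ := hx
  exact ⟨j, f.f j c, chain_comm f _ _ _⟩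

/-- `f` induces isomorphisms in homology. -/
structure IsQI (f : X ⟶ Y) : Prop where
  inj : ∀ (r : ℤ) (x : X.X r), IsCyc X x → IsBd Y (f.f r x) → IsBd X x
  surj : ∀ (r : ℤ) (y : Y.X r), IsCyc Y y → ∃ x, IsCyc X x ∧ IsBd Y (y - f.f r x)

theorem homotopy_apply {f g : X ⟶ Y} (h : Homotopy f g) (r : ℤ) (x : X.X r) :
    f.f r x = h.hom (r - 1) r (X.d r (r - 1) x) + Y.d (r + 1) r (h.hom r (r + 1) x)
      + g.f r x := by
  have := h.comm r
  rw [dNext_eq h.hom (show (ComplexShape.down ℤ).Rel r (r - 1) by simp),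
    prevD_eq h.hom (show (ComplexShape.down ℤ).Rel (r + 1) r by simp)] at this
  rw [this]; rfl

theorem homotopy_isBd {f g : X ⟶ Y} (h : Homotopy f g) {r : ℤ} {x : X.X r} (hx : IsCyc X x) :
    IsBd Y (f.f r x - g.f r x) := by
  rw [homotopy_apply h, hx, map_zero, zero_add, add_sub_cancel_right]
  exact ⟨_, _, rfl⟩

theorem HomotopyEquiv.isQI (e : HomotopyEquiv X Y) : IsQI e.hom where
  inj r x hx hb := by
    have h1 := homotopy_isBd e.homotopyHomInvId hx
    have h2 : IsBd X (e.inv.f r (e.hom.f r x)) := hb.map e.inv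
    have := h2.sub h1
    convert this using 1
    simp
  surj r y hy := by
    refine ⟨e.inv.f r y, hy.map _, ?_⟩
    have h1 := (homotopy_isBd e.homotopyInvHomId hy).neg
    convert h1 using 1
    simp

/-- The identification `X_i = X_j` for `i = j` (zero for `i ≠ j`). -/
def castX (X : ChainComplex (ModuleCat.{u} A) ℤ) (i j : ℤ) : X.X i →ₗ[A] X.X j :=
  if h : i = j then (X.XIsoOfEq h).hom.hom else 0

@[simp] theorem castX_self (i : ℤ) (x : X.X i) : castX X i i x = x := by
  simp [castX]

theorem castX_castX {i j k : ℤ} (h : i = j) (x : X.X i) :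
    castX X j k (castX X i j x) = castX X i k x := by
  subst h; simp

theorem d_castX {i j i' j' : ℤ} (h : i = j) (h' : i' = j') (x : X.X i) :
    X.d j j' (castX X i j x) = castX X i' j' (X.d i i' x) := by
  subst h h'; simp

theorem coneComp_apply (f : X ⟶ Y) (r s : ℤ) (x : X.X (r - 1)) :
    coneComp f r s x = f.f s (castX X (r - 1) s x) := by
  by_cases h : r - 1 = s
  · simp only [coneComp, dif_pos h, castX]; rfl
  · simp [coneComp, dif_neg h, castX]

theorem cone_d_apply (f : X ⟶ Y) (r s : ℤ) (z : Y.X r × X.X (r - 1)) :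
    (cone f).d r s z = ((Y.d r s z.1 + (r - 1).negOnePow • f.f s (castX X (r - 1) s z.2),
      X.d (r - 1) (s - 1) z.2) : Y.X s × X.X (s - 1)) := by
  rw [← coneComp_apply]
  rcases Int.units_eq_one_or (r - 1).negOnePow with e | e <;> simp only [cone, e] <;> rfl

theorem units_smul_eq_iff {M : Type*} [AddCommGroup M] (e : ℤˣ) (x y : M) :
    e • x = y ↔ x = e • y := by
  rcases Int.units_eq_one_or e with rfl | rfl
  · simp
  · simp [Units.neg_smul, neg_eq_iff_eq_neg]

theorem map_units_smul {M N F : Type*} [AddCommGroup M] [AddCommGroup N] [FunLike F M N]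
    [AddMonoidHomClass F M N] (f : F) (e : ℤˣ) (x : M) : f (e • x) = e • f x := by
  rcases Int.units_eq_one_or e with rfl | rfl
  · simp
  · simp [Units.neg_smul]

theorem map_units_smul_prod {M N P : Type*} [AddCommGroup M] [AddCommGroup N] [AddCommGroup P]
    [Module A M] [Module A N] [Module A P] (f : M × N →ₗ[A] P) (e : ℤˣ) (x : M) (y : N) :
    f (e • x, y) = e • f (x, 0) + f (0, y) := by
  rw [← map_units_smul, ← map_add]
  congr 1
  rcases Int.units_eq_one_or e with rfl | rfl <;> simp [Units.neg_smul]

theorem IsCyc.units_smul {r : ℤ} {x : X.X r} (hx : IsCyc X x) (e : ℤˣ) : IsCyc X (e • x) :=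
  fun j => by
    have := map_units_smul (X.d r j).hom e x
    exact this.trans (by rw [hx j, smul_zero])

/-- The cone of a quasi-isomorphism is acyclic. -/
theorem IsQI.cone_acyclic {f : X ⟶ Y} (hf : IsQI f) (r : ℤ) (z : (cone f).X r)
    (hz : IsCyc (cone f) z) : IsBd (cone f) z := by
  obtain ⟨y, x⟩ : Y.X r × X.X (r - 1) := z
  have h := hz (r - 1)
  rw [cone_d_apply] at h
  have h1 := congrArg Prod.fst h
  have h2 := congrArg Prod.snd h
  clear h
  change Y.d r (r - 1) y + (r - 1).negOnePow • f.f (r - 1) (castX X (r - 1) (r - 1) x) = 0 at h1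
  change X.d (r - 1) (r - 1 - 1) x = 0 at h2
  rw [castX_self] at h1
  have hx : IsCyc X x := (isCyc_iff (by ring) x).2 h2
  -- The first component of the cycle condition exhibits `f x` as the boundary of `∓y`, so `x`
  -- bounds by injectivity in homology.
  have hb : IsBd X x := by
    refine hf.inj _ x hx ⟨r, -((r - 1).negOnePow • y), ?_⟩
    rw [map_neg]
    have := map_units_smul (Y.d r (r - 1)).hom (r - 1).negOnePow y
    erw [this]
    rw [eq_neg_of_add_eq_zero_left h1, smul_neg, neg_neg, smul_smul, Int.units_mul_self, one_smul]
  obtain ⟨x1, hx1⟩ := (isBd_iff (show r - 1 + 1 = r + 1 - 1 by ring) x).1 hb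
  have e0 : (r + 1 - 1).negOnePow = -(r - 1).negOnePow := by
    rw [add_sub_cancel_right, Int.negOnePow_sub, Int.negOnePow_one]; simp
  have e1 : (r + 1 - 1).negOnePow = r.negOnePow := by rw [add_sub_cancel_right]
  have hc1 : Y.d r (r - 1) (f.f r (castX X (r + 1 - 1) r x1)) = f.f (r - 1) x := by
    rw [chain_comm, d_castX (i' := r - 1) (by ring) rfl, hx1, castX_self]
  -- Subtracting the image of a chain `x1` bounding `x` makes `y` a cycle; surjectivity in homology
  -- then writes it as `f x2` plus a boundary.
  have hy : IsCyc Y (y - (r + 1 - 1).negOnePow • f.f r (castX X (r + 1 - 1) r x1)) := by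
    refine (isCyc_iff (j := r - 1) (by ring) _).2 ?_
    rw [map_sub, e0]
    have := map_units_smul (Y.d r (r - 1)).hom (-(r - 1).negOnePow)
      (f.f r (castX X (r + 1 - 1) r x1))
    erw [this]
    rw [show (Y.d r (r - 1)).hom (f.f r (castX X (r + 1 - 1) r x1)) = _ from hc1, ← h1,
      Units.neg_smul]
    abel
  obtain ⟨x2, hx2, hb2⟩ := hf.surj r _ hy
  obtain ⟨y2, hy2⟩ := (isBd_iff rfl _).1 hb2
  refine ⟨r + 1, ((y2, x1 + (r + 1 - 1).negOnePow • castX X r (r + 1 - 1) x2) :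
    Y.X (r + 1) × X.X (r + 1 - 1)), ?_⟩
  rw [cone_d_apply]
  refine Prod.ext ?_ ?_
  · show Y.d (r + 1) r y2 + (r + 1 - 1).negOnePow • f.f r (castX X (r + 1 - 1) r
      (x1 + (r + 1 - 1).negOnePow • castX X r (r + 1 - 1) x2)) = y
    rw [hy2, map_add, map_add, map_units_smul, castX_castX (by ring), castX_self]
    have := map_units_smul (f.f r).hom (r + 1 - 1).negOnePow x2
    erw [this]
    rw [smul_add, smul_smul, Int.units_mul_self, one_smul]
    show y - _ - f.f r x2 + (_ + f.f r x2) = y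
    abel
  · show X.d (r + 1 - 1) (r - 1) (x1 + (r + 1 - 1).negOnePow • castX X r (r + 1 - 1) x2) = x
    rw [map_add, hx1]
    have := map_units_smul (X.d (r + 1 - 1) (r - 1)).hom (r + 1 - 1).negOnePow
      (castX X r (r + 1 - 1) x2)
    erw [this]
    have h3 : X.d (r + 1 - 1) (r - 1) (castX X r (r + 1 - 1) x2) = 0 := by
      rw [d_castX (i' := r - 1) (by ring) rfl, hx2, map_zero]
    erw [h3]
    rw [smul_zero, add_zero]

/-- The submodule of cycles. -/
def cycles (X : ChainComplex (ModuleCat.{u} A) ℤ) (r : ℤ) : Submodule A (X.X r) where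
  carrier := {x | IsCyc X x}
  add_mem' := IsCyc.add
  zero_mem' := fun j => map_zero _
  smul_mem' a x hx j := by rw [map_smul, hx, smul_zero]

/-- The differential as a map to cycles. -/
def toCycles (X : ChainComplex (ModuleCat.{u} A) ℤ) (i j : ℤ) : X.X i →ₗ[A] cycles X j :=
  (X.d i j).hom.codRestrict _ fun _ _ => d_d_apply X _

/-- An acyclic complex of projectives which is bounded below has a contraction. -/
theorem exists_contraction (K : ChainComplex (ModuleCat.{u} A) ℤ)
    (hp : ∀ r, Module.Projective A (K.X r)) (b : ℤ) (hb : ∀ r < b, Subsingleton (K.X r))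
    (hac : ∀ (r : ℤ) (x : K.X r), IsCyc K x → IsBd K x) :
    ∃ H : ∀ i j : ℤ, K.X i →ₗ[A] K.X j, ∀ (i j k : ℤ), i + 1 = j → k + 1 = i → ∀ x : K.X i,
      K.d j i (H i j x) + H k i (K.d i k x) = x := by
  have hsurj : ∀ i j : ℤ, j + 1 = i → Function.Surjective (toCycles K i j) := by
    rintro i j h ⟨z, hz⟩
    obtain ⟨c, hc⟩ := (isBd_iff h z).1 (hac _ z hz)
    exact ⟨c, Subtype.ext hc⟩
  -- If `Z_j` is projective, `d : K_i → Z_j` has a section `s`, and `1 - s d` retracts `K_i` onto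
  -- `Z_i`. So projectivity climbs from one degree to the next.
  have hstep : ∀ i j : ℤ, j + 1 = i → Module.Projective A (cycles K j) →
      Module.Projective A (cycles K i) := by
    intro i j hij ih
    obtain ⟨s, hs⟩ := Module.projective_lifting_property (toCycles K i j) LinearMap.id
      (hsurj _ _ hij)
    have := hp i
    have hmem : ∀ x, (LinearMap.id (R := A) - s ∘ₗ toCycles K i j : K.X i →ₗ[A] _) x
        ∈ cycles K i := by
      intro x
      refine (isCyc_iff hij _).2 ?_
      have := congrArg Subtype.val (LinearMap.congr_fun hs (toCycles K i j x))
      change K.d _ _ (s (toCycles K _ _ x)) = K.d _ _ x at this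
      simp [this]
    refine Module.Projective.of_split (cycles K i).subtype
      (LinearMap.codRestrict _ _ hmem) (LinearMap.ext fun x => Subtype.ext ?_)
    have : toCycles K i j x.1 = 0 := Subtype.ext (x.2 _)
    simp [this]
  -- The induction starts at `b - 1`, where the complex is zero.
  have hZ : ∀ m : ℕ, Module.Projective A (cycles K (b - 1 + m)) := by
    intro m
    induction m with
    | zero =>
      have := hb (b - 1 + (0 : ℕ)) (by simp)
      infer_instance
    | succ m ih => exact hstep _ _ (by push_cast; ring) ih
  have hZ' : ∀ r, Module.Projective A (cycles K r) := by
    intro r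
    by_cases h : r < b
    · have := hb r h
      infer_instance
    · have := hZ (r - (b - 1)).toNat
      rwa [Int.toNat_of_nonneg (by omega), add_sub_cancel] at this
  have hs : ∀ i j : ℤ, ∃ s : cycles K j →ₗ[A] K.X i, j + 1 = i → ∀ z, K.d i j (s z) = z.1 := by
    intro i j
    by_cases h : j + 1 = i
    · have := hZ' j
      obtain ⟨s, hs⟩ := Module.projective_lifting_property (toCycles K i j) LinearMap.id
        (hsurj _ _ h)
      exact ⟨s, fun _ z => congrArg Subtype.val (LinearMap.congr_fun hs z)⟩
    · exact ⟨0, fun h' => absurd h' h⟩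
  choose s hs using hs
  have hP : ∀ (i : ℤ) (x : K.X i),
      (LinearMap.id (R := A) - s i (i - 1) ∘ₗ toCycles K i (i - 1) : K.X i →ₗ[A] _) x
        ∈ cycles K i := by
    intro i x
    refine (isCyc_iff (j := i - 1) (by ring) _).2 ?_
    have := hs i (i - 1) (by ring) (toCycles K _ _ x)
    change _ = K.d i (i - 1) x at this
    simp [this]
  -- The contraction is the section applied to the cycle part of a chain. Then `d H = 1 - s d`,
  -- while `H d = s d` because a boundary is its own cycle part.
  refine ⟨fun i j => s j i ∘ₗ (LinearMap.id - s i (i - 1) ∘ₗ toCycles K i (i - 1)).codRestrict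
    _ (hP i), ?_⟩
  rintro i j k hj hk x
  obtain rfl : k = i - 1 := by omega
  rw [LinearMap.comp_apply, hs j i hj]
  have h0 : toCycles K (i - 1) (i - 1 - 1) (K.d i (i - 1) x) = 0 := Subtype.ext (d_d_apply K x)
  have : (LinearMap.id - s (i - 1) (i - 1 - 1) ∘ₗ toCycles K (i - 1) (i - 1 - 1)).codRestrict
    _ (hP (i - 1)) (K.d i (i - 1) x) = toCycles K i (i - 1) x := by
    refine Subtype.ext ?_
    simp only [LinearMap.codRestrict_apply, LinearMap.sub_apply, LinearMap.comp_apply, h0, map_zero]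
    exact sub_zero _
  rw [LinearMap.comp_apply, this]
  simp

/-- A quasi-isomorphism of projective complexes which are bounded below is a chain equivalence. -/
theorem IsQI.exists_homotopyEquiv {f : X ⟶ Y} (hf : IsQI f)
    (hpX : ∀ r, Module.Projective A (X.X r)) (hpY : ∀ r, Module.Projective A (Y.X r))
    (b : ℤ) (hbX : ∀ r < b, Subsingleton (X.X r)) (hbY : ∀ r < b, Subsingleton (Y.X r)) :
    ∃ e : HomotopyEquiv X Y, e.hom = f := by
  obtain ⟨H, hH⟩ := exists_contraction (cone f)
    (fun r => by
      have := hpX (r - 1); have := hpY r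
      exact inferInstanceAs (Module.Projective A (Y.X r × X.X (r - 1)))) b
    (fun r hr => by
      have := hbX (r - 1) (by omega); have := hbY r hr
      exact inferInstanceAs (Subsingleton (Y.X r × X.X (r - 1)))) hf.cone_acyclic
  let H' : ∀ i j : ℤ, (Y.X i × X.X (i - 1)) →ₗ[A] (Y.X j × X.X (j - 1)) := H
  have hH' : ∀ (j : ℤ) (z : Y.X (j + 1) × X.X (j + 1 - 1)),
      (Y.d (j + 1 + 1) (j + 1) (H' (j + 1) (j + 1 + 1) z).1
        + (j + 1 + 1 - 1).negOnePow • f.f (j + 1) (castX X (j + 1 + 1 - 1) (j + 1)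
            (H' (j + 1) (j + 1 + 1) z).2)
        + (H' j (j + 1) (Y.d (j + 1) j z.1
            + (j + 1 - 1).negOnePow • f.f j (castX X (j + 1 - 1) j z.2),
          X.d (j + 1 - 1) (j - 1) z.2)).1 = z.1) ∧
      (X.d (j + 1 + 1 - 1) (j + 1 - 1) (H' (j + 1) (j + 1 + 1) z).2
        + (H' j (j + 1) (Y.d (j + 1) j z.1
            + (j + 1 - 1).negOnePow • f.f j (castX X (j + 1 - 1) j z.2),
          X.d (j + 1 - 1) (j - 1) z.2)).2 = z.2) := by
    intro j z
    have h := hH (j + 1) (j + 1 + 1) j rfl rfl z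
    rw [cone_d_apply, cone_d_apply] at h
    exact ⟨congrArg Prod.fst h, congrArg Prod.snd h⟩
  have e1 : ∀ j : ℤ, (j + 1 + 1 - 1).negOnePow = (j + 1).negOnePow := fun j => by congr 1; ring
  -- The contraction of the cone is a 2 by 2 matrix. Its `Y → X` entry anticommutes with `d`, so up
  -- to the sign `(-1)^i` it is the homotopy inverse. The entries `X → X` and `Y → Y` give the two
  -- homotopies `k` and `a`.
  let g0 : ∀ i : ℤ, Y.X i →ₗ[A] X.X i := fun i =>
    castX X (i + 1 - 1) i ∘ₗ LinearMap.snd A _ _ ∘ₗ H' i (i + 1) ∘ₗ LinearMap.inl A _ _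
  have hg0 : ∀ (j : ℤ) (y : Y.X (j + 1)),
      X.d (j + 1) j (g0 (j + 1) y) = - g0 j (Y.d (j + 1) j y) := by
    intro j y
    have h := (hH' j (y, 0)).2
    simp only [map_zero, smul_zero, add_zero] at h
    have h := congrArg (castX X (j + 1 - 1) j) h
    rw [map_add, ← d_castX (i := j + 1 + 1 - 1) (j := j + 1) (by ring) (by ring), map_zero] at h
    exact eq_neg_of_add_eq_zero_left h
  let g : Y ⟶ X :=
    { f := fun i => ModuleCat.ofHom (i.negOnePow • g0 i)
      comm' := by
        rintro i j hij
        obtain rfl : j + 1 = i := by simpa using hij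
        refine ModuleCat.hom_ext (LinearMap.ext fun y => ?_)
        show X.d (j + 1) j ((j + 1).negOnePow • g0 (j + 1) y)
          = j.negOnePow • g0 j (Y.d (j + 1) j y)
        have := map_units_smul (X.d (j + 1) j).hom (j + 1).negOnePow (g0 (j + 1) y)
        erw [this]
        erw [hg0]
        rw [Int.negOnePow_succ, Units.neg_smul, smul_neg, neg_neg] }
  have hg : ∀ i y, g.f i y = i.negOnePow • g0 i y := fun i y => rfl
  let k : ∀ i j : ℤ, X.X i →ₗ[A] X.X j := fun i j => if i + 1 = j then
    - castX X (j + 1 - 1) j ∘ₗ LinearMap.snd A _ _ ∘ₗ H' (i + 1) (j + 1) ∘ₗ LinearMap.inr A _ _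
      ∘ₗ castX X i (i + 1 - 1) else 0
  let a : ∀ i j : ℤ, Y.X i →ₗ[A] Y.X j := fun i j => if i + 1 = j then
    - LinearMap.fst A _ _ ∘ₗ H' i j ∘ₗ LinearMap.inl A _ _ else 0
  have hk : ∀ (j : ℤ) (x : X.X j), k j (j + 1) x = - castX X (j + 1 + 1 - 1) (j + 1)
      (H' (j + 1) (j + 1 + 1) (0, castX X j (j + 1 - 1) x)).2 := by
    intro j x
    simp only [k, if_pos]; rfl
  have ha : ∀ (j : ℤ) (y : Y.X j), a j (j + 1) y = - (H' j (j + 1) (y, 0)).1 := by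
    intro j x
    simp only [a, if_pos]; rfl
  refine ⟨⟨f, g, ⟨fun i j => ModuleCat.ofHom (k i j), ?_, ?_⟩, ⟨fun i j => ModuleCat.ofHom (a i j),
    ?_, ?_⟩⟩, rfl⟩
  · intro i j hij
    have : ¬ i + 1 = j := by simpa using hij
    simp only [k, if_neg this]; rfl
  · intro i
    obtain ⟨j, rfl⟩ : ∃ j, i = j + 1 := ⟨i - 1, by ring⟩
    rw [dNext_eq _ (show (ComplexShape.down ℤ).Rel (j + 1) j by simp),
      prevD_eq _ (show (ComplexShape.down ℤ).Rel (j + 1 + 1) (j + 1) by simp)]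
    refine ModuleCat.hom_ext (LinearMap.ext fun x => ?_)
    show g.f (j + 1) (f.f (j + 1) x) = k j (j + 1) (X.d (j + 1) j x)
      + X.d (j + 1 + 1) (j + 1) (k (j + 1) (j + 1 + 1) x) + x
    rw [hk, hk, hg]
    have h := (hH' (j + 1) (0, castX X (j + 1) (j + 1 + 1 - 1) x)).2
    simp only [map_zero, zero_add, castX_castX (show j + 1 = j + 1 + 1 - 1 by ring),
      castX_self] at h
    rw [d_castX (i' := j) (by ring) (by ring)] at h
    have h := congrArg (castX X (j + 1 + 1 - 1) (j + 1)) h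
    rw [map_add, castX_castX (by ring), castX_self, ← d_castX (i := j + 1 + 1 + 1 - 1)
      (j := j + 1 + 1) (by ring) (by ring)] at h
    have hsplit := map_units_smul_prod (castX X (j + 1 + 1 - 1) (j + 1) ∘ₗ LinearMap.snd A _ _ ∘ₗ
      H' (j + 1) (j + 1 + 1)) (j + 1).negOnePow (f.f (j + 1) x)
      (castX X j (j + 1 - 1) (X.d (j + 1) j x))
    rw [e1] at h
    change _ + (castX X (j + 1 + 1 - 1) (j + 1) ∘ₗ LinearMap.snd A _ _ ∘ₗ
      H' (j + 1) (j + 1 + 1)) _ = _ at h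
    rw [hsplit] at h
    rw [map_neg]
    have key : ∀ D S K x : X.X (j + 1), D + (S + K) = x → S = -K + -D + x := by
      rintro D S K x rfl; abel
    exact key _ _ _ _ h
  · intro i j hij
    have : ¬ i + 1 = j := by simpa using hij
    simp only [a, if_neg this]; rfl
  · intro i
    obtain ⟨j, rfl⟩ : ∃ j, i = j + 1 := ⟨i - 1, by ring⟩
    rw [dNext_eq _ (show (ComplexShape.down ℤ).Rel (j + 1) j by simp),
      prevD_eq _ (show (ComplexShape.down ℤ).Rel (j + 1 + 1) (j + 1) by simp)]
    refine ModuleCat.hom_ext (LinearMap.ext fun y => ?_)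
    show f.f (j + 1) (g.f (j + 1) y) = a j (j + 1) (Y.d (j + 1) j y)
      + Y.d (j + 1 + 1) (j + 1) (a (j + 1) (j + 1 + 1) y) + y
    rw [ha, ha, hg]
    have h := (hH' j (y, 0)).1
    simp only [map_zero, smul_zero, add_zero] at h
    have := map_units_smul (f.f (j + 1)).hom (j + 1).negOnePow (g0 (j + 1) y)
    erw [this]
    rw [e1] at h
    rw [map_neg]
    change _ + (j + 1).negOnePow • f.f (j + 1) (g0 (j + 1) y) + _ = _ at h
    have key : ∀ D S K x : Y.X (j + 1), D + S + K = x → S = -K + -D + x := by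
      rintro D S K x rfl; abel
    exact key _ _ _ _ h

end Homotopy

/-! ### Reflexivity of f.g. projective modules. -/

section Reflexivity

variable {A : Type u} [Ring A] [StarRing A] {M N : Type u} [AddCommGroup M] [Module A M]
  [AddCommGroup N] [Module A N]

/-- A finite dual basis of a f.g. projective module. -/
theorem exists_dual_basis (M : Type u) [AddCommGroup M] [Module A M] [Module.Finite A M]
    [Module.Projective A M] : ∃ (k : ℕ) (e : Fin k → M) (g : Fin k → InvDual A M),
    ∀ m, ∑ i, g i m • e i = m := by
  obtain ⟨k, f, g, -, -, h⟩ := Module.Finite.exists_comp_eq_id_of_projective A M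
  refine ⟨k, fun i => f (Pi.single i 1), fun i => (LinearMap.proj i ∘ₗ g : M →ₗ[A] A), fun m => ?_⟩
  have h1 : f (g m) = m := LinearMap.congr_fun h m
  conv_rhs => rw [← h1, ← Finset.univ_sum_single (g m), map_sum]
  refine Finset.sum_congr rfl fun i _ => ?_
  rw [← map_smul, ← Pi.single_smul', smul_eq_mul, mul_one]
  rfl

theorem eq_zero_of_dual [Module.Finite A M] [Module.Projective A M] (m : M)
    (h : ∀ y : InvDual A M, y m = 0) : m = 0 := by
  obtain ⟨k, e, g, hg⟩ := exists_dual_basis (A := A) M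
  rw [← hg m]
  exact Finset.sum_eq_zero fun i _ => by rw [h, zero_smul]

theorem eq_of_dual [Module.Finite A M] [Module.Projective A M] (m m' : M)
    (h : ∀ y : InvDual A M, y m = y m') : m = m' :=
  sub_eq_zero.1 (eq_zero_of_dual (A := A) _ fun y => by rw [map_sub, h, sub_self])

theorem InvDual.sum_apply {ι : Type*} (s : Finset ι) (f : ι → InvDual A M) (m : M) :
    (∑ i ∈ s, f i) m = ∑ i ∈ s, f i m := by
  induction s using Finset.cons_induction with
  | empty => simp
  | cons a s ha ih => simp [Finset.sum_cons, ih]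

/-- A functional on `M^*` is determined by its values on a finite dual basis. The `star` reflects
that `M → M^{**}` sends `m` to `y ↦ star (y m)`. -/
theorem exists_eval [Module.Finite A M] [Module.Projective A M]
    (ψ : InvDual A (InvDual A M)) : ∃ m, ∀ y : InvDual A M, y m = star (ψ y) := by
  obtain ⟨k, e, g, hg⟩ := exists_dual_basis (A := A) M
  refine ⟨∑ i, star (ψ (g i)) • e i, fun y => ?_⟩
  have h : y = ∑ i, star (y (e i)) • g i := by
    refine InvDual.ext fun m => ?_
    rw [InvDual.sum_apply]
    conv_lhs => rw [← hg m, map_sum]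
    refine Finset.sum_congr rfl fun i _ => ?_
    rw [map_smul, smul_eq_mul, InvDual.smul_apply, star_star]
  conv_rhs => rw [h, map_sum, star_sum]
  rw [map_sum]
  refine Finset.sum_congr rfl fun i _ => ?_
  rw [map_smul, map_smul, smul_eq_mul, smul_eq_mul, star_mul, star_star]

/-- The pointwise choice of preimages is automatically linear, since `M^*` separates the points of
`M`. -/
theorem exists_sharp [Module.Finite A M] [Module.Projective A M]
    (φ : N →ₗ[A] InvDual A (InvDual A M)) :
    ∃ g : N →ₗ[A] M, ∀ x (y : InvDual A M), y (g x) = star (φ x y) := by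
  choose g hg using fun x => exists_eval (φ x)
  refine ⟨⟨⟨g, fun x x' => eq_of_dual (A := A) _ _ fun y => ?_⟩,
    fun a x => eq_of_dual (A := A) _ _ fun y => ?_⟩, hg⟩
  · rw [map_add, hg, hg, hg, map_add, InvDual.add_apply, star_add]
  · rw [map_smul, hg, hg]; simp

open Classical in
/-- The morphism `N → M` corresponding to `φ : N → M^{**}`. -/
noncomputable def sharp (φ : N →ₗ[A] InvDual A (InvDual A M)) : N →ₗ[A] M :=
  if h : ∃ g : N →ₗ[A] M, ∀ x (y : InvDual A M), y (g x) = star (φ x y) then h.choose else 0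

theorem apply_sharp [Module.Finite A M] [Module.Projective A M]
    (φ : N →ₗ[A] InvDual A (InvDual A M)) (x : N) (y : InvDual A M) :
    y (sharp φ x) = star (φ x y) := by
  have h := exists_sharp φ
  rw [sharp, dif_pos h]
  exact h.choose_spec x y

/-- The evaluation `M → M^{**}`. -/
def evalDual (M : Type u) [AddCommGroup M] [Module A M] : M →ₗ[A] InvDual A (InvDual A M) :=
  transpose (LinearMap.id : InvDual A M →ₗ[A] InvDual A M)

@[simp] theorem evalDual_apply (m : M) (y : InvDual A M) : evalDual M m y = star (y m) := rfl

theorem evalDual_injective [Module.Finite A M] [Module.Projective A M] :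
    Function.Injective (evalDual (A := A) M) := fun m m' h => eq_of_dual (A := A) _ _ fun y => by
  have : evalDual M m y = evalDual M m' y := by rw [h]
  simpa using this

theorem evalDual_surjective [Module.Finite A M] [Module.Projective A M] :
    Function.Surjective (evalDual (A := A) M) := fun ψ => by
  obtain ⟨m, hm⟩ := exists_eval ψ
  exact ⟨m, InvDual.ext fun y => by rw [evalDual_apply, hm, star_star]⟩

instance finite_invDual [Module.Finite A M] [Module.Projective A M] :
    Module.Finite A (InvDual A M) := by
  obtain ⟨k, e, g, hg⟩ := exists_dual_basis (A := A) M
  refine Module.Finite.of_surjective (M := Fin k → A) (Fintype.linearCombination A g) fun y => ?_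
  refine ⟨fun i => star (y (e i)), InvDual.ext fun m => ?_⟩
  rw [Fintype.linearCombination_apply, InvDual.sum_apply]
  conv_rhs => rw [← hg m, map_sum]
  refine Finset.sum_congr rfl fun i _ => ?_
  rw [map_smul, smul_eq_mul, InvDual.smul_apply, star_star]

instance projective_invDual [Module.Finite A M] [Module.Projective A M] :
    Module.Projective A (InvDual A M) := by
  obtain ⟨k, e, g, hg⟩ := exists_dual_basis (A := A) M
  refine Module.Projective.of_split (M := Fin k → A)
    (LinearMap.pi fun i => (evalDual M (e i) : InvDual A M →ₗ[A] A))
    (Fintype.linearCombination A g) (LinearMap.ext fun y => InvDual.ext fun m => ?_)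
  rw [LinearMap.comp_apply, Fintype.linearCombination_apply, InvDual.sum_apply]
  conv_rhs => rw [LinearMap.id_apply, ← hg m, map_sum]
  refine Finset.sum_congr rfl fun i _ => ?_
  rw [map_smul, smul_eq_mul, InvDual.smul_apply]
  show _ * star (star (y (e i))) = _
  rw [star_star]

instance subsingleton_invDual [Subsingleton M] : Subsingleton (InvDual A M) :=
  ⟨fun f g => InvDual.ext fun x => by rw [Subsingleton.elim x 0, map_zero, map_zero]⟩

end Reflexivity

/-! ### Poincaré duality for complexes and pairs, read off in homology. -/

section Duality

variable {A : Type u} [Ring A] [StarRing A] {β : ChainBundle A} {n : ℤ}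
  {C D : ChainComplex (ModuleCat.{u} A) ℤ}

/-- Cocycles. -/
def CoCyc (C : ChainComplex (ModuleCat.{u} A) ℤ) {p : ℤ} (x : InvDual A (C.X p)) : Prop :=
  ∀ j, dualMap (C.d j p).hom x = 0

/-- Coboundaries. -/
def CoBd (C : ChainComplex (ModuleCat.{u} A) ℤ) {p : ℤ} (x : InvDual A (C.X p)) : Prop :=
  ∃ (j : ℤ) (w : InvDual A (C.X j)), dualMap (C.d p j).hom w = x

theorem coCyc_iff {p j : ℤ} (h : p + 1 = j) (x : InvDual A (C.X p)) :
    CoCyc C x ↔ dualMap (C.d j p).hom x = 0 := by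
  refine ⟨fun h => h j, fun h' k => ?_⟩
  by_cases hk : p + 1 = k
  · obtain rfl : k = j := by omega
    exact h'
  · refine InvDual.ext fun y => ?_
    show x (C.d k p y) = 0
    rw [d_eq_zero_of_ne C hk, map_zero]

theorem coBd_iff {p j : ℤ} (h : j + 1 = p) (x : InvDual A (C.X p)) :
    CoBd C x ↔ ∃ w, dualMap (C.d p j).hom w = x := by
  refine ⟨?_, fun ⟨c, hc⟩ => ⟨j, c, hc⟩⟩
  rintro ⟨k, w, hw⟩
  by_cases hk : k + 1 = p
  · obtain rfl : k = j := by omega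
    exact ⟨w, hw⟩
  · refine ⟨0, ?_⟩
    rw [map_zero, ← hw]
    refine InvDual.ext fun y => ?_
    show 0 = w (C.d p k y)
    rw [d_eq_zero_of_ne C hk, map_zero]

theorem CoCyc.map (f : C ⟶ D) {p : ℤ} {x : InvDual A (D.X p)} (hx : CoCyc D x) :
    CoCyc C (dualMap (f.f p).hom x) := fun j => InvDual.ext fun y => by
  show x (f.f p (C.d j p y)) = 0
  rw [← chain_comm]
  exact congrArg (fun g : InvDual A (D.X j) => g (f.f j y)) (hx j)

theorem CoBd.map (f : C ⟶ D) {p : ℤ} {x : InvDual A (D.X p)} (hx : CoBd D x) :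
    CoBd C (dualMap (f.f p).hom x) := by
  obtain ⟨j, w, rfl⟩ := hx
  refine ⟨j, dualMap (f.f j).hom w, InvDual.ext fun y => ?_⟩
  show w (f.f j (C.d p j y)) = w (D.d p j (f.f p y))
  rw [chain_comm]

theorem CoCyc.add {p : ℤ} {x y : InvDual A (C.X p)} (hx : CoCyc C x) (hy : CoCyc C y) :
    CoCyc C (x + y) := fun j => by rw [map_add, hx, hy, add_zero]

theorem CoCyc.neg {p : ℤ} {x : InvDual A (C.X p)} (hx : CoCyc C x) :
    CoCyc C (-x) := fun j => by rw [map_neg, hx, neg_zero]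

theorem coCyc_zero {p : ℤ} : CoCyc C (0 : InvDual A (C.X p)) := fun j => map_zero _

theorem coBd_zero {p : ℤ} : CoBd C (0 : InvDual A (C.X p)) := ⟨p, 0, map_zero _⟩

theorem ndual_d_apply (m r s : ℤ) (x : InvDual A (C.X (m - r))) :
    (ndual m C).d r s x = r.negOnePow • dualMap (C.d (m - s) (m - r)).hom x := by
  rcases Int.units_eq_one_or r.negOnePow with e | e <;> simp only [ndual, e] <;> rfl

theorem isCyc_ndual {m r : ℤ} (x : InvDual A (C.X (m - r))) :
    IsCyc (ndual m C) (show (ndual m C).X r from x) ↔ CoCyc C x := by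
  constructor
  · intro h j
    have := h (m - j)
    rw [ndual_d_apply, units_smul_eq_iff, smul_zero] at this
    have key : ∀ k, k = j → dualMap (C.d k (m - r)).hom x = 0 →
        dualMap (C.d j (m - r)).hom x = 0 := by
      rintro k rfl h; exact h
    exact key _ (sub_sub_cancel m j) this
  · intro h j
    rw [ndual_d_apply, h, smul_zero]

theorem isBd_ndual {m r : ℤ} (x : InvDual A (C.X (m - r))) :
    IsBd (ndual m C) (show (ndual m C).X r from x) ↔ CoBd C x := by
  constructor
  · rintro ⟨j, w, hw⟩
    rw [ndual_d_apply] at hw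
    exact ⟨m - j, j.negOnePow • w, by rw [map_units_smul]; exact hw⟩
  · rintro ⟨j, w, hw⟩
    have key : ∀ k, k = j → ∃ w : InvDual A (C.X k), dualMap (C.d (m - r) k).hom w = x := by
      rintro k rfl; exact ⟨w, hw⟩
    obtain ⟨w', hw'⟩ := key (m - (m - j)) (by ring)
    refine ⟨m - j, (m - j).negOnePow • w', ?_⟩
    rw [ndual_d_apply, map_units_smul, smul_smul, Int.units_mul_self, one_smul]
    exact hw'

/-- The morphism `C^p → D_q` corresponding to `φ_0 : C^p → D^{q*}`. -/
noncomputable def hypSharp (φ : Hyp (dualCx C)) (p q : ℤ) : InvDual A (C.X p) →ₗ[A] C.X q :=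
  sharp (φ 0 p q : InvDual A (C.X p) →ₗ[A] InvDual A (InvDual A (C.X q)))

theorem apply_hypSharp {m : ℤ} (hC : IsDim m C) (φ : Hyp (dualCx C)) (p q : ℤ)
    (x : InvDual A (C.X p)) (y : InvDual A (C.X q)) :
    y (hypSharp φ p q x) = star (φ 0 p q x y) := by
  have := hC.fin q
  have := hC.proj q
  exact apply_sharp _ x y

theorem IsDim.ext {m : ℤ} (hC : IsDim m C) {q : ℤ} {c c' : C.X q}
    (h : ∀ y : InvDual A (C.X q), y c = y c') : c = c' := by
  have := hC.fin q
  have := hC.proj q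
  exact eq_of_dual (A := A) _ _ h

/-- In degree `s = 0` the transposition terms involve `φ_{-1}`, which is zero on `W^%`. -/
theorem hypD_zero_of_isSymm {m : ℤ} {φ : Hyp (dualCx C)} (hφ : IsSymm φ) (p q : ℤ)
    (x : InvDual A (C.X p)) (y : InvDual A (C.X q)) :
    hypD m φ 0 p q x y = φ 0 p (q + 1) x (dualMap (C.d (q + 1) q).hom y)
      + q.negOnePow • φ 0 (p + 1) q (dualMap (C.d (p + 1) p).hom x) y := by
  rw [hypD_apply, hφ (0 - 1) p q (by norm_num), hφ (0 - 1) q p (by norm_num)]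
  simp

/-- The `s = 0` component of `dφ = 0`: it says that `φ_0` is a chain map `C^{2n-*} → C`. -/
theorem StrData.IsStr.d_sharp {S : StrData β n C} (hS : S.IsStr) (hC : IsDim (2 * n) C)
    {p p' q q' : ℤ}
    (hp : p + 1 = p') (hq : q + 1 = q') (x : InvDual A (C.X p)) :
    C.d q' q (hypSharp S.φ p q' x) + q.negOnePow • hypSharp S.φ p' q (dualMap (C.d p' p).hom x)
      = 0 := by
  subst hp hq
  refine hC.ext fun y => ?_
  have h := hypD_zero_of_isSymm (m := 2 * n) hS.φ_symm p q x y
  rw [hS.φ_cycle] at h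
  rw [map_add, map_zero, map_units_smul, apply_hypSharp hC]
  show (dualMap (C.d (q + 1) q).hom y) _ + _ = 0
  rw [apply_hypSharp hC, ← star_star_units, ← star_add, ← h]
  exact star_zero A

/-- The map `φ_0 : C^{m-*} → C` induces isomorphisms in homology. -/
structure IsDuality (m : ℤ) (φ : Hyp (dualCx C)) : Prop where
  inj : ∀ p q, p + q = m → ∀ x : InvDual A (C.X p), CoCyc C x → IsBd C (hypSharp φ p q x) →
    CoBd C x
  surj : ∀ p q, p + q = m → ∀ c : C.X q, IsCyc C c →
    ∃ x : InvDual A (C.X p), CoCyc C x ∧ IsBd C (c - hypSharp φ p q x)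

theorem projective_ndual {m : ℤ} (hC : IsDim m C) (k r : ℤ) :
    Module.Projective A ((ndual k C).X r) := by
  have := hC.fin (k - r)
  have := hC.proj (k - r)
  exact inferInstanceAs (Module.Projective A (InvDual A (C.X (k - r))))

theorem subsingleton_ndual {m : ℤ} (hC : IsDim m C) (r : ℤ) (hr : r < 0) :
    Subsingleton ((ndual m C).X r) := by
  have := hC.zero (m - r) (by omega)
  exact inferInstanceAs (Subsingleton (InvDual A (C.X (m - r))))

/-- The chain map `φ_0 : C^{2n-*} → C`. -/
noncomputable def StrData.IsStr.dualityMap {S : StrData β n C} (hS : S.IsStr)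
    (hC : IsDim (2 * n) C) : ndual (2 * n) C ⟶ C where
  f r := ModuleCat.ofHom (hypSharp S.φ (2 * n - r) r)
  comm' r s hrs := by
    obtain rfl : s + 1 = r := by simpa using hrs
    refine ModuleCat.hom_ext (LinearMap.ext fun x => ?_)
    show C.d (s + 1) s (hypSharp S.φ (2 * n - (s + 1)) (s + 1) x)
      = hypSharp S.φ (2 * n - s) s ((ndual (2 * n) C).d (s + 1) s x)
    rw [ndual_d_apply, map_units_smul, Int.negOnePow_succ, Units.neg_smul]
    exact eq_neg_of_add_eq_zero_left (hS.d_sharp hC (by ring) rfl x)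

/-- `C` and its dual are projective and vanish in negative degrees, so a chain equivalence may be
tested on homology. -/
theorem StrData.isPoincare_iff {S : StrData β n C} (hC : IsDim (2 * n) C) (hS : S.IsStr) :
    S.IsPoincare ↔ IsDuality (2 * n) S.φ := by
  constructor
  · rintro ⟨e, he⟩
    have h : ∀ r (x : InvDual A (C.X (2 * n - r))),
        e.hom.f r x = hypSharp S.φ (2 * n - r) r x := fun r x => hC.ext fun y => by
      rw [apply_hypSharp hC, he, star_star]
    have hq := HomotopyEquiv.isQI e
    constructor
    · intro p q hpq x hx hb
      obtain rfl : p = 2 * n - q := by omega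
      refine (isBd_ndual x).1 (hq.inj q _ ((isCyc_ndual x).2 hx) ?_)
      rwa [← h] at hb
    · intro p q hpq c hc
      obtain rfl : p = 2 * n - q := by omega
      obtain ⟨x, hx, hb⟩ := hq.surj q c hc
      refine ⟨x, (isCyc_ndual _).1 hx, ?_⟩
      rwa [← h]
  · intro h
    have hq : IsQI (hS.dualityMap hC) := by
      constructor
      · intro r x hx hb
        exact (isBd_ndual _).2 (h.inj _ _ (by ring) x ((isCyc_ndual _).1 hx) hb)
      · intro r c hc
        obtain ⟨x, hx, hb⟩ := h.surj (2 * n - r) r (by ring) c hc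
        exact ⟨x, (isCyc_ndual _).2 hx, hb⟩
    obtain ⟨e, he⟩ := hq.exists_homotopyEquiv (projective_ndual hC _) hC.proj 0
      (subsingleton_ndual hC) (fun r hr => hC.zero r (Or.inl hr))
    refine ⟨e, fun r x y => ?_⟩
    rw [he]
    show _ = star (y (hypSharp S.φ (2 * n - r) r x))
    rw [apply_hypSharp hC, star_star]

/-- The map `(ξ_0, ± φ_0 i^*) : D^{2n+1-*} → C(i)` induces isomorphisms in homology. -/
structure IsPairDuality (n : ℤ) (φ : Hyp (dualCx C)) (i : C ⟶ D) (ξ : Hyp (dualCx D)) : Prop where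
  inj : ∀ p q q', p + q = 2 * n + 1 → q' + 1 = q → ∀ x : InvDual A (D.X p), CoCyc D x →
    ∀ (y : D.X (q + 1)) (c : C.X q), hypSharp ξ p q x = D.d (q + 1) q y + i.f q c →
      hypSharp φ p q' (dualMap (i.f p).hom x) = - C.d q q' c → CoBd D x
  surj : ∀ p q q', p + q = 2 * n + 1 → q' + 1 = q → ∀ (y : D.X q) (c : C.X q'),
    D.d q q' y + i.f q' c = 0 → IsCyc C c → ∃ x : InvDual A (D.X p), CoCyc D x ∧
      ∃ (y' : D.X (q + 1)) (c' : C.X q), y = hypSharp ξ p q x + D.d (q + 1) q y' + i.f q c' ∧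
        c = hypSharp φ p q' (dualMap (i.f p).hom x) - C.d q q' c'

/-- The `s = 0` component of `dξ = -i_* φ`. It makes `(ξ_0, ± φ_0 i^*)` a chain map to the cone of
`i`, and later shows that the candidate lagrangian is isotropic. -/
theorem pair_d_sharp {S : StrData β n C} (hC : IsDim (2 * n) C) {i : C ⟶ D}
    (hD : IsDim (2 * n + 1) D) (E : StrEquiv (S.push i) 0) {p p' q q' : ℤ}
    (hp : p + 1 = p') (hq : q + 1 = q') (x : InvDual A (D.X p)) :
    D.d q' q (hypSharp E.ξ p q' x) + q.negOnePow • hypSharp E.ξ p' q (dualMap (D.d p' p).hom x)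
      + i.f q (hypSharp S.φ p q (dualMap (i.f p).hom x)) = 0 := by
  subst hp hq
  refine hD.ext fun y => ?_
  have h := hypD_zero_of_isSymm (m := 2 * n + 1) E.ξ_symm p q x y
  rw [← E.ξ_eq] at h
  rw [map_add, map_add, map_zero, map_units_smul, apply_hypSharp hD]
  show (dualMap (D.d (q + 1) q).hom y) _ + _ + (dualMap (i.f q).hom y) _ = 0
  rw [apply_hypSharp hD, apply_hypSharp hC, ← star_star_units, ← star_add, ← star_add, ← h]
  show star (((0 : Hyp (dualCx D)) 0 p q x y - S.φ 0 p q (dualMap (i.f p).hom x)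
    (dualMap (i.f q).hom y)) + _) = 0
  rw [sub_add_cancel]
  exact star_zero A

/-- The chain map `D^{2n+1-*} → C(i)`. -/
noncomputable def pairDualityMap {S : StrData β n C} (hS : S.IsStr) (hC : IsDim (2 * n) C)
    {i : C ⟶ D} (hD : IsDim (2 * n + 1) D) (E : StrEquiv (S.push i) 0) :
    ndual (2 * n + 1) D ⟶ cone i where
  f r := ModuleCat.ofHom (LinearMap.prod (hypSharp E.ξ (2 * n + 1 - r) r)
    ((r - 1).negOnePow • hypSharp S.φ (2 * n + 1 - r) (r - 1) ∘ₗ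
      dualMap (i.f (2 * n + 1 - r)).hom))
  comm' r s hrs := by
    obtain rfl : r - 1 = s := by
      have : s + 1 = r := by simpa using hrs
      omega
    refine ModuleCat.hom_ext (LinearMap.ext fun x => ?_)
    show (cone i).d r (r - 1) (_, _) = ((hypSharp E.ξ (2 * n + 1 - (r - 1)) (r - 1)
        ((ndual (2 * n + 1) D).d r (r - 1) x)), (r - 1 - 1).negOnePow •
        hypSharp S.φ (2 * n + 1 - (r - 1)) (r - 1 - 1)
        (dualMap (i.f (2 * n + 1 - (r - 1))).hom ((ndual (2 * n + 1) D).d r (r - 1) x)))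
    rw [cone_d_apply, ndual_d_apply]
    have e1 : r.negOnePow = -(r - 1).negOnePow := by
      rw [Int.negOnePow_sub, Int.negOnePow_one]; simp
    have e2 : (r - 1 - 1).negOnePow = -(r - 1).negOnePow := by
      rw [Int.negOnePow_sub (r - 1), Int.negOnePow_one]; simp
    refine Prod.ext ?_ ?_
    · show D.d r (r - 1) (hypSharp E.ξ (2 * n + 1 - r) r x) + (r - 1).negOnePow •
        i.f (r - 1) (castX C (r - 1) (r - 1) ((r - 1).negOnePow •
          hypSharp S.φ (2 * n + 1 - r) (r - 1) (dualMap (i.f (2 * n + 1 - r)).hom x))) = _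
      rw [castX_self]
      have h1 := map_units_smul (i.f (r - 1)).hom (r - 1).negOnePow
        (hypSharp S.φ (2 * n + 1 - r) (r - 1) (dualMap (i.f (2 * n + 1 - r)).hom x))
      erw [h1]
      rw [smul_smul, Int.units_mul_self, one_smul, map_units_smul, e1, Units.neg_smul]
      have := pair_d_sharp hC hD E (p' := 2 * n + 1 - (r - 1)) (by ring)
        (show r - 1 + 1 = r by ring) x
      have key : ∀ a b c : D.X (r - 1), a + b + c = 0 → a + c = - b := by
        intro a b c h
        rw [← sub_eq_zero, ← h]; abel
      exact key _ _ _ this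
    · show C.d (r - 1) (r - 1 - 1) ((r - 1).negOnePow •
        hypSharp S.φ (2 * n + 1 - r) (r - 1) (dualMap (i.f (2 * n + 1 - r)).hom x)) = _
      have h1 := map_units_smul (C.d (r - 1) (r - 1 - 1)).hom (r - 1).negOnePow
        (hypSharp S.φ (2 * n + 1 - r) (r - 1) (dualMap (i.f (2 * n + 1 - r)).hom x))
      erw [h1]
      have := hS.d_sharp hC (p := 2 * n + 1 - r) (p' := 2 * n + 1 - (r - 1)) (by ring)
        (show r - 1 - 1 + 1 = r - 1 by ring) (dualMap (i.f (2 * n + 1 - r)).hom x)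
      have h2 : dualMap (C.d (2 * n + 1 - (r - 1)) (2 * n + 1 - r)).hom
          (dualMap (i.f (2 * n + 1 - r)).hom x) = dualMap (i.f (2 * n + 1 - (r - 1))).hom
            (dualMap (D.d (2 * n + 1 - (r - 1)) (2 * n + 1 - r)).hom x) :=
        InvDual.ext fun y => congrArg x (chain_comm i _ _ y).symm
      rw [h2] at this
      erw [eq_neg_of_add_eq_zero_left this]
      rw [map_units_smul, map_units_smul, e2, e1, Units.neg_smul, Units.neg_smul, Units.neg_smul]
      simp only [Units.neg_smul, map_neg, map_units_smul, smul_neg, neg_neg]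

/-- `IsPairDuality` is the homology of the cone with its signs removed: an element `(y, c)` of cone
degree `r` is rewritten as `(y, (-1)^{r-1} c)`. With that substitution the two conditions say that
the duality map is a quasi-isomorphism. -/
theorem StrData.isBoundary_of {S : StrData β n C} (hC : IsDim (2 * n) C) (hS : S.IsStr)
    {i : C ⟶ D} (hD : IsDim (2 * n + 1) D) (E : StrEquiv (S.push i) 0)
    (h : IsPairDuality n S.φ i E.ξ) : S.IsBoundary := by
  have hq : IsQI (pairDualityMap hS hC hD E) := by
    constructor
    · intro r x hx hb
      obtain ⟨⟨y, c⟩, hyc⟩ : ∃ z : D.X (r + 1) × C.X (r + 1 - 1), _ := (isBd_iff rfl _).1 hb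
      rw [cone_d_apply] at hyc
      have h1 : D.d (r + 1) r y + (r + 1 - 1).negOnePow • i.f r (castX C (r + 1 - 1) r c)
        = hypSharp E.ξ (2 * n + 1 - r) r x := congrArg Prod.fst hyc
      have h2 : C.d (r + 1 - 1) (r - 1) c = (r - 1).negOnePow •
        hypSharp S.φ (2 * n + 1 - r) (r - 1) (dualMap (i.f (2 * n + 1 - r)).hom x) :=
        congrArg Prod.snd hyc
      refine (isBd_ndual _).2 (h.inj _ r (r - 1) (by ring) (by ring) x ((isCyc_ndual _).1 hx) y
        (r.negOnePow • castX C (r + 1 - 1) r c) ?_ ?_)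
      · rw [← h1, show (r + 1 - 1).negOnePow = r.negOnePow by congr 1; ring]
        congr 1
        exact (map_units_smul (i.f r).hom _ _).symm
      · have h3 := map_units_smul (C.d r (r - 1)).hom r.negOnePow (castX C (r + 1 - 1) r c)
        erw [h3]
        erw [d_castX (X := C) (i' := r - 1) (j' := r - 1) (by ring) rfl, h2]
        rw [castX_self, smul_smul, Int.negOnePow_sub, Int.negOnePow_one]
        simp
    · intro r z hz
      obtain ⟨y, c⟩ : D.X r × C.X (r - 1) := z
      have hz := hz (r - 1)
      rw [cone_d_apply] at hz
      have h1 : D.d r (r - 1) y + (r - 1).negOnePow • i.f (r - 1) (castX C (r - 1) (r - 1) c) = 0 :=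
        congrArg Prod.fst hz
      have h2 : C.d (r - 1) (r - 1 - 1) c = 0 := congrArg Prod.snd hz
      have hc : IsCyc C c := (isCyc_iff (by ring) _).2 h2
      rw [castX_self] at h1
      obtain ⟨x, hx, y', c', e1, e2⟩ := h.surj (2 * n + 1 - r) r (r - 1) (by ring) (by ring) y
        ((r - 1).negOnePow • c) (by
          rw [← h1]; congr 1
          exact map_units_smul (i.f (r - 1)).hom _ _) (hc.units_smul _)
      refine ⟨x, (isCyc_ndual _).2 hx, r + 1, ((y', r.negOnePow • castX C r (r + 1 - 1) c') :
        D.X (r + 1) × C.X (r + 1 - 1)), ?_⟩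
      rw [cone_d_apply]
      refine Prod.ext ?_ ?_
      · show D.d (r + 1) r y' + (r + 1 - 1).negOnePow • i.f r (castX C (r + 1 - 1) r
          (r.negOnePow • castX C r (r + 1 - 1) c')) = y - hypSharp E.ξ (2 * n + 1 - r) r x
        rw [add_sub_cancel_right (a := r), map_units_smul, castX_castX (by ring), castX_self, e1]
        have h3 := map_units_smul (i.f r).hom r.negOnePow c'
        erw [h3]
        rw [smul_smul, Int.units_mul_self, one_smul]
        show _ + i.f r c' = _
        abel
      · show C.d (r + 1 - 1) (r - 1) (r.negOnePow • castX C r (r + 1 - 1) c')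
          = c - (r - 1).negOnePow •
          hypSharp S.φ (2 * n + 1 - r) (r - 1) (dualMap (i.f (2 * n + 1 - r)).hom x)
        have h3 := map_units_smul (C.d (r + 1 - 1) (r - 1)).hom r.negOnePow
          (castX C r (r + 1 - 1) c')
        erw [h3]
        erw [d_castX (X := C) (i' := r - 1) (j' := r - 1) (by ring) rfl]
        rw [units_smul_eq_iff] at e2
        rw [e2, castX_self, smul_sub, sub_sub_cancel_left, Int.negOnePow_sub, Int.negOnePow_one]
        simp
  obtain ⟨e, he⟩ := hq.exists_homotopyEquiv (projective_ndual hD _)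
    (fun r => by
      have := hD.proj r; have := hC.proj (r - 1)
      exact inferInstanceAs (Module.Projective A (D.X r × C.X (r - 1)))) 0
    (subsingleton_ndual hD) (fun r hr => by
      have := hD.zero r (Or.inl hr); have := hC.zero (r - 1) (by omega)
      exact inferInstanceAs (Subsingleton (D.X r × C.X (r - 1))))
  refine ⟨D, hD, i, E, e, fun r x => ⟨fun y => ?_, fun y => ?_⟩⟩
  · rw [he]
    show _ = star (y (hypSharp E.ξ (2 * n + 1 - r) r x))
    rw [apply_hypSharp hD, star_star]
  · rw [he]
    show _ = star (y ((r - 1).negOnePow •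
      hypSharp S.φ (2 * n + 1 - r) (r - 1) (dualMap (i.f (2 * n + 1 - r)).hom x)))
    rw [map_units_smul, apply_hypSharp hC, star_star_units, star_star]

/-- The converse passage, with the same change of sign in the `C`-component. -/
theorem StrData.IsBoundary.exists {S : StrData β n C} (hC : IsDim (2 * n) C) (h : S.IsBoundary) :
    ∃ (D : ChainComplex (ModuleCat.{u} A) ℤ) (_ : IsDim (2 * n + 1) D) (i : C ⟶ D)
      (E : StrEquiv (S.push i) 0), IsPairDuality n S.φ i E.ξ := by
  obtain ⟨D, hD, i, E, e, he⟩ := h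
  refine ⟨D, hD, i, E, ?_⟩
  have h1 : ∀ r (x : InvDual A (D.X (2 * n + 1 - r))),
      e.hom.f r x = ((hypSharp E.ξ (2 * n + 1 - r) r x, (r - 1).negOnePow •
      hypSharp S.φ (2 * n + 1 - r) (r - 1) (dualMap (i.f (2 * n + 1 - r)).hom x)) :
      D.X r × C.X (r - 1)) := fun r x => by
    refine Prod.ext (hD.ext fun y => ?_) (hC.ext fun y => ?_)
    · have := (he r x).1 y
      rw [apply_hypSharp hD, this, star_star]
    · have := (he r x).2 y
      rw [map_units_smul, apply_hypSharp hC, ← star_star_units, this, star_star]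
  have hq := HomotopyEquiv.isQI e
  constructor
  · intro p q q' hpq hq' x hx y c e1 e2
    obtain rfl : p = 2 * n + 1 - q := by omega
    obtain rfl : q' = q - 1 := by omega
    refine (isBd_ndual x).1 (hq.inj q _ ((isCyc_ndual x).2 hx) ⟨q + 1,
      ((y, q.negOnePow • castX C q (q + 1 - 1) c) : D.X (q + 1) × C.X (q + 1 - 1)), ?_⟩)
    rw [h1, cone_d_apply]
    refine Prod.ext ?_ ?_
    · show D.d (q + 1) q y + (q + 1 - 1).negOnePow • i.f q (castX C (q + 1 - 1) q
          (q.negOnePow • castX C q (q + 1 - 1) c)) = hypSharp E.ξ (2 * n + 1 - q) q x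
      rw [add_sub_cancel_right (a := q), map_units_smul, castX_castX (by ring), castX_self, e1]
      have h3 := map_units_smul (i.f q).hom q.negOnePow c
      erw [h3]
      rw [smul_smul, Int.units_mul_self, one_smul]
    · show C.d (q + 1 - 1) (q - 1) (q.negOnePow • castX C q (q + 1 - 1) c) = (q - 1).negOnePow •
          hypSharp S.φ (2 * n + 1 - q) (q - 1) (dualMap (i.f (2 * n + 1 - q)).hom x)
      have h3 := map_units_smul (C.d (q + 1 - 1) (q - 1)).hom q.negOnePow
          (castX C q (q + 1 - 1) c)
      erw [h3]
      erw [d_castX (X := C) (i' := q - 1) (j' := q - 1) (by ring) rfl]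
      rw [e2, castX_self, Int.negOnePow_sub, Int.negOnePow_one]
      simp
  · intro p q q' hpq hq' y c e1 hc
    obtain rfl : p = 2 * n + 1 - q := by omega
    obtain rfl : q' = q - 1 := by omega
    obtain ⟨x, hx, hb⟩ := hq.surj q ((y, (q - 1).negOnePow • c) : D.X q × C.X (q - 1)) (by
      refine (isCyc_iff (j := q - 1) (by ring) _).2 ?_
      rw [cone_d_apply]
      refine Prod.ext ?_ ?_
      · show D.d q (q - 1) y + (q - 1).negOnePow • i.f (q - 1) (castX C (q - 1) (q - 1)
          ((q - 1).negOnePow • c)) = 0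
        rw [castX_self, ← e1]
        have h3 := map_units_smul (i.f (q - 1)).hom (q - 1).negOnePow c
        erw [h3]
        rw [smul_smul, Int.units_mul_self, one_smul]
      · exact (hc.units_smul _) _)
    obtain ⟨⟨y', c'⟩, hyc⟩ : ∃ z : D.X (q + 1) × C.X (q + 1 - 1), _ := (isBd_iff rfl _).1 hb
    rw [h1, cone_d_apply] at hyc
    have h2 : D.d (q + 1) q y' + (q + 1 - 1).negOnePow • i.f q (castX C (q + 1 - 1) q c')
        = y - hypSharp E.ξ (2 * n + 1 - q) q x := congrArg Prod.fst hyc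
    have h3 : C.d (q + 1 - 1) (q - 1) c' = (q - 1).negOnePow • c - (q - 1).negOnePow •
        hypSharp S.φ (2 * n + 1 - q) (q - 1) (dualMap (i.f (2 * n + 1 - q)).hom x) :=
        congrArg Prod.snd hyc
    refine ⟨x, (isCyc_ndual _).1 hx, y', q.negOnePow • castX C (q + 1 - 1) q c', ?_, ?_⟩
    · rw [show (q + 1 - 1).negOnePow = q.negOnePow by congr 1; ring] at h2
      have h4 := map_units_smul (i.f q).hom q.negOnePow (castX C (q + 1 - 1) q c')
      erw [h4]
      rw [eq_sub_iff_add_eq] at h2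
      rw [← h2]
      show _ = _ + _ + q.negOnePow • i.f q (castX C (q + 1 - 1) q c')
      abel
    · have h4 := map_units_smul (C.d q (q - 1)).hom q.negOnePow (castX C (q + 1 - 1) q c')
      erw [h4]
      erw [d_castX (X := C) (i' := q - 1) (j' := q - 1) (by ring) rfl, h3]
      rw [castX_self, ← smul_sub, smul_smul, Int.negOnePow_sub, Int.negOnePow_one]
      simp

end Duality

/-! ### The group of structures on a fixed complex. -/

section StructureGroup

variable {A : Type u} [Ring A] [StarRing A] {X Y Z : CochainComplex (ModuleCat.{u} A) ℤ}
  {C D E : ChainComplex (ModuleCat.{u} A) ℤ} {β : ChainBundle A} {n : ℤ}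

theorem hypBracket_add_left (u u' v : X ⟶ Y) (θ : Hyp Y) :
    hypBracket (u + u') v θ = hypBracket u v θ + hypBracket u' v θ := by
  refine hyp_ext fun s p q x y => ?_
  simp only [Pi.add_apply, LinearMap.add_apply, InvDual.add_apply, hypBracket_apply, add_f_apply,
    map_add, star_add, smul_add, neg_add]

theorem hypBracket_add_right (u v v' : X ⟶ Y) (θ : Hyp Y) :
    hypBracket u (v + v') θ = hypBracket u v θ + hypBracket u v' θ := by
  refine hyp_ext fun s p q x y => ?_
  simp only [Pi.add_apply, LinearMap.add_apply, InvDual.add_apply, hypBracket_apply, add_f_apply,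
    map_add, star_add, smul_add, neg_add]

theorem hypBracket_zero_left (v : X ⟶ Y) (θ : Hyp Y) : hypBracket 0 v θ = 0 := by
  have := hypBracket_add_left 0 0 v θ
  rwa [add_zero, left_eq_add] at this

theorem hypBracket_zero_right (v : X ⟶ Y) (θ : Hyp Y) : hypBracket v 0 θ = 0 := by
  have := hypBracket_add_right v 0 0 θ
  rwa [add_zero, left_eq_add] at this

theorem hypBracket_neg_left (u v : X ⟶ Y) (θ : Hyp Y) :
    hypBracket (-u) v θ = -hypBracket u v θ := by
  rw [eq_neg_iff_add_eq_zero, ← hypBracket_add_left, neg_add_cancel, hypBracket_zero_left]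

theorem hypBracket_neg_right (u v : X ⟶ Y) (θ : Hyp Y) :
    hypBracket u (-v) θ = -hypBracket u v θ := by
  rw [eq_neg_iff_add_eq_zero, ← hypBracket_add_right, neg_add_cancel, hypBracket_zero_right]

theorem hypBracket_comp (w : Z ⟶ X) (u v : X ⟶ Y) (θ : Hyp Y) :
    hypBracket (w ≫ u) (w ≫ v) θ = hypPull w (hypBracket u v θ) := by
  refine hyp_ext fun s p q x y => ?_
  show _ = hypBracket u v θ s p q (w.f p x) (w.f q y)
  rw [hypBracket_apply, hypBracket_apply]
  rfl

@[ext] theorem StrData.ext {S S' : StrData β n C} (h1 : S.φ = S'.φ) (h2 : S.θ = S'.θ)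
    (h3 : S.f = S'.f) : S = S' := by
  cases S; cases S'; congr

theorem StrData.add_φ (S S' : StrData β n C) : (S + S').φ = S.φ + S'.φ := rfl
theorem StrData.add_θ (S S' : StrData β n C) :
    (S + S').θ = S.θ + S'.θ + hypBracket S.f S'.f (susp β (2 * n)) := rfl
theorem StrData.add_f (S S' : StrData β n C) : (S + S').f = S.f + S'.f := rfl
theorem StrData.neg_φ (S : StrData β n C) : (-S).φ = -S.φ := rfl
theorem StrData.neg_θ (S : StrData β n C) :
    (-S).θ = -S.θ - hypBracket S.f (-S.f) (susp β (2 * n)) := rfl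
theorem StrData.neg_f (S : StrData β n C) : (-S).f = -S.f := rfl
theorem StrData.zero_φ : (0 : StrData β n C).φ = 0 := rfl
theorem StrData.zero_θ : (0 : StrData β n C).θ = 0 := rfl
theorem StrData.zero_f : (0 : StrData β n C).f = 0 := rfl

/-- The bracket is biadditive, hence a 2-cocycle, and the twisted addition is strictly associative
with strict inverses. Commutativity holds only up to equivalence, so this is not an `AddCommGroup`
and the order of summands matters below. -/
instance : AddGroup (StrData β n C) where
  add_assoc S S' S'' := by
    ext1
    · exact add_assoc _ _ _
    · simp only [StrData.add_θ, StrData.add_f, hypBracket_add_left, hypBracket_add_right]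
      abel
    · exact add_assoc _ _ _
  zero_add S := by
    ext1
    · exact zero_add _
    · simp only [StrData.add_θ, StrData.zero_θ, StrData.zero_f, hypBracket_zero_left, zero_add,
        add_zero]
    · exact zero_add _
  add_zero S := by
    ext1
    · exact add_zero _
    · simp only [StrData.add_θ, StrData.zero_θ, StrData.zero_f, hypBracket_zero_right,
        add_zero]
    · exact add_zero _
  neg_add_cancel S := by
    ext1
    · exact neg_add_cancel _
    · simp only [StrData.add_θ, StrData.neg_θ, StrData.neg_f, StrData.zero_θ,
        hypBracket_neg_left, hypBracket_neg_right]
      abel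
    · exact neg_add_cancel _
  nsmul := nsmulRec
  zsmul := zsmulRec

theorem StrData.push_add (v : C ⟶ D) (S S' : StrData β n C) :
    (S + S').push v = S.push v + S'.push v := by
  ext1
  · rfl
  · show hypPull _ (_ + _ + _) = hypPull _ _ + hypPull _ _ + hypBracket (_ ≫ _) (_ ≫ _) _
    rw [hypBracket_comp]; rfl
  · exact Preadditive.comp_add _ _ _ _ _ _

theorem StrData.push_zero (v : C ⟶ D) : (0 : StrData β n C).push v = 0 := by
  ext1
  · rfl
  · rfl
  · exact Limits.comp_zero

theorem StrData.push_neg (v : C ⟶ D) (S : StrData β n C) : (-S).push v = -S.push v := by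
  rw [eq_neg_iff_add_eq_zero, ← push_add, neg_add_cancel, push_zero]

theorem StrData.push_push (v : C ⟶ D) (w : D ⟶ E) (S : StrData β n C) :
    (S.push v).push w = S.push (v ≫ w) := rfl

theorem StrData.push_id (S : StrData β n C) : S.push (𝟙 C) = S := by
  ext1
  · rfl
  · rfl
  · exact Category.id_comp _

/-- The boundary of `[f, -f]` is `f^% + (-f)^%`, because the pullback along `f + (-f) = 0` vanishes.
This is what the term `-[f, -f]` in the negative compensates. -/
theorem StrData.IsStr.neg {S : StrData β n C} (hS : S.IsStr) : (-S).IsStr where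
  φ_chain s p q h := by
    show -(S.φ s p q) = 0
    rw [hS.φ_chain s p q h, neg_zero]
  φ_symm s p q h := by
    show -(S.φ s p q) = 0
    rw [hS.φ_symm s p q h, neg_zero]
  θ_chain s p q h := by
    show -(S.θ s p q) - hypBracket S.f (-S.f) (susp β (2 * n)) s p q = 0
    rw [hS.θ_chain s p q h, neg_zero, zero_sub, neg_eq_zero]
    refine LinearMap.ext fun x => InvDual.ext fun y => ?_
    rw [hypBracket_apply, susp, β.β_deg _ _ _ (by omega)]
    simp
  φ_cycle := by
    rw [StrData.neg_φ, hypD_neg, hS.φ_cycle, neg_zero]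
  eq := by
    rw [StrData.neg_φ, StrData.neg_θ, StrData.neg_f, hypD_sub, hypD_neg, ← hS.eq,
      hypD_bracket n _ _ _ (hypD_susp n), add_neg_cancel]
    have : hypPull (0 : dualCx C ⟶ bundleCx (2 * n) β.B) (susp β (2 * n)) = 0 := by
      refine hyp_ext fun s p q x y => ?_
      show susp β (2 * n) s p q 0 _ = 0
      rw [map_zero]; rfl
    rw [this]
    abel

theorem StrData.isStr_zero : (0 : StrData β n C).IsStr where
  φ_chain s p q h := rfl
  φ_symm s p q h := rfl
  θ_chain s p q h := rfl
  φ_cycle := by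
    have := hypD_add (X := dualCx C) (2 * n) 0 0
    rwa [add_zero, left_eq_add] at this
  eq := by
    have := hypD_add (X := dualCx C) (2 * n + 1) 0 0
    rw [add_zero, left_eq_add] at this
    refine Eq.trans ?_ this.symm
    refine hyp_ext fun s p q x y => ?_
    show 0 - susp β (2 * n) s p q 0 _ = 0
    rw [map_zero, sub_eq_zero]; rfl

/-- Transport of an equivalence along equalities. -/
def StrEquiv.copy {S S' T T' : StrData β n C} (E : StrEquiv S S') (h : S = T) (h' : S' = T') :
    StrEquiv T T' where
  ξ := E.ξ
  η := E.η
  h := E.h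
  ξ_chain := E.ξ_chain
  ξ_symm := E.ξ_symm
  η_chain := E.η_chain
  h_eq := by subst h h'; exact E.h_eq
  ξ_eq := by subst h h'; exact E.ξ_eq
  η_eq := by subst h h'; exact E.η_eq

/-- The pushforward of an equivalence. -/
def StrEquiv.push (v : C ⟶ D) {S S' : StrData β n C} (E : StrEquiv S S') :
    StrEquiv (S.push v) (S'.push v) where
  ξ := hypPull (dualCxMap v) E.ξ
  η := hypPull (dualCxMap v) E.η
  h p := E.h p ∘ₗ ((dualCxMap v).f p).hom
  ξ_chain s p q h := by
    rw [hypPull, hypCross, E.ξ_chain s p q h]; rfl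
  ξ_symm s p q h := by
    rw [hypPull, hypCross, E.ξ_symm s p q h]; rfl
  η_chain s p q h := by
    rw [hypPull, hypCross, E.η_chain s p q h]; rfl
  h_eq p x := by
    have h := E.h_eq p ((dualCxMap v).f p x)
    rw [cochain_comm] at h
    exact h
  ξ_eq := by
    rw [hypD_pull, ← E.ξ_eq]; rfl
  η_eq := by
    rw [hypD_pull, ← E.η_eq]; rfl

theorem hypHtpy_zero (m : ℤ) (u v : X ⟶ Y) (θ : Hyp Y) : hypHtpy m u v 0 θ = 0 := by
  refine hyp_ext fun s p q x y => ?_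
  simp only [hypHtpy]
  rcases Int.units_eq_one_or q.negOnePow with e | e <;>
  rcases Int.units_eq_one_or (m - 1 + q).negOnePow with e' | e' <;> rw [e, e'] <;> simp

theorem hypD_zero (m : ℤ) : hypD m (0 : Hyp X) = 0 := by
  have := hypD_add (X := X) m 0 0
  rwa [add_zero, left_eq_add] at this

/-- An equivalence with `ξ = 0`, `h = 0`. -/
def StrEquiv.ofBoundary (T : StrData β n C) (hφ : T.φ = 0) (hf : T.f = 0) (η : Hyp (dualCx C))
    (hη : IsChain (2 * n + 2) η) (h : T.θ = hypD (2 * n + 2) η) : StrEquiv T 0 where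
  ξ := 0
  η := η
  h := 0
  ξ_chain _ _ _ _ := rfl
  ξ_symm _ _ _ _ := rfl
  η_chain := hη
  h_eq p x := by
    rw [hf, StrData.zero_f]
    show (0 : (bundleCx (2 * n) β.B).X p) - 0 = (bundleCx (2 * n) β.B).d (p - 1) p 0
      + (ModuleCat.Hom.hom ((bundleCx (2 * n) β.B).XIsoOfEq (add_sub_cancel_right p 1)).hom) 0
    rw [map_zero, map_zero, sub_zero, add_zero]
  ξ_eq := by rw [hφ, hypD_zero]; exact sub_zero _
  η_eq := by rw [hypHtpy_zero, ← h, StrData.zero_θ]; simp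

/-- The cycle condition for `θ` in degree `s + 2`, evaluated at `(u x, v y)`: the transposition
terms that it leaves are `θ_{s+1}(u x, v y)` and its transpose, which are the two brackets. It is
the source of commutativity up to equivalence. -/
theorem hypD_cross (n : ℤ) (u v : X ⟶ Y) (θ : Hyp Y) (hθ : hypD (2 * n) θ = 0) :
    hypD (2 * n + 2) (fun s p q => hypCross u v θ (s + 2) p q)
      = hypBracket u v θ - hypBracket v u θ := by
  refine hyp_ext fun s p q x y => ?_
  rw [hypD_apply]
  have h : hypD (2 * n) θ (s + 2) p q (u.f p x) (v.f q y) = 0 := by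
    rw [hθ]; rfl
  rw [hypD_apply] at h
  simp only [hypBracket_apply, cochain_comm, Pi.sub_apply,
    LinearMap.sub_apply, InvDual.sub_apply, hypCross_apply] at h ⊢
  have e : s + 2 - 1 = s + 1 := by ring
  have e' : s - 1 + 2 = s + 1 := by ring
  rw [e] at h
  rw [e']
  by_cases hp : Even p <;> by_cases hq : Even q <;> by_cases hs : Even s <;>
  simp only [negOnePow_ite, Int.even_add, Int.even_sub, Int.even_mul, hp, hq, hs,
    even_two, true_or, or_true, or_false, or_self, iff_true, true_iff, iff_false, false_iff,
    if_true, if_false, Int.not_even_one, not_true, not_false_iff, iff_self, one_smul,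
    Units.neg_smul, not_not] at h ⊢ <;>
  · rw [← sub_eq_zero] at h ⊢
    rw [← h]
    abel

/-- Addition of structures is commutative up to equivalence. -/
def StrEquiv.addComm (S S' : StrData β n C) : StrEquiv (S + S' + -(S' + S)) 0 :=
  .ofBoundary _ (by simp only [StrData.add_φ, StrData.neg_φ]; abel)
    (by simp only [StrData.add_f, StrData.neg_f]; abel)
    (fun s p q => hypCross S.f S'.f (susp β (2 * n)) (s + 2) p q)
    (fun s p q h => by
      refine LinearMap.ext fun x => InvDual.ext fun y => ?_
      rw [hypCross_apply, susp, β.β_deg _ _ _ (by omega)]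
      simp)
    (by
      rw [hypD_cross n _ _ _ (hypD_susp n)]
      simp only [StrData.add_θ, StrData.neg_θ, StrData.add_f, StrData.neg_f, neg_add,
        hypBracket_add_left, hypBracket_add_right, hypBracket_neg_right]
      abel)

/-- The equivalence from a structure which is equal to `0`. -/
def StrEquiv.ofEqZero (T : StrData β n C) (h : T = 0) : StrEquiv T 0 :=
  .ofBoundary T (by rw [h]; rfl) (by rw [h]; rfl) 0 (fun _ _ _ _ => rfl)
    (by rw [h, hypD_zero]; rfl)

end StructureGroup

/-! ### Naturality of the duality morphism and duals of direct sums. -/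

section SharpLemmas

variable {A : Type u} [Ring A] [StarRing A] {C D : ChainComplex (ModuleCat.{u} A) ℤ} {m k : ℤ}

theorem hypSharp_add (hC : IsDim m C) (φ φ' : Hyp (dualCx C)) (p q : ℤ) (x : InvDual A (C.X p)) :
    hypSharp (φ + φ') p q x = hypSharp φ p q x + hypSharp φ' p q x := hC.ext fun y => by
  rw [map_add, apply_hypSharp hC, apply_hypSharp hC, apply_hypSharp hC, ← star_add]; rfl

theorem hypSharp_neg (hC : IsDim m C) (φ : Hyp (dualCx C)) (p q : ℤ) (x : InvDual A (C.X p)) :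
    hypSharp (-φ) p q x = -hypSharp φ p q x := hC.ext fun y => by
  rw [map_neg, apply_hypSharp hC, apply_hypSharp hC, ← star_neg]; rfl

theorem hypSharp_zero (hC : IsDim m C) (p q : ℤ) (x : InvDual A (C.X p)) :
    hypSharp (0 : Hyp (dualCx C)) p q x = 0 := hC.ext fun y => by
  rw [map_zero, apply_hypSharp hC]; exact star_zero A

theorem hypSharp_pull (hC : IsDim m C) (hD : IsDim k D) (v : C ⟶ D) (φ : Hyp (dualCx C)) (p q : ℤ)
    (x : InvDual A (D.X p)) :
    hypSharp (hypPull (dualCxMap v) φ) p q x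
      = v.f q (hypSharp φ p q (dualMap (v.f p).hom x)) := hD.ext fun y => by
  rw [apply_hypSharp hD]
  exact (apply_hypSharp hC φ p q (dualMap (v.f p).hom x) (dualMap (v.f q).hom y)).symm

theorem IsDim.mono {C : ChainComplex (ModuleCat.{u} A) ℤ} (hC : IsDim m C) (h : m ≤ k) :
    IsDim k C where
  fin := hC.fin
  proj := hC.proj
  zero r hr := hC.zero r (by omega)

theorem dualMap_f_of_eq {u v : C ⟶ D} (h : u = v) (p : ℤ) (x : InvDual A (D.X p)) :
    dualMap (u.f p).hom x = dualMap (v.f p).hom x := by rw [h]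

theorem CoBd.add {p : ℤ} {x y : InvDual A (C.X p)} (hx : CoBd C x) (hy : CoBd C y) :
    CoBd C (x + y) := by
  rw [coBd_iff (sub_add_cancel p 1)] at *
  obtain ⟨c, rfl⟩ := hx
  obtain ⟨c', rfl⟩ := hy
  exact ⟨c + c', map_add _ _ _⟩

theorem dual_dsum_eq (p : ℤ) (x : InvDual A ((dsum C D).X p)) :
    x = dualMap ((dfst C D).f p).hom (dualMap ((dinl C D).f p).hom x)
      + dualMap ((dsnd C D).f p).hom (dualMap ((dinr C D).f p).hom x) := by
  refine InvDual.ext fun (y : C.X p × D.X p) => ?_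
  show x y = x (y.1, 0) + x (0, y.2)
  rw [← map_add]
  exact congrArg x (by simp)

end SharpLemmas


/-! ### The cobordism group `L⟨B, β⟩^{2n}(A)`. -/

section LGroup

variable {A : Type u} [Ring A] [StarRing A] {C D : ChainComplex (ModuleCat.{u} A) ℤ}
  {β : ChainBundle A} {n : ℤ}

theorem PoincareCx.duality (E : PoincareCx β n) : IsDuality (2 * n) E.S.φ :=
  (StrData.isPoincare_iff E.dim E.isStr).1 E.poincare

/-- The complex `(C, -φ, -θ, -f)`. -/
def PoincareCx.neg (E : PoincareCx β n) : PoincareCx β n where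
  C := E.C
  dim := E.dim
  S := -E.S
  isStr := E.isStr.neg
  poincare := by
    refine (StrData.isPoincare_iff E.dim E.isStr.neg).2 ⟨fun p q h x hx hb => ?_,
      fun p q h c hc => ?_⟩
    · rw [StrData.neg_φ, hypSharp_neg E.dim] at hb
      refine E.duality.inj p q h x hx ?_
      rw [← neg_neg (hypSharp _ _ _ _)]
      exact hb.neg
    · obtain ⟨x, hx, hb⟩ := E.duality.surj p q h c hc
      refine ⟨-x, hx.neg, ?_⟩
      rwa [StrData.neg_φ, hypSharp_neg E.dim, map_neg, neg_neg]

variable (A) in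
/-- The zero complex. -/
@[reducible] def zeroCx : ChainComplex (ModuleCat.{u} A) ℤ where
  X _ := ModuleCat.of A PUnit.{u+1}
  d _ _ := 0

theorem isDim_zeroCx (m : ℤ) : IsDim m (zeroCx A) where
  fin _ := inferInstanceAs (Module.Finite A PUnit.{u+1})
  proj _ := inferInstanceAs (Module.Projective A PUnit.{u+1})
  zero _ _ := inferInstanceAs (Subsingleton PUnit.{u+1})

variable (β n) in
/-- The zero Poincaré complex. -/
def PoincareCx.zero : PoincareCx β n where
  C := zeroCx A
  dim := isDim_zeroCx _
  S := 0
  isStr := StrData.isStr_zero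
  poincare := by
    have hs : ∀ r, Subsingleton ((zeroCx A).X r) := fun _ =>
      inferInstanceAs (Subsingleton PUnit.{u+1})
    refine (StrData.isPoincare_iff (isDim_zeroCx _) StrData.isStr_zero).2
      ⟨fun p q h x hx hb => ?_, fun p q h c hc => ?_⟩
    · have : x = 0 := InvDual.ext fun y => by
        rw [Subsingleton.elim (α := (zeroCx A).X p) y 0, map_zero, InvDual.zero_apply]
      rw [this]; exact coBd_zero
    · exact ⟨0, coCyc_zero, 0, 0, Subsingleton.elim (α := (zeroCx A).X q) _ _⟩

theorem PoincareCx.cobordant_iff (E E' : PoincareCx β n) :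
    E.Cobordant E' ↔ (E.sum E'.neg).S.IsBoundary := Iff.rfl

/-- Isomorphic Poincaré complexes are cobordant; the structures need only agree up to an
equivalence with `ξ = 0`. -/
theorem PoincareCx.cobordant_of_iso (E E' : PoincareCx β n) (u : E.C ⟶ E'.C) (v : E'.C ⟶ E.C)
    (huv : u ≫ v = 𝟙 _) (hvu : v ≫ u = 𝟙 _) (e : StrEquiv (E.S.push u + -E'.S) 0)
    (hξ : e.ξ = 0) : E.Cobordant E' := by
  -- The cobordism is the mapping cylinder of `u`: `D = E'.C`, with `i = (u, 1)` on `E.C ⊕ E'.C`.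
  -- The pushforward along `i` is the difference of the two structures on `E'.C`.
  have hpush : E.S.push u + -E'.S = (E.sum E'.neg).S.push (dfst E.C E'.C ≫ u + dsnd E.C E'.C) := by
    show _ = (E.S.push (dinl E.C E'.C) + (-E'.S).push (dinr E.C E'.C)).push _
    rw [StrData.push_add, StrData.push_push, StrData.push_push, Preadditive.comp_add,
      Preadditive.comp_add, ← Category.assoc, ← Category.assoc, dinl_dfst, dinl_dsnd, dinr_dfst,
      dinr_dsnd, Category.id_comp, Limits.zero_comp, add_zero, zero_add, StrData.push_id]
  -- With `ξ = 0` the symmetric parts correspond strictly under `u`, so the duality of the pair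
  -- reduces to that of `E`.
  have hφ : E'.S.φ = hypPull (dualCxMap u) E.S.φ := by
    have h := e.ξ_eq
    rw [hξ, hypD_zero, StrData.zero_φ, zero_sub, neg_eq_zero, StrData.add_φ, StrData.neg_φ,
      ← sub_eq_add_neg, sub_eq_zero] at h
    exact h.symm
  have hP' : ∀ p q x, hypSharp E'.S.φ p q x
      = u.f q (hypSharp E.S.φ p q (dualMap (u.f p).hom x)) := fun p q x => by
    rw [hφ, hypSharp_pull E.dim E'.dim]
  have hsum : ∀ p q (x : InvDual A ((dsum E.C E'.C).X p)),
      hypSharp (E.sum E'.neg).S.φ p q x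
        = (hypSharp E.S.φ p q (dualMap ((dinl E.C E'.C).f p).hom x),
          - hypSharp E'.S.φ p q (dualMap ((dinr E.C E'.C).f p).hom x)) := by
    intro p q x
    have := hypSharp_add (E.sum E'.neg).dim (hypPull (dualCxMap (dinl E.C E'.C)) E.S.φ)
      (hypPull (dualCxMap (dinr E.C E'.C)) (-E'.S.φ)) p q x
    refine this.trans ?_
    have h1 := hypSharp_pull E.dim (E.sum E'.neg).dim (dinl E.C E'.C) E.S.φ p q x
    have h2 := hypSharp_pull E'.dim (E.sum E'.neg).dim (dinr E.C E'.C) (-E'.S.φ) p q x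
    rw [hypSharp_neg E'.dim] at h2
    erw [h1, h2]
    exact Prod.ext (add_zero _) (zero_add _)
  refine StrData.isBoundary_of (E.sum E'.neg).dim (E.sum E'.neg).isStr
    (i := dfst E.C E'.C ≫ u + dsnd E.C E'.C)
    (E'.dim.mono (by omega)) (e.copy hpush rfl) ?_
  have huv' : ∀ p (x : InvDual A (E.C.X p)), dualMap (u.f p).hom (dualMap (v.f p).hom x) = x :=
    fun p x => dualMap_f_of_eq huv p x
  have hvu' : ∀ p (x : InvDual A (E'.C.X p)), dualMap (v.f p).hom (dualMap (u.f p).hom x) = x :=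
    fun p x => dualMap_f_of_eq hvu p x
  have hil : ∀ p (x : InvDual A (E'.C.X p)), dualMap ((dinl E.C E'.C).f p).hom
      (dualMap ((dfst E.C E'.C ≫ u + dsnd E.C E'.C).f p).hom x) = dualMap (u.f p).hom x := by
    intro p x
    refine InvDual.ext fun y => ?_
    show x (u.f p y + 0) = x (u.f p y)
    rw [add_zero]
  have hir : ∀ p (x : InvDual A (E'.C.X p)), dualMap ((dinr E.C E'.C).f p).hom
      (dualMap ((dfst E.C E'.C ≫ u + dsnd E.C E'.C).f p).hom x) = x := by
    intro p x
    refine InvDual.ext fun y => ?_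
    show x (u.f p 0 + y) = x y
    rw [map_zero, zero_add]
  constructor
  · intro p q q' hpq hq' x hx y c _ h2
    replace h2 := (hsum p q' _).symm.trans h2
    have h3 : hypSharp E.S.φ p q' (dualMap ((dinl E.C E'.C).f p).hom _) = -E.C.d q q' c.1 :=
      congrArg Prod.fst h2
    rw [hil] at h3
    have h4 := (E.duality.inj p q' (by omega) _ (hx.map u)
      ⟨q, -c.1, by rw [h3, map_neg]⟩).map v
    rwa [hvu'] at h4
  · intro p q q' hpq hq' y c h1 hc
    obtain ⟨c1, c2⟩ : E.C.X q' × E'.C.X q' := c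
    have h1 : E'.C.d q q' y + (u.f q' c1 + c2) = 0 := h1
    have hc1 : IsCyc E.C c1 := fun j => congrArg Prod.fst (hc j)
    obtain ⟨x0, hx0, hb⟩ := E.duality.surj p q' (by omega) c1 hc1
    obtain ⟨c', hc'⟩ := (isBd_iff hq' _).1 hb
    -- A class dual to `c1` is carried to `E'.C` by `v^*`. Since `ξ = 0`, the `D`-component `y` must
    -- come from the second summand of the `C`-chain through `i`.
    refine ⟨dualMap (v.f p).hom x0, hx0.map v, 0,
      ((-c', y + u.f q c') : E.C.X q × E'.C.X q), ?_, ?_⟩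
    · show y = hypSharp e.ξ p q _ + _ + (u.f q (-c') + (y + u.f q c'))
      rw [hξ, hypSharp_zero E'.dim, map_zero, map_neg]
      abel
    · refine Eq.trans ?_ (congrArg (· - _) (hsum p q' _).symm)
      rw [hil, hir, huv', hP', huv']
      refine Prod.ext ?_ ?_
      · show c1 = hypSharp E.S.φ p q' x0 - E.C.d q q' (-c')
        rw [map_neg, hc']; abel
      · show c2 = - u.f q' (hypSharp E.S.φ p q' x0) - E'.C.d q q' (y + u.f q c')
        rw [map_add, chain_comm, hc', map_sub]
        rw [← sub_eq_zero, ← h1]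
        abel

theorem LSet.mk_eq_of_iso (E E' : PoincareCx β n) (u : E.C ⟶ E'.C) (v : E'.C ⟶ E.C)
    (huv : u ≫ v = 𝟙 _) (hvu : v ≫ u = 𝟙 _) (e : E.S.push u = E'.S) :
    LSet.mk E = LSet.mk E' :=
  Quot.sound (E.cobordant_of_iso E' u v huv hvu (.ofEqZero _ (by rw [e, add_neg_cancel])) rfl)

/-- The exchange `C ⊕ D → D ⊕ C`. -/
def dswap (C D : ChainComplex (ModuleCat.{u} A) ℤ) : dsum C D ⟶ dsum D C where
  f r := ModuleCat.ofHom (LinearMap.prod (LinearMap.snd A (C.X r) (D.X r)) (LinearMap.fst A _ _))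
  comm' r s _ := rfl

/-- The associativity `(C ⊕ D) ⊕ E → C ⊕ (D ⊕ E)`. -/
def dassoc (C D E : ChainComplex (ModuleCat.{u} A) ℤ) :
    dsum (dsum C D) E ⟶ dsum C (dsum D E) where
  f r := ModuleCat.ofHom (LinearEquiv.prodAssoc A (C.X r) (D.X r) (E.X r)).toLinearMap
  comm' r s _ := rfl

/-- The inverse of `dassoc`. -/
def dassocInv (C D E : ChainComplex (ModuleCat.{u} A) ℤ) :
    dsum C (dsum D E) ⟶ dsum (dsum C D) E where
  f r := ModuleCat.ofHom (LinearEquiv.prodAssoc A (C.X r) (D.X r) (E.X r)).symm.toLinearMap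
  comm' r s _ := rfl

/-- The exchange of summands reverses the order of addition of structures, so it is not an isometry.
The discrepancy is absorbed by `StrEquiv.addComm`, which has `ξ = 0`. -/
theorem LSet.mk_sum_comm (E E' : PoincareCx β n) :
    LSet.mk (E.sum E') = LSet.mk (E'.sum E) := by
  refine Quot.sound ((E.sum E').cobordant_of_iso (E'.sum E) (dswap _ _) (dswap _ _) rfl rfl
    ((StrEquiv.addComm (E.S.push (dinr E'.C E.C)) (E'.S.push (dinl E'.C E.C))).copy ?_ rfl) rfl)
  show _ = (E.S.push (dinl E.C E'.C) + E'.S.push (dinr E.C E'.C)).push _ + _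
  rw [StrData.push_add]
  rfl

theorem LSet.mk_sum_assoc (E E' E'' : PoincareCx β n) :
    LSet.mk ((E.sum E').sum E'') = LSet.mk (E.sum (E'.sum E'')) := by
  refine LSet.mk_eq_of_iso _ _ (dassoc _ _ _) (dassocInv _ _ _) rfl rfl ?_
  show ((E.S.push (dinl E.C E'.C) + E'.S.push (dinr E.C E'.C)).push (dinl _ _)
    + E''.S.push (dinr _ _)).push _ = E.S.push (dinl _ _) +
    (E'.S.push (dinl E'.C E''.C) + E''.S.push (dinr E'.C E''.C)).push (dinr _ _)
  rw [StrData.push_add, StrData.push_push, StrData.push_add, StrData.push_add, add_assoc]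
  rfl

theorem LSet.mk_sum_zero (E : PoincareCx β n) :
    LSet.mk (E.sum (PoincareCx.zero β n)) = LSet.mk E := by
  refine LSet.mk_eq_of_iso _ _ (dfst _ _) (dinl _ _) ?_ (dinl_dfst _ _) ?_
  · refine HomologicalComplex.hom_ext _ _ fun r => ModuleCat.hom_ext
      (LinearMap.ext fun (x : E.C.X r × PUnit.{u+1}) => ?_)
    rfl
  · show (E.S.push (dinl E.C (zeroCx A)) + (0 : StrData β n (zeroCx A)).push
      (dinr E.C (zeroCx A))).push (dfst E.C (zeroCx A)) = _
    rw [StrData.push_zero, add_zero, StrData.push_push]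
    exact (congrArg E.S.push (dinl_dfst E.C (zeroCx A))).trans (StrData.push_id _)

/-- Boundaries are invariant under isomorphism of complexes. -/
theorem StrData.IsBoundary.push {S : StrData β n C} (hC : IsDim (2 * n) C) (hD : IsDim (2 * n) D)
    (hS : S.IsStr) (h : S.IsBoundary) (u : C ⟶ D) (v : D ⟶ C)
    (huv : u ≫ v = 𝟙 _) (hvu : v ≫ u = 𝟙 _) : (S.push u).IsBoundary := by
  obtain ⟨K, hK, i, e, he⟩ := h.exists hC
  have hpush : S.push i = (S.push u).push (v ≫ i) := by
    rw [StrData.push_push, ← Category.assoc, huv, Category.id_comp]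
  have hui : u ≫ v ≫ i = i := by rw [← Category.assoc, huv, Category.id_comp]
  have hdual : ∀ p (x : InvDual A (K.X p)), dualMap (u.f p).hom
      (dualMap ((v ≫ i).f p).hom x) = dualMap (i.f p).hom x := fun p x => by
    conv_rhs => rw [← dualMap_f_of_eq hui]
    rfl
  have hvuX : ∀ r (x : D.X r), u.f r (v.f r x) = x := fun r x =>
    congrArg (fun w : D ⟶ D => w.f r x) hvu
  have huvX : ∀ r (x : C.X r), v.f r (u.f r x) = x := fun r x =>
    congrArg (fun w : C ⟶ C => w.f r x) huv
  refine StrData.isBoundary_of hD (hS.push u) (i := v ≫ i) hK (e.copy hpush rfl) ?_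
  have hφ : ∀ p q x, hypSharp (S.push u).φ p q x
      = u.f q (hypSharp S.φ p q (dualMap (u.f p).hom x)) := fun p q x =>
    hypSharp_pull hC hD u S.φ p q x
  constructor
  · intro p q q' hpq hq' x hx y c h1 h2
    refine he.inj p q q' hpq hq' x hx y (v.f q c) h1 ?_
    rw [hφ, hdual] at h2
    have h3 := congrArg (v.f q') h2
    rw [huvX, map_neg, ← chain_comm] at h3
    exact h3
  · intro p q q' hpq hq' y c h1 hc
    obtain ⟨x, hx, y', c', e1, e2⟩ := he.surj p q q' hpq hq' y (v.f q' c) h1 (hc.map v)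
    refine ⟨x, hx, y', u.f q c', ?_, ?_⟩
    · have : (v ≫ i).f q (u.f q c') = i.f q c' := congrArg (i.f q) (huvX q c')
      rw [this]
      exact e1
    · rw [hφ, hdual, chain_comm, ← map_sub, ← e2, hvuX]

theorem LSet.mk_eq_zero_of_isBoundary (E : PoincareCx β n) (h : E.S.IsBoundary) :
    LSet.mk E = LSet.mk (PoincareCx.zero β n) := by
  refine Quot.sound ?_
  show (E.S.push (dinl E.C (zeroCx A))
    + (-(0 : StrData β n (zeroCx A))).push (dinr E.C (zeroCx A))).IsBoundary
  rw [neg_zero, StrData.push_zero, add_zero]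
  refine h.push E.dim (E.dim.dsum (PoincareCx.zero β n).dim) E.isStr _ (dfst _ _) (dinl_dfst _ _) ?_
  refine HomologicalComplex.hom_ext _ _ fun r => ModuleCat.hom_ext
      (LinearMap.ext fun (x : E.C.X r × PUnit.{u+1}) => ?_)
  rfl

/-- The identity of `E`, viewed as a cobordism. -/
theorem PoincareCx.sum_neg_isBoundary (E : PoincareCx β n) : (E.sum E.neg).S.IsBoundary :=
  (E.cobordant_iff E).1 (E.cobordant_of_iso E (𝟙 _) (𝟙 _) (Category.id_comp _) (Category.id_comp _)
    (.ofEqZero _ (by rw [StrData.push_id, add_neg_cancel])) rfl)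

theorem PoincareCx.hypSharp_sum (E E' : PoincareCx β n) (p q : ℤ)
    (x : InvDual A ((dsum E.C E'.C).X p)) :
    hypSharp (E.sum E').S.φ p q x
      = (hypSharp E.S.φ p q (dualMap ((dinl E.C E'.C).f p).hom x),
        hypSharp E'.S.φ p q (dualMap ((dinr E.C E'.C).f p).hom x)) := by
  have := hypSharp_add (E.sum E').dim (hypPull (dualCxMap (dinl E.C E'.C)) E.S.φ)
    (hypPull (dualCxMap (dinr E.C E'.C)) E'.S.φ) p q x
  refine this.trans ?_
  have h1 := hypSharp_pull E.dim (E.sum E').dim (dinl E.C E'.C) E.S.φ p q x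
  have h2 := hypSharp_pull E'.dim (E.sum E').dim (dinr E.C E'.C) E'.S.φ p q x
  erw [h1, h2]
  exact Prod.ext (add_zero _) (zero_add _)

theorem PoincareCx.hypSharp_neg (E : PoincareCx β n) (p q : ℤ) (x : InvDual A (E.C.X p)) :
    hypSharp E.neg.S.φ p q x = -hypSharp E.S.φ p q x :=
  ChainBundleL.hypSharp_neg E.dim _ p q x

/-- The given cobordism on `K` is added to the trivial cobordism of `G`: the new `D` is `K ⊕ G`, and
the two copies of `G` are folded onto one. -/
theorem PoincareCx.Cobordant.sum_right {E E' : PoincareCx β n} (h : E.Cobordant E')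
    (G : PoincareCx β n) : (E.sum G).Cobordant (E'.sum G) := by
  obtain ⟨K, hK, i, e, he⟩ : ∃ (K : ChainComplex (ModuleCat.{u} A) ℤ) (_ : IsDim (2 * n + 1) K)
      (i : dsum E.C E'.C ⟶ K) (e : StrEquiv (StrData.push i (E.sum E'.neg).S) 0),
      IsPairDuality n (E.sum E'.neg).S.φ i e.ξ :=
    ((E.cobordant_iff E').1 h).exists (E.sum E'.neg).dim
  let j : dsum (dsum E.C G.C) (dsum E'.C G.C) ⟶ dsum K G.C :=
    dfst _ _ ≫ (dfst _ _ ≫ dinl E.C E'.C ≫ i ≫ dinl K G.C + dsnd _ _ ≫ dinr K G.C)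
      + dsnd _ _ ≫ (dfst _ _ ≫ dinr E.C E'.C ≫ i ≫ dinl K G.C + dsnd _ _ ≫ dinr K G.C)
  have hKG : IsDim (2 * n + 1) (dsum K G.C) := hK.dsum (G.dim.mono (by omega))
  have hj : ∀ r (c1 : E.C.X r) (g1 : G.C.X r) (c2 : E'.C.X r) (g2 : G.C.X r),
      j.f r (((c1, g1), (c2, g2)) : (E.C.X r × G.C.X r) × (E'.C.X r × G.C.X r))
        = ((i.f r (c1, c2), g1 + g2) : K.X r × G.C.X r) := by
    intro r c1 g1 c2 g2
    show ((i.f r (c1, 0), 0) + (0, g1) + ((i.f r (0, c2), 0) + (0, g2)) : K.X r × G.C.X r) = _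
    refine Prod.ext ?_ ?_
    · show i.f r (c1, 0) + 0 + (i.f r (0, c2) + 0) = i.f r (c1, c2)
      rw [add_zero, add_zero]
      exact (map_add (i.f r).hom _ _).symm.trans
        (congrArg (i.f r) (Prod.ext (add_zero _) (zero_add _)))
    · show (0 + g1) + (0 + g2) = g1 + g2
      rw [zero_add, zero_add]
  have hpush : ((E.sum E'.neg).S.push i).push (dinl K G.C)
      = ((E.sum G).sum (E'.sum G).neg).S.push j := by
    have e1 : dinl E.C G.C ≫ dinl _ _ ≫ j = dinl E.C E'.C ≫ i ≫ dinl K G.C := by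
      refine HomologicalComplex.hom_ext _ _ fun r => ModuleCat.hom_ext (LinearMap.ext fun x => ?_)
      refine (hj r x 0 0 0).trans ?_
      rw [add_zero]; rfl
    have e2 : dinr E.C G.C ≫ dinl _ _ ≫ j = dinr K G.C := by
      refine HomologicalComplex.hom_ext _ _ fun r => ModuleCat.hom_ext (LinearMap.ext fun x => ?_)
      refine (hj r 0 x 0 0).trans ?_
      rw [add_zero]
      exact Prod.ext (map_zero (i.f r).hom) rfl
    have e3 : dinl E'.C G.C ≫ dinr _ _ ≫ j = dinr E.C E'.C ≫ i ≫ dinl K G.C := by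
      refine HomologicalComplex.hom_ext _ _ fun r => ModuleCat.hom_ext (LinearMap.ext fun x => ?_)
      refine (hj r 0 0 x 0).trans ?_
      rw [add_zero]; rfl
    have e4 : dinr E'.C G.C ≫ dinr _ _ ≫ j = dinr K G.C := by
      refine HomologicalComplex.hom_ext _ _ fun r => ModuleCat.hom_ext (LinearMap.ext fun x => ?_)
      refine (hj r 0 0 0 x).trans ?_
      rw [zero_add]
      exact Prod.ext (map_zero (i.f r).hom) rfl
    show ((E.S.push (dinl E.C E'.C) + (-E'.S).push (dinr E.C E'.C)).push i).push (dinl K G.C)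
      = ((E.S.push (dinl E.C G.C) + G.S.push (dinr E.C G.C)).push (dinl _ _)
        + (-(E'.S.push (dinl E'.C G.C) + G.S.push (dinr E'.C G.C))).push (dinr _ _)).push j
    simp only [StrData.push_add, StrData.push_push, StrData.push_neg, Category.assoc]
    -- In the noncommutative group of structures `E + G - (E' + G) = E + G - G - E'`, so the
    -- contributions of `G` are adjacent and cancel exactly.
    rw [e1, e2, e3, e4, neg_add_rev, add_assoc, add_neg_cancel_left]
  have hz : ((0 : StrData β n K).push (dinl K G.C)) = 0 := StrData.push_zero _
  refine StrData.isBoundary_of ((E.sum G).sum (E'.sum G).neg).dim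
    ((E.sum G).sum (E'.sum G).neg).isStr (i := j) hKG ((e.push (dinl K G.C)).copy hpush hz) ?_
  have hξ : ∀ p q (x : InvDual A ((dsum K G.C).X p)),
      hypSharp ((e.push (dinl K G.C)).copy hpush hz).ξ p q x
        = ((hypSharp e.ξ p q (dualMap ((dinl K G.C).f p).hom x), 0) : K.X q × G.C.X q) :=
    fun p q x => hypSharp_pull hK hKG (dinl K G.C) e.ξ p q x
  -- The duality map splits into that of the given pair and two opposite copies of that of `G`. The
  -- conditions below are then checked on the `K`-part by `he` and on the `G`-part by `G.duality`.
  have hP : ∀ p q (x : InvDual A ((dsum K G.C).X p)),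
      hypSharp ((E.sum G).sum (E'.sum G).neg).S.φ p q (dualMap (j.f p).hom x)
      = (((hypSharp (E.sum E'.neg).S.φ p q (dualMap (i.f p).hom
          (dualMap ((dinl K G.C).f p).hom x))).1,
            hypSharp G.S.φ p q (dualMap ((dinr K G.C).f p).hom x)),
        ((hypSharp (E.sum E'.neg).S.φ p q (dualMap (i.f p).hom
          (dualMap ((dinl K G.C).f p).hom x))).2,
            -hypSharp G.S.φ p q (dualMap ((dinr K G.C).f p).hom x))) := by
    intro p q x
    have d1 : dualMap ((dinl E.C G.C).f p).hom
        (dualMap ((dinl (dsum E.C G.C) (dsum E'.C G.C)).f p).hom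
        (dualMap (j.f p).hom x)) = dualMap ((dinl E.C E'.C).f p).hom (dualMap (i.f p).hom
          (dualMap ((dinl K G.C).f p).hom x)) := InvDual.ext fun y => by
      refine congrArg x ((hj p y 0 0 0).trans ?_)
      rw [add_zero]; rfl
    have d2 : dualMap ((dinr E.C G.C).f p).hom
        (dualMap ((dinl (dsum E.C G.C) (dsum E'.C G.C)).f p).hom
        (dualMap (j.f p).hom x)) = dualMap ((dinr K G.C).f p).hom x := InvDual.ext fun y => by
      refine congrArg x ((hj p 0 y 0 0).trans ?_)
      rw [add_zero]
      exact Prod.ext (map_zero (i.f p).hom) rfl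
    have d3 : dualMap ((dinl E'.C G.C).f p).hom
        (dualMap ((dinr (dsum E.C G.C) (dsum E'.C G.C)).f p).hom
        (dualMap (j.f p).hom x)) = dualMap ((dinr E.C E'.C).f p).hom (dualMap (i.f p).hom
          (dualMap ((dinl K G.C).f p).hom x)) := InvDual.ext fun y => by
      refine congrArg x ((hj p 0 0 y 0).trans ?_)
      rw [add_zero]; rfl
    have d4 : dualMap ((dinr E'.C G.C).f p).hom
        (dualMap ((dinr (dsum E.C G.C) (dsum E'.C G.C)).f p).hom
        (dualMap (j.f p).hom x)) = dualMap ((dinr K G.C).f p).hom x := InvDual.ext fun y => by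
      refine congrArg x ((hj p 0 0 0 y).trans ?_)
      rw [zero_add]
      exact Prod.ext (map_zero (i.f p).hom) rfl
    refine ((E.sum G).hypSharp_sum (E'.sum G).neg p q _).trans ?_
    have s1 := E.hypSharp_sum G p q (dualMap ((dinl (dsum E.C G.C) (dsum E'.C G.C)).f p).hom
        (dualMap (j.f p).hom x))
    have s2 := (E'.sum G).hypSharp_neg p q (dualMap ((dinr (dsum E.C G.C) (dsum E'.C G.C)).f p).hom
        (dualMap (j.f p).hom x))
    have s3 := E'.hypSharp_sum G p q (dualMap ((dinr (dsum E.C G.C) (dsum E'.C G.C)).f p).hom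
        (dualMap (j.f p).hom x))
    have s4 := E.hypSharp_sum E'.neg p q (dualMap (i.f p).hom
          (dualMap ((dinl K G.C).f p).hom x))
    have s5 := E'.hypSharp_neg p q (dualMap ((dinr E.C E'.C).f p).hom (dualMap (i.f p).hom
          (dualMap ((dinl K G.C).f p).hom x)))
    rw [d1, d2] at s1
    rw [d3, d4] at s3
    refine Prod.ext (s1.trans ?_) ((s2.trans (congrArg Neg.neg s3)).trans ?_)
    · rw [s4]
      rfl
    · rw [s4]
      exact Prod.ext s5.symm rfl
  constructor
  · rintro p q q' hpq hq' x hx y ⟨⟨c1, g1⟩, ⟨c2, g2⟩⟩ h1 h2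
    obtain ⟨y1, y2⟩ : K.X (q + 1) × G.C.X (q + 1) := y
    replace h1 := (hξ p q x).symm.trans (h1.trans (congrArg (_ + ·) (hj q c1 g1 c2 g2)))
    replace h2 := (hP p q' x).symm.trans h2
    have a1 : hypSharp e.ξ p q (dualMap ((dinl K G.C).f p).hom x)
      = K.d (q + 1) q y1 + i.f q (c1, c2) := congrArg Prod.fst h1
    have a2 := congrArg (fun z => z.1.1) h2
    have a3 := congrArg (fun z => z.2.1) h2
    have a4 : hypSharp G.S.φ p q' (dualMap ((dinr K G.C).f p).hom x) = -G.C.d q q' g1 :=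
      congrArg (fun z => z.1.2) h2
    have b1 := he.inj p q q' hpq hq' _ (hx.map (dinl K G.C)) y1 (c1, c2) a1 (Prod.ext a2 a3)
    have b2 := G.duality.inj p q' (by omega) _ (hx.map (dinr K G.C))
      ⟨q, -g1, by rw [map_neg]; exact a4.symm⟩
    rw [dual_dsum_eq p x]
    exact (b1.map (dfst K G.C)).add (b2.map (dsnd K G.C))
  · rintro p q q' hpq hq' y ⟨⟨c1, g1⟩, ⟨c2, g2⟩⟩ h1 hc
    obtain ⟨y1, y2⟩ : K.X q × G.C.X q := y
    replace h1 := (congrArg (_ + ·) (hj q' c1 g1 c2 g2)).symm.trans h1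
    have a1 : K.d q q' y1 + i.f q' (c1, c2) = 0 := congrArg Prod.fst h1
    have a2 : G.C.d q q' y2 + (g1 + g2) = 0 := congrArg Prod.snd h1
    have hc1 : IsCyc (dsum E.C E'.C) (show (dsum E.C E'.C).X q' from (c1, c2)) := fun k =>
      Prod.ext (congrArg (fun z => z.1.1) (hc k)) (congrArg (fun z => z.2.1) (hc k))
    have hg1 : IsCyc G.C g1 := fun k => congrArg (fun z => z.1.2) (hc k)
    obtain ⟨x1, hx1, y1', ⟨c1', c2'⟩, b1, b2⟩ := he.surj p q q' hpq hq' y1 (c1, c2) a1 hc1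
    obtain ⟨x2, hx2, hb⟩ := G.duality.surj p q' (by omega) g1 hg1
    obtain ⟨g', hg'⟩ := (isBd_iff hq' _).1 hb
    let x := dualMap ((dfst K G.C).f p).hom x1 + dualMap ((dsnd K G.C).f p).hom x2
    have t1 : dualMap ((dinl K G.C).f p).hom x = x1 := InvDual.ext fun y => by
      show x1 y + x2 0 = x1 y
      rw [map_zero, add_zero]
    have t2 : dualMap ((dinr K G.C).f p).hom x = x2 := InvDual.ext fun y => by
      show x1 0 + x2 y = x2 y
      rw [map_zero, zero_add]
    refine ⟨x, (hx1.map (dfst K G.C)).add (hx2.map (dsnd K G.C)), ((y1', 0) : K.X _ × G.C.X _),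
      (((c1', -g'), (c2', y2 + g')) : (E.C.X q × G.C.X q) × (E'.C.X q × G.C.X q)), ?_, ?_⟩
    · refine Eq.trans ?_ (congrArg₂ (fun a b => a + _ + b) (hξ p q x).symm
        (hj q c1' (-g') c2' (y2 + g')).symm)
      rw [t1]
      refine Prod.ext b1 ?_
      show y2 = 0 + G.C.d (q + 1) q 0 + (-g' + (y2 + g'))
      rw [map_zero]; abel
    · refine Eq.trans ?_ (congrArg (· - _) (hP p q' x).symm)
      rw [t1, t2]
      have f1 := congrArg Prod.fst b2
      have f2 := congrArg Prod.snd b2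
      refine Prod.ext (Prod.ext f1 ?_) (Prod.ext f2 ?_)
      · show g1 = hypSharp G.S.φ p q' x2 - G.C.d q q' (-g')
        rw [map_neg, hg']; abel
      · show g2 = -hypSharp G.S.φ p q' x2 - G.C.d q q' (y2 + g')
        rw [map_add, hg', ← sub_eq_zero, ← a2]; abel

theorem LSet.mk_sum_congr_right {E E' : PoincareCx β n} (h : E.Cobordant E') (G : PoincareCx β n) :
    LSet.mk (E.sum G) = LSet.mk (E'.sum G) := Quot.sound (h.sum_right G)

theorem LSet.mk_sum_congr_left {E E' : PoincareCx β n} (h : E.Cobordant E') (G : PoincareCx β n) :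
    LSet.mk (G.sum E) = LSet.mk (G.sum E') := by
  rw [LSet.mk_sum_comm, LSet.mk_sum_congr_right h, LSet.mk_sum_comm]

scoped instance : Add (LSet β n) :=
  ⟨Quot.lift₂ (fun E E' => LSet.mk (E.sum E')) (fun G _ _ h => LSet.mk_sum_congr_left h G)
    (fun _ _ G h => LSet.mk_sum_congr_right h G)⟩

scoped instance : Zero (LSet β n) := ⟨LSet.mk (PoincareCx.zero β n)⟩

noncomputable scoped instance : Neg (LSet β n) := ⟨fun w => LSet.mk (PoincareCx.neg w.out)⟩

theorem LSet.mk_sum (E E' : PoincareCx β n) : LSet.mk (E.sum E') = LSet.mk E + LSet.mk E' := rfl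

theorem LSet.mk_of_isBoundary {E : PoincareCx β n} (h : E.S.IsBoundary) : LSet.mk E = 0 :=
  LSet.mk_eq_zero_of_isBoundary E h

/-- The group `L⟨B, β⟩^{2n}(A)`. -/
noncomputable scoped instance addCommGroupLSet : AddCommGroup (LSet β n) where
  add_assoc := by
    rintro ⟨E⟩ ⟨E'⟩ ⟨E''⟩
    exact LSet.mk_sum_assoc E E' E''
  add_comm := by
    rintro ⟨E⟩ ⟨E'⟩
    exact LSet.mk_sum_comm E E'
  zero_add := by
    rintro ⟨E⟩
    exact (LSet.mk_sum_comm _ _).trans (LSet.mk_sum_zero E)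
  add_zero := by
    rintro ⟨E⟩
    exact LSet.mk_sum_zero E
  neg_add_cancel w := by
    have h : LSet.mk w.out = w := Quot.out_eq w
    have h' : -w = LSet.mk (PoincareCx.neg w.out) := rfl
    have h2 : -w + w = LSet.mk ((PoincareCx.neg w.out).sum w.out) := by
      rw [LSet.mk_sum, h, h']
    rw [h2, LSet.mk_sum_comm]
    exact LSet.mk_of_isBoundary (PoincareCx.sum_neg_isBoundary w.out)
  nsmul := nsmulRec
  zsmul := zsmulRec

end LGroup

/-! ### Pairings on free modules. -/

section Pairings

variable {A : Type u} [Ring A] [StarRing A] {M N M' N' : Type u}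
  [AddCommGroup M] [Module A M] [AddCommGroup N] [Module A N]

theorem pairing_smul (φ : M →ₗ[A] InvDual A N) (a b : A) (x : M) (y : N) :
    φ (a • x) (b • y) = b * φ x y * star a := by
  rw [map_smul φ, InvDual.smul_apply, map_smul (φ x), smul_eq_mul]

theorem pairing_ext {k : ℕ} (b : Module.Basis (Fin k) A M) {G H : M →ₗ[A] InvDual A M}
    (h : ∀ i j, G (b i) (b j) = H (b i) (b j)) : G = H :=
  b.ext fun i => (b.ext fun j => h i j : (G (b i) : M →ₗ[A] A) = (H (b i) : M →ₗ[A] A))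

theorem units_transpose_apply (e : ℤˣ) (G : M →ₗ[A] InvDual A N) (x : N) (y : M) :
    (e • transpose G) x y = e • star (G y x) := by
  rcases Int.units_eq_one_or e with rfl | rfl <;> simp

/-- A symmetric pairing on a free module is of the form `χ + χ^*` if it is so on the diagonal of
a basis. -/
theorem exists_half {k : ℕ} (b : Module.Basis (Fin k) A M) (e : ℤˣ) (G : M →ₗ[A] InvDual A M)
    (hG : ∀ x y, G x y = e • star (G y x)) (c : Fin k → A)
    (hc : ∀ i, G (b i) (b i) = c i + e • star (c i)) :
    ∃ χ : M →ₗ[A] InvDual A M, (∀ x y, G x y = χ x y + e • star (χ y x)) ∧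
      ∀ i, χ (b i) (b i) = c i := by
  -- The upper triangular half of the matrix of `G`, with the prescribed halves on the diagonal.
  let t : Fin k → Fin k → A := fun i j => if i < j then G (b i) (b j) else if i = j then c i else 0
  let χ : M →ₗ[A] InvDual A M := b.constr ℕ fun i => (b.constr ℕ (t i) : M →ₗ[A] A)
  have hχ : ∀ i j, χ (b i) (b j) = t i j := fun i j => by
    have h1 : χ (b i) = (b.constr ℕ (t i) : M →ₗ[A] A) := b.constr_basis ℕ _ i
    rw [h1]
    exact b.constr_basis ℕ (t i) j
  have key : G = χ + e • transpose χ := by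
    refine pairing_ext b fun i j => ?_
    rw [LinearMap.add_apply, InvDual.add_apply, units_transpose_apply, hχ, hχ]
    rcases lt_trichotomy i j with h | rfl | h
    · simp [t, h, h.not_gt, h.ne']
    · simp [t, hc]
    · simp only [t, h, h.not_gt, h.ne', if_true, if_false, zero_add]
      exact hG _ _
  refine ⟨χ, fun x y => ?_, fun i => by rw [hχ]; simp [t]⟩
  conv_lhs => rw [key]
  rw [LinearMap.add_apply, InvDual.add_apply, units_transpose_apply]

/-- A finitely generated projective module is a retract of a free module. -/
theorem exists_retract_free (A M : Type u) [Ring A] [AddCommGroup M] [Module A M]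
    [Module.Finite A M] [Module.Projective A M] :
    ∃ (k : ℕ) (p : (Fin k → A) →ₗ[A] M) (j : M →ₗ[A] (Fin k → A)), p ∘ₗ j = LinearMap.id := by
  obtain ⟨k, p, hp⟩ := Module.Finite.exists_fin' A M
  obtain ⟨j, hj⟩ := Module.projective_lifting_property p LinearMap.id hp
  exact ⟨k, p, j, hj⟩

end Pairings

/-! ### Lifting quadratic forms to the chain level. -/

section QuadraticData

variable {A : Type u} [Ring A] [StarRing A] {β : ChainBundle A} {n : ℤ}
  {M M' : Type u} [AddCommGroup M] [Module A M] [AddCommGroup M'] [Module A M']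

/-- The class of a pair as an element of the underlying group of `Q β n`. -/
def Q.mk (a : A) (b : β.B.X n) (h : β.B.d n (n - 1) b = 0) : (Q β n).carrier := Qn.mk a b h

theorem Q.mk_congr {a a' : A} {b b' : β.B.X n} {h : β.B.d n (n - 1) b = 0}
    {h' : β.B.d n (n - 1) b' = 0} (ha : a = a') (hb : b = b') : Q.mk a b h = Q.mk a' b' h' := by
  subst ha hb; rfl

theorem Q.exists_mk (q : (Q β n).carrier) : ∃ a b h, q = Q.mk (β := β) (n := n) a b h := by
  obtain ⟨p, rfl⟩ := Quotient.exists_rep q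
  exact ⟨p.a, p.b, p.db, rfl⟩

theorem Q.mk_eq_mk_iff {a a' : A} {b b' : β.B.X n} {h : β.B.d n (n - 1) b = 0}
    {h' : β.B.d n (n - 1) b' = 0} : Q.mk a b h = Q.mk a' b' h' ↔
      ∃ y : β.B.X (n + 1), b' - b = β.B.d (n + 1) n y ∧ a' - a + corr b b' y ∈ skew A n :=
  (Quotient.eq (r := QPair.setoid β n)).trans (rel_iff _ _)

theorem Q.mk_add_mk {a a' : A} {b b' : β.B.X n} (h : β.B.d n (n - 1) b = 0)
    (h' : β.B.d n (n - 1) b' = 0) : Q.mk a b h + Q.mk a' b' h'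
      = Q.mk (a + a' - β.β (-2 * n) n n b b') (b + b') (by rw [map_add, h, h', add_zero]) := rfl

theorem Q.s_eq (a : A) : (Q β n).s a = Q.mk a 0 (map_zero (β.B.d n (n - 1)).hom) := rfl

/-- A presentation `λ - β_{-2n}(f, f) = θ + ε θ^*`, `μ(x) = (θ(x)(x), f(x))` of a
`Q(n)`-quadratic form on `M`. -/
structure Presents (f : M →ₗ[A] β.B.X n) (θ lam : M →ₗ[A] InvDual A M)
    (mu : M → (Q β n).carrier) : Prop where
  d_f : ∀ x, β.B.d n (n - 1) (f x) = 0
  lam_eq : ∀ x y, lam x y - β.β (-2 * n) n n (f x) (f y)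
    = θ x y + n.negOnePow • star (θ y x)
  mu_eq : ∀ x, mu x = Q.mk (θ x x) (f x) (d_f x)

namespace Presents

variable {f : M →ₗ[A] β.B.X n} {θ lam : M →ₗ[A] InvDual A M} {mu : M → (Q β n).carrier}
  (P : Presents f θ lam mu)

include P

theorem lam_symm (x y : M) : n.negOnePow • star (lam y x) = lam x y := by
  have h1 := P.lam_eq x y
  have h2 := P.lam_eq y x
  rw [sub_eq_iff_eq_add] at h1 h2
  rw [h1, h2, cyc0 _ _ (P.d_f x) (P.d_f y)]
  rcases Int.units_eq_one_or n.negOnePow with e | e <;> rw [e] <;> simp <;> abel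

theorem mu_smul (a : A) (x : M) : mu (a • x) = a • mu x := by
  rw [P.mu_eq, P.mu_eq]
  exact Q.mk_congr (pairing_smul θ a a x x) (map_smul f a x)

theorem r_mu (x : M) : (Q β n).r (mu x) = lam x x := by
  rw [P.mu_eq, sub_eq_iff_eq_add.1 (P.lam_eq x x)]
  rfl

/-- The cross terms of `θ` are `θ(x)(y) + θ(y)(x)`, while `λ - β(f, f)` contributes `θ(x)(y) + ε
star (θ(y)(x))`. They differ by an element of `skew`, and the `β` term is the twist in the addition
of `Q(n)`. -/
theorem mu_add (x y : M) : mu (x + y) - mu x - mu y = (Q β n).s (lam x y) := by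
  rw [sub_sub, sub_eq_iff_eq_add', P.mu_eq, P.mu_eq, P.mu_eq, Q.s_eq, Q.mk_add_mk, Q.mk_add_mk]
  refine Q.mk_eq_mk_iff.2 ⟨0, ?_, ?_⟩
  · rw [map_add f, add_zero, sub_self, map_zero]
  · convert (skew A n).neg_mem (sub_skew (n := n) (θ y x)) using 1
    have h := P.lam_eq x y
    rw [sub_eq_iff_eq_add] at h
    rw [h]
    simp [corr]
    abel

theorem comp (g : M' →ₗ[A] M) :
    Presents (f ∘ₗ g) (pullPair θ g g) (pullPair lam g g) (mu ∘ g) where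
  d_f x := P.d_f (g x)
  lam_eq x y := P.lam_eq (g x) (g y)
  mu_eq x := P.mu_eq (g x)

end Presents

/-- Every quadratic form on a finitely generated projective module has a presentation. -/
theorem exists_presents [Module.Finite A M] [Module.Projective A M] (lam : M →ₗ[A] InvDual A M)
    (mu : M → (Q β n).carrier) (hlam : ∀ x y, n.negOnePow • star (lam y x) = lam x y)
    (hsmul : ∀ (a : A) x, mu (a • x) = a • mu x) (hr : ∀ x, (Q β n).r (mu x) = lam x x)
    (hadd : ∀ x y, mu (x + y) - mu x - mu y = (Q β n).s (lam x y)) :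
    ∃ f θ, Presents f θ lam mu := by
  obtain ⟨k, p, j, hpj⟩ := exists_retract_free A M
  let b := Pi.basisFun A (Fin k)
  have hpj' : ∀ x, p (j x) = x := fun x => LinearMap.congr_fun hpj x
  have hmu : ∀ i, ∃ (a : A) (w : β.B.X n) (hw : β.B.d n (n - 1) w = 0),
      mu (p (b i)) = Q.mk a w hw := fun i => Q.exists_mk _
  -- Representatives of `μ` are picked only on the images of the basis; `w` extends linearly to `f`,
  -- and `a` prescribes the diagonal of `θ`.
  choose a w hw haw using hmu
  let f : (Fin k → A) →ₗ[A] β.B.X n := b.constr ℕ w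
  have hf : ∀ i, f (b i) = w i := fun i => b.constr_basis ℕ w i
  have hdf : ∀ x, β.B.d n (n - 1) (f x) = 0 := by
    have : (β.B.d n (n - 1)).hom ∘ₗ f = 0 := b.ext fun i => by
      rw [LinearMap.comp_apply, hf]; exact hw i
    exact fun x => LinearMap.congr_fun this x
  -- The diagonal condition of `exists_half` is `r(μ) = λ` on the basis, since `r(a, b) = a + ε ā +
  -- β_{-2n}(b)(b)`.
  obtain ⟨θ, hθ, hθb⟩ := exists_half b n.negOnePow
    (pullPair lam p p - pullPair (β.β (-2 * n) n n) f f) (fun x y => by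
      show lam _ _ - β.β _ _ _ _ _ = _ • star (lam _ _ - β.β _ _ _ _ _)
      rw [star_sub, smul_sub, hlam, ← cyc0 _ _ (hdf x) (hdf y)]) a (fun i => by
      show lam (p (b i)) (p (b i)) - β.β (-2 * n) n n (f (b i)) (f (b i)) = _
      rw [← hr, haw, hf, sub_eq_iff_eq_add]
      rfl)
  have P : Presents f θ (pullPair lam p p) (fun x => Q.mk (θ x x) (f x) (hdf x)) :=
    ⟨hdf, hθ, fun _ => rfl⟩
  -- The defect between `μ` and the presented function. Both have the same polarization, so it is
  -- additive; it commutes with the action and vanishes on the basis, hence everywhere.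
  let δ : (Fin k → A) →+ (Q β n).carrier := AddMonoidHom.mk'
    (fun x => mu (p x) - Q.mk (θ x x) (f x) (hdf x)) fun x y => by
      have h1 := hadd (p x) (p y)
      have h2 := P.mu_add x y
      rw [sub_sub, sub_eq_iff_eq_add] at h1 h2
      show mu (p (x + y)) - Q.mk _ _ _ = _
      rw [map_add, h1]
      rw [h2, pullPair_apply]
      abel
  have hδs : ∀ (c : A) x, δ (c • x) = c • δ x := fun c x => by
    show mu (p (c • x)) - Q.mk _ _ _ = c • (mu (p x) - _)
    rw [map_smul, hsmul, smul_sub]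
    rw [P.mu_smul]
  have hδb : ∀ i, δ (b i) = 0 := fun i => by
    show mu (p (b i)) - Q.mk _ _ _ = 0
    rw [sub_eq_zero, haw]
    exact Q.mk_congr (hθb i).symm (hf i).symm
  have hδ : ∀ x, δ x = 0 := fun x => by
    rw [← b.sum_repr x, map_sum]
    exact Finset.sum_eq_zero fun i _ => by rw [hδs, hδb, smul_zero]
  refine ⟨f ∘ₗ j, pullPair θ j j, fun x => hdf (j x), fun x y => ?_, fun x => ?_⟩
  · have := P.lam_eq (j x) (j y)
    rwa [pullPair_apply, hpj', hpj'] at this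
  · have := sub_eq_zero.1 (hδ (j x))
    rwa [hpj'] at this

/-- If a presentation gives the zero form, then `f` is null-homotopic and `θ` is the boundary
determined by a null-homotopy up to a pairing of the form `χ - ε χ^*`. -/
theorem Presents.exists_null [Module.Finite A M] [Module.Projective A M]
    {f : M →ₗ[A] β.B.X n} {θ : M →ₗ[A] InvDual A M} (P : Presents f θ 0 0) :
    ∃ (h : M →ₗ[A] β.B.X (n + 1)) (χ : M →ₗ[A] InvDual A M),
      (∀ x, -f x = n.negOnePow • β.B.d (n + 1) n (h x)) ∧
      ∀ x y, θ x y - β.β (-2 * n - 1) n (n + 1) (f x) (h y)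
        - star (β.β (-2 * n - 2) (n + 1) (n + 1) (h y) (h x))
        = χ x y - n.negOnePow • star (χ y x) := by
  obtain ⟨k, p, j, hpj⟩ := exists_retract_free A M
  let b := Pi.basisFun A (Fin k)
  have hpj' : ∀ x, p (j x) = x := fun x => LinearMap.congr_fun hpj x
  -- The relation from `(θ(x)(x), f(x))` to `(0, 0)` on basis elements. The chains `y i` assemble
  -- into the null-homotopy, and the elements `x i` become the diagonal of `χ`.
  have hnull : ∀ i, ∃ (x : A) (y : β.B.X (n + 1)), 0 - f (p (b i)) = β.B.d (n + 1) n y ∧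
      0 - θ (p (b i)) (p (b i)) = x - n.negOnePow • star x
      - n.negOnePow • β.β (-2 * n - 1) n (n + 1) (f (p (b i))) y
      - β.β (-2 * n - 1) (n + 1) n y 0
      - n.negOnePow • β.β (-2 * n - 2) (n + 1) (n + 1) y y := fun i =>
    Quotient.exact (s := QPair.setoid β n) (P.mu_eq (p (b i))).symm
  choose x y hy hx using hnull
  let g := f ∘ₗ p
  let h : (Fin k → A) →ₗ[A] β.B.X (n + 1) := b.constr ℕ fun i => n.negOnePow • y i
  have hh : ∀ i, h (b i) = n.negOnePow • y i := fun i => b.constr_basis ℕ _ i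
  have hdh : ∀ z, β.B.d (n + 1) n (h z) = -(n.negOnePow • g z) := by
    have : (β.B.d (n + 1) n).hom ∘ₗ h = -(n.negOnePow • g) := b.ext fun i => by
      rw [LinearMap.comp_apply, hh]
      show _ = -(n.negOnePow • f (p (b i)))
      have := hy i
      rw [zero_sub] at this
      rw [← smul_neg, this]
      rcases Int.units_eq_one_or n.negOnePow with e | e <;> rw [e] <;> simp
    intro z
    refine (LinearMap.congr_fun this z).trans ?_
    rcases Int.units_eq_one_or n.negOnePow with e | e <;> rw [e] <;> simp
  have hdg : ∀ z, β.B.d n (n - 1) (g z) = 0 := fun z => P.d_f (p z)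
  let G : (Fin k → A) →ₗ[A] InvDual A (Fin k → A) :=
    pullPair θ p p - pullPair (β.β (-2 * n - 1) n (n + 1)) g h
      - transpose (pullPair (β.β (-2 * n - 2) (n + 1) (n + 1)) h h)
  have hG : ∀ z w, G z w = θ (p z) (p w) - β.β (-2 * n - 1) n (n + 1) (g z) (h w)
      - star (β.β (-2 * n - 2) (n + 1) (n + 1) (h w) (h z)) := fun _ _ => rfl
  -- `G` is symmetric for the sign `-ε`: this is a combination of the presentation identity with `λ
  -- = 0` and the cycle conditions `cyc1`, `cyc2` for `β`. So `exists_half` applies with `-ε`.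
  obtain ⟨χ, hχ, -⟩ := exists_half b (-n.negOnePow) G (fun z w => by
      have h0 := P.lam_eq (p z) (p w)
      have h1 := cyc1 (h z) (g w) (hdg w)
      have h2 := cyc2 (h z) (h w)
      rw [hdh] at h1
      rw [hdh, hdh] at h2
      change 0 - β.β (-2 * n) n n (g z) (g w) = _ at h0
      rw [hG, hG]
      rw [← sub_eq_zero] at h0 h1 h2 ⊢
      rcases Int.units_eq_one_or n.negOnePow with e | e <;> rw [e] at h0 h1 h2 ⊢ <;>
      simp only [one_smul, Units.neg_smul, neg_neg, map_neg, InvDual.neg_apply,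
        LinearMap.neg_apply, star_sub, star_star] at h0 h1 h2 ⊢
      · have h3 := congrArg₂ (· + ·) (congrArg₂ (· - ·) h0 h1) h2
        simp only [sub_zero, add_zero] at h3
        rw [← neg_eq_zero, ← h3]
        abel
      · have h3 := congrArg₂ (· + ·) (congrArg₂ (· + ·) h0 h1) h2
        simp only [sub_zero, add_zero] at h3
        rw [← neg_eq_zero, ← h3]
        abel)
    (fun i => -x i + n.negOnePow • β.β (-2 * n - 2) (n + 1) (n + 1) (y i) (y i)) (fun i => by
      have h0 := hx i
      rw [zero_sub, neg_eq_iff_eq_neg] at h0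
      rw [hG, hh, h0]
      show _ - β.β (-2 * n - 1) n (n + 1) (f (p (b i))) _ - _ = _
      rcases Int.units_eq_one_or n.negOnePow with e | e <;> rw [e] <;> simp <;> abel)
  refine ⟨h ∘ₗ j, pullPair χ j j, fun z => ?_, fun z w => ?_⟩
  · have := hdh (j z)
    change _ = -(n.negOnePow • f (p (j z))) at this
    rw [hpj'] at this
    show _ = n.negOnePow • β.B.d (n + 1) n (h (j z))
    rw [this, smul_neg, smul_smul, Int.units_mul_self, one_smul]
  · have := (hG (j z) (j w)).symm.trans (hχ (j z) (j w))
    change θ (p (j z)) (p (j w)) - β.β _ _ _ (f (p (j z))) _ - _ = _ at this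
    rw [hpj', hpj', Units.neg_smul, ← sub_eq_add_neg] at this
    exact this

end QuadraticData

/-! ### The normal Wu class. -/

section Wu

variable {A : Type u} [Ring A] [StarRing A] {β : ChainBundle A} {n : ℤ}
  {C D : ChainComplex (ModuleCat.{u} A) ℤ}

theorem ChainBundle.β_castX {s s' i i' j j' : ℤ} (hs : s = s') (hi : i = i') (hj : j = j')
    (x : β.B.X i) (y : β.B.X j) :
    β.β s i j x y = β.β s' i' j' (castX β.B i i' x) (castX β.B j j' y) := by
  subst hs hi hj
  rw [castX_self, castX_self]

theorem StrData.fn_eq (S : StrData β n C) (z : InvDual A (C.X n)) :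
    S.fn z = castX β.B (2 * n - n) n (S.f.f n z) := by
  rw [castX, dif_pos (by ring)]
  rfl

theorem StrData.fn_add (S S' : StrData β n C) (z : InvDual A (C.X n)) :
    (S + S').fn z = S.fn z + S'.fn z := by
  rw [StrData.fn_eq, StrData.fn_eq, StrData.fn_eq, ← map_add]
  rfl

theorem susp_fn (S S' : StrData β n C) (z w : InvDual A (C.X n)) :
    susp β (2 * n) 0 n n (S.f.f n z) (S'.f.f n w) = β.β (-2 * n) n n (S.fn z) (S'.fn w) := by
  rw [StrData.fn_eq, StrData.fn_eq]
  exact ChainBundle.β_castX (by ring) (by ring) (by ring) _ _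

theorem StrData.wu_eq (S : StrData β n C) (z : InvDual A (C.X n))
    (hz : dualMap (C.d (n + 1) n).hom z = 0) :
    S.wu z hz = Q.mk (S.θ (-1) n n z z) (S.fn z) (S.d_fn z hz) := rfl

/-- On cocycles the differential terms drop out of `J(φ) - f^%(S^{2n} β) = dθ`, and its `s = 0`
component becomes the presentation identity. Thus the Wu class is quadratic with respect to `φ_0`,
on the module of cocycles of any complex. -/
theorem StrData.IsStr.presents {S : StrData β n C} (hS : S.IsStr) :
    Presents (S.fn ∘ₗ (LinearMap.ker (dualMap (C.d (n + 1) n).hom)).subtype)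
      (pullPair (S.θ (-1) n n) (LinearMap.ker (dualMap (C.d (n + 1) n).hom)).subtype
        (LinearMap.ker (dualMap (C.d (n + 1) n).hom)).subtype)
      (pullPair (S.φ 0 n n) (LinearMap.ker (dualMap (C.d (n + 1) n).hom)).subtype
        (LinearMap.ker (dualMap (C.d (n + 1) n).hom)).subtype)
      (fun z => S.wu z.1 z.2) where
  d_f z := S.d_fn z.1 z.2
  lam_eq := by
    rintro ⟨z, hz⟩ ⟨w, hw⟩
    have h : (S.φ - hypPull S.f (susp β (2 * n))) 0 n n z w = hypD (2 * n + 1) S.θ 0 n n z w := by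
      rw [hS.eq]
    rw [hypD_apply] at h
    have hz : (dualCx C).d n (n + 1) z = 0 := hz
    have hw : (dualCx C).d n (n + 1) w = 0 := hw
    have e1 : (2 * n + 1 + 0 - 1).negOnePow = 1 := Int.negOnePow_even _ ⟨n, by ring⟩
    rw [hz, hw, map_zero, map_zero, InvDual.zero_apply, smul_zero, zero_add, zero_add, e1, one_smul,
      Int.negOnePow_zero, one_smul, Int.negOnePow_mul_self] at h
    have h2 := susp_fn S S z w
    exact (congrArg (S.φ 0 n n z w - ·) h2.symm).trans h
  mu_eq z := rfl

/-- The bracket in the sum of structures is the twist in the addition of `Q(n)`. By `cyc0` it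
appears as `β_{-2n}(f'^* z)(f^* z)`, which belongs to the sum in the opposite order; hence the
initial `add_comm`. -/
theorem StrData.wu_add (S S' : StrData β n C) (z : InvDual A (C.X n))
    (hz : dualMap (C.d (n + 1) n).hom z = 0) : (S + S').wu z hz = S.wu z hz + S'.wu z hz := by
  rw [add_comm, StrData.wu_eq, StrData.wu_eq, StrData.wu_eq, Q.mk_add_mk]
  refine Q.mk_congr ?_ ((S.fn_add S' z).trans (add_comm _ _))
  show S.θ (-1) n n z z + S'.θ (-1) n n z z + hypBracket S.f S'.f (susp β (2 * n)) (-1) n n z z = _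
  rw [hypBracket_apply, cyc0 _ _ (S'.d_fn z hz) (S.d_fn z hz), Int.negOnePow_mul_self]
  have h := susp_fn S S' z z
  rw [show (-1 : ℤ) + 1 = 0 from rfl, h, ← sub_eq_add_neg, add_comm (S'.θ (-1) n n z z)]

theorem StrData.wu_zero (z : InvDual A (C.X n)) (hz : dualMap (C.d (n + 1) n).hom z = 0) :
    (0 : StrData β n C).wu z hz = 0 := by
  have h := StrData.wu_add (0 : StrData β n C) 0 z hz
  rwa [add_zero, left_eq_add] at h

theorem StrData.wu_neg (S : StrData β n C) (z : InvDual A (C.X n))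
    (hz : dualMap (C.d (n + 1) n).hom z = 0) : (-S).wu z hz = -S.wu z hz := by
  rw [eq_neg_iff_add_eq_zero, ← StrData.wu_add]
  have h := StrData.wu_zero (β := β) (C := C) z hz
  rw [← h]
  congr 1
  exact neg_add_cancel S

theorem dualMap_cocycle (v : C ⟶ D) {z : InvDual A (D.X n)}
    (hz : dualMap (D.d (n + 1) n).hom z = 0) :
    dualMap (C.d (n + 1) n).hom (dualMap (v.f n).hom z) = 0 := by
  have h := cochain_comm (dualCxMap v) n (n + 1) z
  refine h.trans ?_
  have h0 : (dualCx D).d n (n + 1) z = 0 := hz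
  rw [h0, map_zero]

/-- The map of `n`-cocycles induced by a chain map. -/
def cocycleMap (n : ℤ) (v : C ⟶ D) : LinearMap.ker (dualMap (D.d (n + 1) n).hom) →ₗ[A]
    LinearMap.ker (dualMap (C.d (n + 1) n).hom) :=
  LinearMap.restrict (dualMap (v.f n).hom) fun _ hz => dualMap_cocycle v hz

end Wu

/-! ### The cohomology form of a Poincaré complex. -/

section CohomologyForms

variable {A : Type u} [Ring A] [StarRing A] {β : ChainBundle A} {n : ℤ}
  {E E' : PoincareCx β n} {F F' : QForm (Q β n)}

theorem exists_coboundary_iff {C : ChainComplex (ModuleCat.{u} A) ℤ} (z : InvDual A (C.X n)) :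
    (∃ w, dualMap (C.d n (n - 1)).hom w = z) ↔ CoBd C z :=
  (coBd_iff (by ring) z).symm

theorem IsCohomologyForm.sum (h : IsCohomologyForm E F) (h' : IsCohomologyForm E' F') :
    IsCohomologyForm (E.sum E') (F.sum F') := by
  obtain ⟨π, hs, hk, hl, hm⟩ := h
  obtain ⟨π', hs', hk', hl', hm'⟩ := h'
  let p : LinearMap.ker (dualMap ((dsum E.C E'.C).d (n + 1) n).hom) →ₗ[A] F.M × F'.M :=
    LinearMap.prod (π ∘ₗ cocycleMap n (dinl E.C E'.C)) (π' ∘ₗ cocycleMap n (dinr E.C E'.C))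
  refine ⟨p, ?_, fun z => ?_, fun z w => ?_, fun z => ?_⟩
  · rintro ⟨m, m'⟩
    obtain ⟨z, rfl⟩ := hs m
    obtain ⟨z', rfl⟩ := hs' m'
    refine ⟨cocycleMap n (dfst E.C E'.C) z + cocycleMap n (dsnd E.C E'.C) z',
      Prod.ext (congrArg π (Subtype.ext (InvDual.ext fun y => ?_)))
        (congrArg π' (Subtype.ext (InvDual.ext fun y => ?_)))⟩
    · show z.1 y + z'.1 0 = z.1 y
      rw [map_zero, add_zero]
    · show z.1 0 + z'.1 y = z'.1 y
      rw [map_zero, zero_add]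
  · refine Iff.trans ?_ (exists_coboundary_iff (C := dsum E.C E'.C) z.1).symm
    have h1 := (hk (cocycleMap n (dinl E.C E'.C) z)).trans (exists_coboundary_iff _)
    have h2 := (hk' (cocycleMap n (dinr E.C E'.C) z)).trans (exists_coboundary_iff _)
    constructor
    · intro h
      have b1 := h1.1 (congrArg Prod.fst h)
      have b2 := h2.1 (congrArg Prod.snd h)
      have e := dual_dsum_eq n z.1
      rw [e]
      exact (b1.map (dfst E.C E'.C)).add (b2.map (dsnd E.C E'.C))
    · intro h
      exact Prod.ext (h1.2 (h.map (dinl E.C E'.C))) (h2.2 (h.map (dinr E.C E'.C)))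
  · show F.lam _ _ + F'.lam _ _ = _
    erw [hl, hl']
    rfl
  · show F.mu _ + F'.mu _ = _
    erw [hm, hm']
    exact (StrData.wu_add (E.S.push (dinl E.C E'.C)) (E'.S.push (dinr E.C E'.C)) z.1 z.2).symm

theorem IsCohomologyForm.neg (h : IsCohomologyForm E F) : IsCohomologyForm E.neg F.neg := by
  obtain ⟨π, hs, hk, hl, hm⟩ := h
  refine ⟨π, hs, hk, fun z w => ?_, fun z => ?_⟩
  · show -F.lam _ _ = _
    erw [hl]
    rfl
  · show -F.mu _ = _
    erw [hm]
    exact (StrData.wu_neg E.S z.1 z.2).symm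

/-- Both modules are quotients of the cocycles by the coboundaries, so the cohomology form is unique
up to isomorphism. -/
theorem IsCohomologyForm.iso (h : IsCohomologyForm E F) (h' : IsCohomologyForm E F') :
    F.Iso F' := by
  obtain ⟨π, hs, hk, hl, hm⟩ := h
  obtain ⟨π', hs', hk', hl', hm'⟩ := h'
  have hker : LinearMap.ker π = LinearMap.ker π' := by
    ext z
    exact (hk z).trans (hk' z).symm
  let e : F.M ≃ₗ[A] F'.M := (π.quotKerEquivOfSurjective hs).symm ≪≫ₗ
    Submodule.quotEquivOfEq _ _ hker ≪≫ₗ π'.quotKerEquivOfSurjective hs'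
  have he : ∀ z, e (π z) = π' z := fun z => by
    have : (π.quotKerEquivOfSurjective hs).symm (π z) = Submodule.Quotient.mk z := by
      rw [LinearEquiv.symm_apply_eq]
      rfl
    show π'.quotKerEquivOfSurjective hs' (Submodule.quotEquivOfEq _ _ hker
      ((π.quotKerEquivOfSurjective hs).symm (π z))) = _
    rw [this]
    rfl
  refine ⟨e, fun x y => ?_, fun x => ?_⟩
  · obtain ⟨z, rfl⟩ := hs x
    obtain ⟨w, rfl⟩ := hs y
    rw [he, he, hl, hl']
  · obtain ⟨z, rfl⟩ := hs x
    rw [he, hm, hm']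

theorem IsCohomologyForm.of_iso (h : IsCohomologyForm E F) (e : F.Iso F') :
    IsCohomologyForm E F' := by
  obtain ⟨π, hs, hk, hl, hm⟩ := h
  obtain ⟨e, el, em⟩ := e
  refine ⟨e.toLinearMap ∘ₗ π, e.surjective.comp hs, fun z => ?_, fun z w => ?_, fun z => ?_⟩
  · rw [LinearMap.comp_apply, LinearEquiv.coe_coe, LinearEquiv.map_eq_zero_iff, hk]
  · exact (el _ _).trans (hl z w)
  · exact (em _).trans (hm z)

theorem subsingleton_dual {M : Type u} [AddCommGroup M] [Module A M] [Subsingleton M] :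
    Subsingleton (InvDual A M) :=
  ⟨fun f g => InvDual.ext fun x => by rw [Subsingleton.elim x 0, map_zero, map_zero]⟩

/-- For a complex concentrated in degree `n` there are no nonzero `n`-coboundaries, and cocycles
coincide with cohomology. -/
theorem isFormCx_iff : IsFormCx F E ↔
    (∀ r, r ≠ n → Subsingleton (E.C.X r)) ∧ IsCohomologyForm E F := by
  refine and_congr_right fun hC => ?_
  have h1 := hC (n - 1) (by omega)
  constructor
  · rintro ⟨e, hl, hm⟩
    refine ⟨e.symm.toLinearMap, e.symm.surjective, fun z => ?_, fun z w => ?_, fun z => ?_⟩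
    · rw [LinearEquiv.coe_coe, LinearEquiv.map_eq_zero_iff]
      constructor
      · rintro rfl
        exact ⟨0, map_zero _⟩
      · rintro ⟨w, hw⟩
        have := subsingleton_dual (A := A) (M := E.C.X (n - 1))
        rw [Subsingleton.elim w 0, map_zero] at hw
        exact Subtype.ext hw.symm
    · rw [LinearEquiv.coe_coe, ← hl, e.apply_symm_apply, e.apply_symm_apply]
    · rw [LinearEquiv.coe_coe, ← hm]
      simp only [e.apply_symm_apply]
  · rintro ⟨π, hs, hk, hl, hm⟩
    have hinj : Function.Injective π := by
      refine (injective_iff_map_eq_zero π).2 fun z hz => ?_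
      obtain ⟨w, hw⟩ := (hk z).1 hz
      have := subsingleton_dual (A := A) (M := E.C.X (n - 1))
      rw [Subsingleton.elim w 0, map_zero] at hw
      exact Subtype.ext hw.symm
    have he : ∀ x, π ((LinearEquiv.ofBijective π ⟨hinj, hs⟩).symm x) = x := fun x =>
      (LinearEquiv.ofBijective π ⟨hinj, hs⟩).apply_symm_apply x
    refine ⟨(LinearEquiv.ofBijective π ⟨hinj, hs⟩).symm, fun x y => ?_, fun x => ?_⟩
    · rw [← hl, he, he]
    · rw [← hm, he]

theorem IsFormCx.isCohomologyForm (h : IsFormCx F E) : IsCohomologyForm E F := (isFormCx_iff.1 h).2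

theorem IsFormCx.sum (h : IsFormCx F E) (h' : IsFormCx F' E') :
    IsFormCx (F.sum F') (E.sum E') := by
  rw [isFormCx_iff] at h h' ⊢
  refine ⟨fun r hr => ?_, h.2.sum h'.2⟩
  have := h.1 r hr
  have := h'.1 r hr
  exact inferInstanceAs (Subsingleton (E.C.X r × E'.C.X r))

theorem IsFormCx.neg (h : IsFormCx F E) : IsFormCx F.neg E.neg := by
  rw [isFormCx_iff] at h ⊢
  exact ⟨h.1, h.2.neg⟩

theorem IsFormCx.of_iso (h : IsFormCx F E) (e : F.Iso F') : IsFormCx F' E := by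
  rw [isFormCx_iff] at h ⊢
  exact ⟨h.1, h.2.of_iso e⟩

end CohomologyForms

/-! ### Complexes concentrated in degree `n`, and the realization of forms. -/

section Concentrated

variable {A : Type u} [Ring A] {n : ℤ} {C D : ChainComplex (ModuleCat.{u} A) ℤ}

theorem exists_concentrated (N : Type u) [AddCommGroup N] [Module A N] [Module.Finite A N]
    [Module.Projective A N] (hn : 0 ≤ n) : ∃ C : ChainComplex (ModuleCat.{u} A) ℤ,
      (∀ r, r ≠ n → Subsingleton (C.X r)) ∧ IsDim (2 * n) C ∧ Nonempty (C.X n ≃ₗ[A] N) := by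
  let C := (HomologicalComplex.single (ModuleCat.{u} A) (ComplexShape.down ℤ) n).obj
    (ModuleCat.of A N)
  have h0 : ∀ r, r ≠ n → Subsingleton (C.X r) := fun r hr =>
    ModuleCat.subsingleton_of_isZero
      (HomologicalComplex.isZero_single_obj_X (ComplexShape.down ℤ) n _ r hr)
  have e : C.X n ≃ₗ[A] N :=
    (HomologicalComplex.singleObjXSelf (ComplexShape.down ℤ) n (ModuleCat.of A N)).toLinearEquiv
  refine ⟨C, h0, ⟨fun r => ?_, fun r => ?_, fun r hr => h0 r (by omega)⟩, ⟨e⟩⟩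
  · by_cases hr : r = n
    · subst hr
      exact Module.Finite.equiv e.symm
    · have := h0 r hr
      infer_instance
  · by_cases hr : r = n
    · subst hr
      exact Module.Projective.of_equiv e.symm
    · have := h0 r hr
      infer_instance

/-- The chain map between complexes concentrated in degree `n` given by a linear map. -/
def concMap (hC : ∀ r, r ≠ n → Subsingleton (C.X r)) (hD : ∀ r, r ≠ n → Subsingleton (D.X r))
    (g : C.X n →ₗ[A] D.X n) : C ⟶ D where
  f r := ModuleCat.ofHom (castX D n r ∘ₗ g ∘ₗ castX C r n)
  comm' r s h := by
    refine ModuleCat.hom_ext (LinearMap.ext fun x => ?_)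
    by_cases hr : r = n
    · have hs : s ≠ n := by
        have : s + 1 = r := h
        omega
      have := hD s hs
      exact Subsingleton.elim _ _
    · have := hC r hr
      rw [Subsingleton.elim x 0, map_zero, map_zero]

theorem concMap_f (hC : ∀ r, r ≠ n → Subsingleton (C.X r))
    (hD : ∀ r, r ≠ n → Subsingleton (D.X r)) (g : C.X n →ₗ[A] D.X n) (x : C.X n) :
    (concMap hC hD g).f n x = g x := by
  show castX D n n (g (castX C n n x)) = g x
  rw [castX_self, castX_self]

variable [StarRing A] {β : ChainBundle A}

/-- The hyperquadratic chain given by a pairing `C^n → C_n` in degree `s₀`. -/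
def concHyp (s₀ : ℤ) (φ : InvDual A (C.X n) →ₗ[A] InvDual A (InvDual A (C.X n))) :
    Hyp (dualCx C) :=
  fun s p q => if s = s₀ then pullPair φ (dualMap (castX C n p)) (dualMap (castX C n q)) else 0

theorem dualMap_castX_self (x : InvDual A (C.X n)) : dualMap (castX C n n) x = x :=
  InvDual.ext fun y => by rw [dualMap_apply, castX_self]

theorem concHyp_self (s₀ : ℤ) (φ : InvDual A (C.X n) →ₗ[A] InvDual A (InvDual A (C.X n)))
    (x y : InvDual A (C.X n)) : concHyp s₀ φ s₀ n n x y = φ x y := by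
  rw [concHyp, if_pos rfl, pullPair_apply, dualMap_castX_self, dualMap_castX_self]

theorem concHyp_ne {s₀ s : ℤ} (h : s ≠ s₀)
    (φ : InvDual A (C.X n) →ₗ[A] InvDual A (InvDual A (C.X n))) (p q : ℤ) :
    concHyp s₀ φ s p q = 0 := by
  rw [concHyp, if_neg h]

section

variable (hC : ∀ r, r ≠ n → Subsingleton (C.X r))

include hC

theorem dual_eq_zero {p : ℤ} (hp : p ≠ n) (x : InvDual A (C.X p)) : x = 0 := by
  have := hC p hp
  have := subsingleton_dual (A := A) (M := C.X p)
  exact Subsingleton.elim _ _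

theorem hyp_apply_eq_zero {p q : ℤ} (h : p ≠ n ∨ q ≠ n) (θ : Hyp (dualCx C)) (s : ℤ) :
    θ s p q = 0 := by
  refine LinearMap.ext fun x => InvDual.ext fun y => ?_
  rcases h with h | h
  · rw [dual_eq_zero hC h x, map_zero, LinearMap.zero_apply]
  · rw [dual_eq_zero hC h y, map_zero, map_zero]

theorem hyp_ext_of_conc {θ θ' : Hyp (dualCx C)}
    (h : ∀ s (x y : InvDual A (C.X n)), θ s n n x y = θ' s n n x y) : θ = θ' := by
  funext s p q
  by_cases hpq : p ≠ n ∨ q ≠ n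
  · rw [hyp_apply_eq_zero hC hpq θ, hyp_apply_eq_zero hC hpq θ']
  · push Not at hpq
    obtain ⟨rfl, rfl⟩ := hpq
    exact LinearMap.ext fun x => InvDual.ext fun y => h s x y

theorem isChain_concHyp (s₀ : ℤ) (φ : InvDual A (C.X n) →ₗ[A] InvDual A (InvDual A (C.X n)))
    {m : ℤ} (h : m + s₀ = 2 * n) : IsChain m (concHyp s₀ φ) := by
  intro s p q hpq
  by_cases hs : s = s₀
  · exact hyp_apply_eq_zero hC (by omega) _ s
  · exact concHyp_ne hs φ p q

/-- With no differential only the transposition terms survive, so each structure equation concerns a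
single value of `s`. -/
theorem hypD_conc (m : ℤ) (θ : Hyp (dualCx C)) (s : ℤ) (x y : InvDual A (C.X n)) :
    hypD m θ s n n x y = (m + s - 1).negOnePow • (θ (s - 1) n n x y
      + s.negOnePow • n.negOnePow • star (θ (s - 1) n n y x)) := by
  have h0 : ∀ x : InvDual A (C.X n), (dualCx C).d n (n + 1) x = 0 := fun x =>
    dual_eq_zero hC (by omega) _
  rw [hypD_apply, h0, h0, map_zero, map_zero, InvDual.zero_apply, smul_zero, zero_add, zero_add,
    Int.negOnePow_mul_self]

theorem cocycle_conc (x : InvDual A (C.X n)) : dualMap (C.d (n + 1) n).hom x = 0 :=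
  dual_eq_zero hC (by omega) _

theorem isBd_conc {x : C.X n} (h : IsBd C x) : x = 0 := by
  obtain ⟨j, c, rfl⟩ := h
  by_cases hj : j = n
  · subst hj
    exact d_eq_zero_of_ne C (by omega) _
  · have := hC j hj
    rw [Subsingleton.elim c 0, map_zero]

theorem coBd_conc {x : InvDual A (C.X n)} (h : CoBd C x) : x = 0 := by
  obtain ⟨w, hw⟩ := (exists_coboundary_iff x).2 h
  rw [← hw, dual_eq_zero hC (by omega) w, map_zero]

/-- The cochain map `C^* → B_{2n-*}` given by a map `C^n → B_n` of a complex concentrated in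
degree `n`. -/
def concBundleMap (f : InvDual A (C.X n) →ₗ[A] β.B.X n) (hf : ∀ x, β.B.d n (n - 1) (f x) = 0) :
    dualCx C ⟶ bundleCx (2 * n) β.B where
  f p := ModuleCat.ofHom (castX β.B n (2 * n - p) ∘ₗ f ∘ₗ dualMap (castX C n p))
  comm' p q h := by
    refine ModuleCat.hom_ext (LinearMap.ext fun (x : InvDual A (C.X p)) => ?_)
    obtain rfl : p + 1 = q := h
    by_cases hp : p = n
    · subst hp
      have h0 : (dualCx C).d p (p + 1) x = 0 := cocycle_conc hC x
      show (bundleCx (2 * p) β.B).d p (p + 1) (castX β.B p (2 * p - p) (f (dualMap _ x)))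
        = castX _ _ _ (f (dualMap _ ((dualCx C).d p (p + 1) x)))
      rw [h0, map_zero, map_zero, map_zero, bundleCx_d, d_castX (by ring) (by ring) (i' := p - 1),
        hf, map_zero, smul_zero]
    · rw [dual_eq_zero hC hp x, map_zero, map_zero]

theorem concBundleMap_fn {φ θ : Hyp (dualCx C)} (f : InvDual A (C.X n) →ₗ[A] β.B.X n)
    (hf : ∀ x, β.B.d n (n - 1) (f x) = 0) (x : InvDual A (C.X n)) :
    (StrData.mk φ θ (concBundleMap hC f hf)).fn x = f x := by
  rw [StrData.fn_eq]
  show castX β.B _ _ (castX β.B n (2 * n - n) (f (dualMap (castX C n n) x))) = _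
  rw [dualMap_castX_self, castX_castX (by ring), castX_self]

/-- Two equations carry content: `dφ = 0` at `s = 1` is the symmetry of `λ`, and the equation for
`θ` at `s = 0` is the presentation identity. For the other `s` everything vanishes for reasons of
degree. -/
theorem isStr_conc {f : InvDual A (C.X n) →ₗ[A] β.B.X n}
    {θ lam : InvDual A (C.X n) →ₗ[A] InvDual A (InvDual A (C.X n))}
    {mu : InvDual A (C.X n) → (Q β n).carrier} (P : Presents f θ lam mu) :
    (StrData.mk (concHyp 0 lam) (concHyp (-1) θ) (concBundleMap hC f P.d_f)).IsStr where
  φ_chain := isChain_concHyp hC 0 lam (by ring)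
  φ_symm s p q hs := concHyp_ne (by omega) lam p q
  θ_chain := isChain_concHyp hC (-1) θ (by ring)
  φ_cycle := by
    refine hyp_ext_of_conc hC fun s x y => ?_
    rw [hypD_conc hC]
    by_cases hs : s = 1
    · subst hs
      show _ • (concHyp 0 lam 0 n n x y + _ • _ • star (concHyp 0 lam 0 n n y x)) = 0
      rw [concHyp_self, concHyp_self, P.lam_symm, Int.negOnePow_one, Units.neg_smul, one_smul,
        add_neg_cancel, smul_zero]
    · have h0 : concHyp 0 lam (s - 1) n n = 0 := concHyp_ne (by omega) _ _ _
      dsimp only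
      rw [h0]
      simp
  eq := by
    refine hyp_ext_of_conc hC fun s x y => ?_
    rw [hypD_conc hC]
    show concHyp 0 lam s n n x y - susp β (2 * n) s n n _ _ = _
    by_cases hs : s = 0
    · subst hs
      have h := susp_fn (StrData.mk (concHyp 0 lam) (concHyp (-1) θ) (concBundleMap hC f P.d_f))
        (StrData.mk (concHyp 0 lam) (concHyp (-1) θ) (concBundleMap hC f P.d_f)) x y
      rw [concBundleMap_fn, concBundleMap_fn] at h
      refine (congrArg (concHyp 0 lam 0 n n x y - ·) h).trans ?_
      show _ = _ • (concHyp (-1) θ (-1) n n x y + _ • _ • star (concHyp (-1) θ (-1) n n y x))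
      rw [concHyp_self, concHyp_self, concHyp_self, P.lam_eq, Int.negOnePow_zero, one_smul,
        Int.negOnePow_even (2 * n + 1 + 0 - 1) ⟨n, by ring⟩, one_smul]
    · have h0 : concHyp (-1) θ (s - 1) n n = 0 := concHyp_ne (by omega) _ _ _
      have h1 : concHyp 0 lam s n n = 0 := concHyp_ne hs _ _ _
      dsimp only
      rw [h0, h1, susp, β.β_deg _ _ _ (by omega)]
      simp

theorem isPoincare_conc (hdim : IsDim (2 * n) C) {f : InvDual A (C.X n) →ₗ[A] β.B.X n}
    {θ lam : InvDual A (C.X n) →ₗ[A] InvDual A (InvDual A (C.X n))}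
    {mu : InvDual A (C.X n) → (Q β n).carrier} (P : Presents f θ lam mu)
    (hlam : Function.Bijective lam) :
    (StrData.mk (concHyp 0 lam) (concHyp (-1) θ) (concBundleMap hC f P.d_f)).IsPoincare := by
  have hsharp : ∀ x y : InvDual A (C.X n), y (hypSharp (concHyp 0 lam) n n x) = star (lam x y) :=
    fun x y => by rw [apply_hypSharp hdim, concHyp_self]
  refine (StrData.isPoincare_iff hdim (isStr_conc hC P)).2 ⟨fun p q hpq x _ hb => ?_,
    fun p q hpq c _ => ?_⟩
  · by_cases hp : p = n
    · subst hp
      obtain rfl : q = p := by omega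
      have h0 := isBd_conc hC hb
      have : x = 0 := hlam.1 (InvDual.ext fun y => star_injective <| by
        rw [map_zero, InvDual.zero_apply, ← hsharp, star_zero]
        exact (congrArg y h0).trans (map_zero y))
      rw [this]
      exact coBd_zero
    · rw [dual_eq_zero hC hp x]
      exact coBd_zero
  · by_cases hq : q = n
    · subst hq
      obtain rfl : p = q := by omega
      obtain ⟨x, hx⟩ := hlam.2 (evalDual _ c)
      refine ⟨x, (coCyc_iff rfl _).2 (cocycle_conc hC x), ?_⟩
      have : c = hypSharp (concHyp 0 lam) p p x := hdim.ext fun y => by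
        rw [hsharp, hx, evalDual_apply, star_star]
      rw [← this, sub_self]
      exact isBd_zero
    · have := hC q hq
      exact ⟨0, coCyc_zero, by rw [Subsingleton.elim (c - _) 0]; exact isBd_zero⟩

end

/-- The bidual of a finitely generated projective module. -/
theorem exists_bidual_equiv {X L : Type u} [AddCommGroup X] [Module A X] [AddCommGroup L]
    [Module A L] [Module.Finite A L] [Module.Projective A L] (e : X ≃ₗ[A] InvDual A L) :
    Nonempty (InvDual A X ≃ₗ[A] L) := by
  have h1 : Function.Bijective (dualMap e.toLinearMap) := by
    constructor
    · intro f g h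
      refine InvDual.ext fun y => ?_
      obtain ⟨x, rfl⟩ := e.surjective y
      exact DFunLike.congr_fun h x
    · intro f
      exact ⟨dualMap e.symm.toLinearMap f, InvDual.ext fun x => by simp⟩
  exact ⟨(LinearEquiv.ofBijective _ ⟨evalDual_injective (A := A) (M := L), evalDual_surjective⟩
    ≪≫ₗ LinearEquiv.ofBijective _ h1).symm⟩

/-- Every form is the form of a Poincaré complex concentrated in degree `n`. -/
theorem exists_isFormCx (hn : 0 ≤ n) (F : QForm (Q β n)) : ∃ E, IsFormCx F E := by
  -- Taking `C_n = M^*` gives `C^n = M^{**}`, which is identified with `M` by reflexivity.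
  obtain ⟨C, hC, hdim, ⟨e⟩⟩ := exists_concentrated (A := A) (InvDual A F.M) hn
  obtain ⟨e₀⟩ := exists_bidual_equiv e
  obtain ⟨f, θ, P⟩ := exists_presents F.lam F.mu F.lam_symm F.mu_smul F.r_mu F.mu_add
  have P' := P.comp e₀.toLinearMap
  have hbij : Function.Bijective (pullPair F.lam e₀.toLinearMap e₀.toLinearMap) := by
    constructor
    · intro x y h
      refine e₀.injective (F.nonsing.1 (InvDual.ext fun z => ?_))
      obtain ⟨w, rfl⟩ := e₀.surjective z
      exact DFunLike.congr_fun h w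
    · intro g
      obtain ⟨m, hm⟩ := F.nonsing.2 (dualMap e₀.symm.toLinearMap g)
      refine ⟨e₀.symm m, InvDual.ext fun z => ?_⟩
      simp [hm]
  refine ⟨⟨C, hdim, _, isStr_conc hC P', isPoincare_conc hC hdim P' hbij⟩, ?_⟩
  refine isFormCx_iff.2 ⟨hC, e₀.toLinearMap ∘ₗ Submodule.subtype _, fun m => ?_, fun z => ?_,
    fun z w => ?_, fun z => ?_⟩
  · exact ⟨⟨e₀.symm m, cocycle_conc hC _⟩, e₀.apply_symm_apply m⟩
  · show e₀ z.1 = 0 ↔ _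
    rw [LinearEquiv.map_eq_zero_iff]
    refine ⟨fun h => ⟨0, by rw [h, map_zero]⟩, fun h => ?_⟩
    exact coBd_conc hC ((exists_coboundary_iff _).1 h)
  · exact (concHyp_self 0 (pullPair F.lam e₀.toLinearMap e₀.toLinearMap) z.1 w.1).symm
  · refine (P'.mu_eq z.1).trans (Q.mk_congr ?_ ?_)
    · exact (concHyp_self (-1) (pullPair θ e₀.toLinearMap e₀.toLinearMap) z.1 z.1).symm
    · exact (concBundleMap_fn hC _ P'.d_f z.1).symm

end Concentrated

/-! ### Hyperbolic forms bound; the morphism to the `L`-group and the criterion for a splitting. -/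

section Hyperbolic

variable {A : Type u} [Ring A] [StarRing A] {n : ℤ} {β : ChainBundle A}

theorem exists_dual_preimage {X Y : Type u} [AddCommGroup X] [Module A X] [AddCommGroup Y]
    [Module A Y] [Module.Finite A Y] [Module.Projective A Y] (g : InvDual A Y →ₗ[A] InvDual A X) :
    ∃ i : X →ₗ[A] Y, ∀ y x, y (i x) = g y x :=
  ⟨sharp (transpose g), fun y x => by rw [apply_sharp, transpose_apply, star_star]⟩

theorem hypHtpy_apply {X Y : CochainComplex (ModuleCat.{u} A) ℤ} (m : ℤ) (v v' : X ⟶ Y)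
    (h : ∀ p, X.X p →ₗ[A] Y.X (p - 1)) (θ : Hyp Y) (s p q : ℤ) (x : X.X p) (y : X.X q) :
    hypHtpy m v v' h θ s p q x y = θ s p (q - 1) (v.f p x) (h q y)
      + q.negOnePow • θ s (p - 1) q (h p x) (v'.f q y)
      + (m - 1 + q).negOnePow • ((p - 1) * (q - 1)).negOnePow •
        star (θ (s - 1) (q - 1) (p - 1) (h q y) (h p x)) := by
  simp only [hypHtpy, hypT]
  rcases Int.units_eq_one_or q.negOnePow with e1 | e1 <;>
  rcases Int.units_eq_one_or (m - 1 + q).negOnePow with e2 | e2 <;>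
  rcases Int.units_eq_one_or ((p - 1) * (q - 1)).negOnePow with e3 | e3 <;>
  rw [e1, e2, e3] <;> simp

theorem hyp_sub_sub_add_apply {X : CochainComplex (ModuleCat.{u} A) ℤ} (ξ σ θ' θ : Hyp X)
    (s p q : ℤ) (x : X.X p) (y : X.X q) : (ξ - σ - θ' + θ) s p q x y
      = ξ s p q x y - σ s p q x y - θ' s p q x y + θ s p q x y := rfl

theorem hyp_zero_apply {X : CochainComplex (ModuleCat.{u} A) ℤ} (s p q : ℤ) (x : X.X p)
    (y : X.X q) : (0 : Hyp X) s p q x y = 0 := rfl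

/-- The data of a Poincaré pair `(C → D)` with `C` and `D` concentrated in degree `n`, determined by
a null-homotopy `h` and a pairing `χ`. -/
theorem exists_strEquiv_conc {C D : ChainComplex (ModuleCat.{u} A) ℤ}
    (hD : ∀ r, r ≠ n → Subsingleton (D.X r)) {S : StrData β n C} (hS : S.IsStr) (i : C ⟶ D)
    (h₀ : InvDual A (D.X n) →ₗ[A] β.B.X (n + 1))
    (χ : InvDual A (D.X n) →ₗ[A] InvDual A (InvDual A (D.X n)))
    (hφ : ∀ x y, S.φ 0 n n (dualMap (i.f n).hom x) (dualMap (i.f n).hom y) = 0)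
    (hh : ∀ x, -S.fn (dualMap (i.f n).hom x) = n.negOnePow • β.B.d (n + 1) n (h₀ x))
    (hχ : ∀ x y, S.θ (-1) n n (dualMap (i.f n).hom x) (dualMap (i.f n).hom y)
      - β.β (-2 * n - 1) n (n + 1) (S.fn (dualMap (i.f n).hom x)) (h₀ y)
      - star (β.β (-2 * n - 2) (n + 1) (n + 1) (h₀ y) (h₀ x))
        = χ x y - n.negOnePow • star (χ y x)) :
    ∃ E : StrEquiv (S.push i) 0, E.ξ = 0 := by
  let h : ∀ p : ℤ, (dualCx D).X p →ₗ[A] (bundleCx (2 * n) β.B).X (p - 1) := fun p =>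
    castX β.B (n + 1) (2 * n - (p - 1)) ∘ₗ h₀ ∘ₗ dualMap (castX D n p)
  have hn : ∀ x, h n x = castX β.B (n + 1) (2 * n - (n - 1)) (h₀ x) := fun x => by
    show castX β.B (n + 1) (2 * n - (n - 1)) (h₀ (dualMap (castX D n n) x)) = _
    rw [dualMap_castX_self]
  -- `ξ = 0` works because `φ_0` vanishes on the image of `D^n`. A `(2n+2)`-chain on `D` is nonzero
  -- only in degree `s = -2`, so `χ` is `η_{-2}` and the `η`-equation has content only at `s = -1`.
  refine ⟨⟨0, concHyp (-2) χ, h, fun _ _ _ _ => rfl, fun _ _ _ _ => rfl,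
    isChain_concHyp hD (-2) χ (by ring), fun p x => ?_, ?_, ?_⟩, rfl⟩
  · by_cases hp : p = n
    · subst hp
      have h0 : (dualCx D).d p (p + 1) x = 0 := cocycle_conc hD x
      rw [h0, map_zero, map_zero, add_zero, hn, bundleCx_d,
        d_castX (by ring) (by ring) (i' := p), sub_add_cancel, ← map_units_smul, ← hh, map_neg,
        StrData.fn_eq, castX_castX (by ring), castX_self]
      exact zero_sub _
    · rw [dual_eq_zero hD hp x]
      simp only [map_zero]
      rw [sub_zero]
      exact (add_zero _).symm
  · refine hyp_ext_of_conc hD fun s x y => ?_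
    rw [hypD_zero]
    show 0 - S.φ s n n _ _ = 0
    by_cases hs : s = 0
    · subst hs
      exact (zero_sub _).trans (neg_eq_zero.2 (hφ x y))
    · rw [hS.φ_chain s n n (by omega)]
      exact sub_zero _
  · refine hyp_ext_of_conc hD fun s x y => ?_
    rw [hypD_conc hD]
    have hθ : (S.push i).θ s n n x y
      = S.θ s n n (dualMap (i.f n).hom x) (dualMap (i.f n).hom y) := rfl
    have hz : (0 : StrData β n D).f.f n y = 0 := rfl
    rw [hyp_sub_sub_add_apply, hypHtpy_apply, hθ, hz, map_zero, smul_zero, add_zero,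
      StrData.zero_θ, hyp_zero_apply, sub_zero, zero_sub]
    by_cases hs : s = -1
    · subst hs
      have e1 : (2 * n - 1 + n).negOnePow • ((n - 1) * (n - 1)).negOnePow = (1 : ℤˣ) := by
        rw [smul_eq_mul, ← Int.negOnePow_add]
        exact Int.negOnePow_even _ (by
          rcases Int.even_or_odd n with ⟨k, rfl⟩ | ⟨k, rfl⟩
          · exact ⟨2 * k * k + k, by ring⟩
          · exact ⟨2 * k * k + 3 * k + 1, by ring⟩)
      rw [← smul_assoc, e1, one_smul, hn, hn]
      have b1 : susp β (2 * n) (-1) n (n - 1) ((S.push i).f.f n x)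
          (castX β.B (n + 1) (2 * n - (n - 1)) (h₀ y))
          = β.β (-2 * n - 1) n (n + 1) (S.fn (dualMap (i.f n).hom x)) (h₀ y) := by
        refine (ChainBundle.β_castX (s' := -2 * n - 1) (i' := n) (j' := n + 1) (by ring) (by ring)
          (by ring) _ _).trans ?_
        rw [castX_castX (by ring), castX_self, StrData.fn_eq]
        rfl
      have b2 : susp β (2 * n) (-1 - 1) (n - 1) (n - 1)
          (castX β.B (n + 1) (2 * n - (n - 1)) (h₀ y))
          (castX β.B (n + 1) (2 * n - (n - 1)) (h₀ x))
          = β.β (-2 * n - 2) (n + 1) (n + 1) (h₀ y) (h₀ x) := by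
        refine (ChainBundle.β_castX (s' := -2 * n - 2) (i' := n + 1) (j' := n + 1) (by ring)
          (by ring) (by ring) _ _).trans ?_
        rw [castX_castX (by ring), castX_self, castX_castX (by ring), castX_self]
      rw [b1, b2, show (-1 : ℤ) - 1 = -2 from rfl, concHyp_self, concHyp_self,
        Int.negOnePow_even (2 * n + 2 + -1 - 1) ⟨n, by ring⟩,
        Int.negOnePow_odd (-1) ⟨-1, by ring⟩, one_smul, Units.neg_smul, one_smul, ← sub_eq_add_neg,
        ← hχ]
      abel
    · have h0 : concHyp (-2) χ (s - 1) n n = 0 := concHyp_ne (by omega) _ _ _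
      rw [h0, hS.θ_chain s n n (by omega), susp, susp, β.β_deg _ _ _ (by omega),
        β.β_deg _ _ _ (by omega)]
      simp

/-- The Poincaré complex of a hyperbolic form is a boundary. -/
theorem IsFormCx.isBoundary (hn : 0 ≤ n) {F : QForm (Q β n)} {E : PoincareCx β n}
    (h : IsFormCx F E) (hF : F.IsHyperbolic) : E.S.IsBoundary := by
  obtain ⟨hC, e, hl, hm⟩ := h
  obtain ⟨L, ρ, hρ, hex, hsurj, hmu⟩ := hF.exists_injection
  have : Module.Finite A L := .of_surjective ρ fun l => ⟨l, LinearMap.congr_fun hρ l⟩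
  have : Module.Projective A L := Module.Projective.of_split L.subtype ρ hρ
  -- `D_n = L^*`, so that `D^n` is `L` and the chain map `i` is dual to the inclusion of the
  -- lagrangian.
  obtain ⟨D, hD, hdim, ⟨a⟩⟩ := exists_concentrated (A := A) (InvDual A L) hn
  obtain ⟨b⟩ := exists_bidual_equiv a
  have hdim' : IsDim (2 * n + 1) D := hdim.mono (by omega)
  have := hdim.fin n
  have := hdim.proj n
  let g : InvDual A (D.X n) →ₗ[A] LinearMap.ker (dualMap (E.C.d (n + 1) n).hom) :=
    e.toLinearMap ∘ₗ L.subtype ∘ₗ b.toLinearMap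
  obtain ⟨i₀, hi₀⟩ := exists_dual_preimage (Submodule.subtype _ ∘ₗ g)
  let i := concMap hC hD i₀
  have hi : ∀ x, dualMap (i.f n).hom x = (g x).1 := fun x => InvDual.ext fun y =>
    (congrArg x (concMap_f hC hD i₀ y)).trans (hi₀ x y)
  have P := E.isStr.presents.comp g
  -- Both `λ` and `μ` vanish on `L`, so the structure restricted to `L` presents the zero form and
  -- has a null-homotopy.
  have P0 : Presents (E.S.fn ∘ₗ Submodule.subtype _ ∘ₗ g)
      (pullPair (E.S.θ (-1) n n) (Submodule.subtype _ ∘ₗ g) (Submodule.subtype _ ∘ₗ g))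
      0 0 := by
    refine ⟨P.d_f, fun x y => (congrArg (· - _) ?_).trans (P.lam_eq x y), fun x =>
      Eq.trans ?_ (P.mu_eq x)⟩
    · exact (((hl _ _).trans ((hex _).2 (b x).2 _ (b y).2)).symm)
    · exact (((hm _).trans (hmu _ (b x).2)).symm)
  obtain ⟨h₀, χ, hh, hχ⟩ := P0.exists_null
  have hfull : ∀ z : InvDual A (E.C.X n), ∃ m, (e m).1 = z := fun z =>
    ⟨e.symm ⟨z, cocycle_conc hC z⟩, by rw [e.apply_symm_apply]⟩
  obtain ⟨K, hK⟩ := exists_strEquiv_conc hD E.isStr i h₀ χ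
    (fun x y => by rw [hi, hi]; exact (hl _ _).trans ((hex _).2 (b x).2 _ (b y).2))
    (fun x => by rw [hi]; exact hh x) (fun x y => by rw [hi, hi]; exact hχ x y)
  refine StrData.isBoundary_of E.dim E.isStr hdim' K ?_
  rw [hK]
  have hinj : Function.Injective g := e.injective.comp (L.subtype_injective.comp b.injective)
  constructor
  · intro p q q' hpq hq x _ y c _ h2
    by_cases hp : p = n
    · subst hp
      obtain rfl : q = p + 1 := by omega
      obtain rfl : q' = p := by omega
      have := hC (q' + 1) (by omega)
      rw [Subsingleton.elim c 0, map_zero, neg_zero, hi] at h2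
      have : g x = 0 := by
        have h3 : F.lam (e.symm (g x)) = 0 := InvDual.ext fun m => by
          rw [← hl, e.apply_symm_apply]
          have h4 := apply_hypSharp E.dim E.S.φ q' q' (g x).1 (e m).1
          rw [h2, map_zero] at h4
          exact (star_eq_zero.1 h4.symm)
        have h4 := F.nonsing.1 (h3.trans (map_zero _).symm)
        rwa [LinearEquiv.map_eq_zero_iff] at h4
      rw [hinj (this.trans (map_zero g).symm)]
      exact coBd_zero
    · rw [dual_eq_zero hD hp x]
      exact coBd_zero
  · intro p q q' hpq hq y c h1 hc
    by_cases hq' : q' = n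
    · subst hq'
      obtain rfl : p = q' := by omega
      obtain rfl : q = p + 1 := by omega
      have := hD (p + 1) (by omega)
      rw [Subsingleton.elim y 0, map_zero, zero_add] at h1
      obtain ⟨z, -, hz⟩ := E.duality.surj p p (by ring) c hc
      have hz := sub_eq_zero.1 (isBd_conc hC hz)
      obtain ⟨m, rfl⟩ := hfull z
      -- A chain `c` with `i c = 0` is dual to some `m` orthogonal to `L`; exactness puts `m` in
      -- `L`. The remaining nonzero case, `q = n`, is surjectivity of `M → L^*`.
      have hm' : m ∈ L := (hex m).1 fun l hl' => by
        have h3 : b.symm ⟨l, hl'⟩ (i.f p c) = 0 := by rw [h1, map_zero]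
        have h4 : (dualMap (i.f p).hom (b.symm ⟨l, hl'⟩)) c = 0 := h3
        rw [hi, hz, apply_hypSharp E.dim, star_eq_zero] at h4
        rw [← hl]
        have h5 : g (b.symm ⟨l, hl'⟩) = e l := by
          show e (L.subtype (b (b.symm ⟨l, hl'⟩))) = e l
          rw [b.apply_symm_apply]
          rfl
        rwa [h5] at h4
      refine ⟨b.symm ⟨m, hm'⟩, (coCyc_iff rfl _).2 (cocycle_conc hD _), 0, 0,
        Subsingleton.elim _ _, ?_⟩
      have h5 : g (b.symm ⟨m, hm'⟩) = e m := by
        show e (L.subtype (b (b.symm ⟨m, hm'⟩))) = e m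
        rw [b.apply_symm_apply]
        rfl
      rw [hi, h5, map_zero, sub_zero]
      exact hz
    · have hc0 := hC q' hq'
      by_cases hqn : q = n
      · subst hqn
        obtain ⟨m, hm'⟩ := hsurj
          ((evalDual (D.X q) y : InvDual A (D.X q) →ₗ[A] A) ∘ₗ b.symm.toLinearMap)
        refine ⟨0, coCyc_zero, 0, hypSharp E.S.φ q q (e m).1, ?_, Subsingleton.elim _ _⟩
        rw [map_zero, map_zero, zero_add, zero_add]
        refine hdim.ext fun x => ?_
        have h3 : x (i.f q (hypSharp E.S.φ q q (e m).1))
          = (dualMap (i.f q).hom x) (hypSharp E.S.φ q q (e m).1) := rfl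
        rw [h3, hi, apply_hypSharp E.dim]
        have h4 := hm' (b x)
        have h5 : E.S.φ 0 q q (e m).1 (g x).1 = F.lam m (L.subtype (b x)) := hl _ _
        rw [h5, h4]
        show x y = star (evalDual (D.X q) y (b.symm (b x)))
        rw [b.symm_apply_apply, evalDual_apply, star_star]
      · have := hD q hqn
        exact ⟨0, coCyc_zero, 0, 0, Subsingleton.elim _ _, Subsingleton.elim _ _⟩

theorem IsFormCx.mk_eq_zero (hn : 0 ≤ n) {F : QForm (Q β n)} {E : PoincareCx β n}
    (h : IsFormCx F E) (hF : F.IsHyperbolic) : LSet.mk E = 0 :=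
  LSet.mk_of_isBoundary (h.isBoundary hn hF)

/-- The cobordism class of a complex associated to a form is determined by the form. -/
theorem IsFormCx.mk_eq (hn : 0 ≤ n) {F : QForm (Q β n)} {E E' : PoincareCx β n}
    (h : IsFormCx F E) (h' : IsFormCx F E') : LSet.mk E = LSet.mk E' := by
  have h1 := (h.sum h'.neg).mk_eq_zero hn (QForm.sum_neg_isHyperbolic F)
  -- `E` and `E'` both cancel `-E'`, hence are equal in the group.
  have h2 := (h'.sum h'.neg).mk_eq_zero hn (QForm.sum_neg_isHyperbolic F)
  rw [LSet.mk_sum] at h1 h2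
  exact add_right_cancel (h1.trans h2.symm)

/-- The morphism `W_{Q(n)}(A) → L⟨B, β⟩^{2n}(A)`. -/
noncomputable def wittToL (β : ChainBundle A) {n : ℤ} (hn : 0 ≤ n) :
    WSet (Q β n) →+ LSet β n where
  toFun := Quot.lift (fun F => LSet.mk (exists_isFormCx hn F).choose) (by
    rintro F G ⟨H, K, hH, hK, e⟩
    have hF := (exists_isFormCx hn F).choose_spec
    have hG := (exists_isFormCx hn G).choose_spec
    obtain ⟨EH, hEH⟩ := exists_isFormCx hn H
    obtain ⟨EK, hEK⟩ := exists_isFormCx hn K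
    -- A stable isomorphism is realized by two complexes of one form; the hyperbolic summands bound
    -- and disappear.
    have h := ((hF.sum hEH).of_iso e).mk_eq hn (hG.sum hEK)
    rwa [LSet.mk_sum, LSet.mk_sum, hEH.mk_eq_zero hn hH, hEK.mk_eq_zero hn hK, add_zero,
      add_zero] at h)
  map_zero' := (exists_isFormCx hn (QForm.zero (Q β n))).choose_spec.mk_eq_zero hn
    QForm.isHyperbolic_zero
  map_add' := by
    rintro ⟨F⟩ ⟨G⟩
    exact (exists_isFormCx hn (F.sum G)).choose_spec.mk_eq hn
      ((exists_isFormCx hn F).choose_spec.sum (exists_isFormCx hn G).choose_spec)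

theorem IsFormCx.wittToL_mk (hn : 0 ≤ n) {F : QForm (Q β n)} {E : PoincareCx β n}
    (h : IsFormCx F E) : wittToL β hn (WSet.mk F) = LSet.mk E :=
  (exists_isFormCx hn F).choose_spec.mk_eq hn h

/-- If every Poincaré complex has a cohomology form, and those of boundaries are trivial in the Witt
group, then the cohomology form gives a splitting of `wittToL`. -/
theorem exists_splitting (hn : 0 ≤ n)
    (H1 : ∀ E : PoincareCx β n, ∃ F : QForm (Q β n), IsCohomologyForm E F)
    (H2 : ∀ (E : PoincareCx β n) (F : QForm (Q β n)), IsCohomologyForm E F → E.S.IsBoundary →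
      WSet.mk F = 0) :
    ∃ Ψ : LSet β n →+ WSet (Q β n), (∀ w, Ψ (wittToL β hn w) = w) ∧
      ∀ (E : PoincareCx β n) (F : QForm (Q β n)), IsCohomologyForm E F →
        Ψ (LSet.mk E) = WSet.mk F := by
  choose F hF using H1
  have huniq : ∀ {E F'}, IsCohomologyForm E F' → WSet.mk (F E) = WSet.mk F' := fun h =>
    WSet.mk_eq_of_iso ((hF _).iso h)
  let Ψ : LSet β n →+ WSet (Q β n) := AddMonoidHom.mk' (Quot.lift (fun E => WSet.mk (F E)) (by
    intro E E' h
    -- Only generating cobordisms need to be tested, so transitivity of `Cobordant` is not needed.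
    have h1 := H2 _ _ ((hF E).sum (hF E').neg) ((E.cobordant_iff E').1 h)
    rwa [WSet.mk_sum, WSet.mk_neg, ← sub_eq_add_neg, sub_eq_zero] at h1)) (by
    rintro ⟨E⟩ ⟨E'⟩
    exact huniq ((hF E).sum (hF E')))
  refine ⟨Ψ, ?_, fun E F' h => huniq h⟩
  rintro ⟨G⟩
  exact huniq (exists_isFormCx hn G).choose_spec.isCohomologyForm

end Hyperbolic

/-! ### Components of a null-cobordism in degrees `n` and `n + 1`. -/

section Null

variable {A : Type u} [Ring A] [StarRing A] {n : ℤ} {β : ChainBundle A}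
  {C D : ChainComplex (ModuleCat.{u} A) ℤ} {S : StrData β n C} {i : C ⟶ D}

namespace StrEquiv

variable (E : StrEquiv (S.push i) 0)

/-- The component `D^n → B_{n+1}` of the null-homotopy. -/
def hn : InvDual A (D.X n) →ₗ[A] β.B.X (n + 1) :=
  castX β.B (2 * n - (n - 1)) (n + 1) ∘ₗ E.h n

/-- The component `D^{n+1} → B_n` of the null-homotopy. -/
def hs : InvDual A (D.X (n + 1)) →ₗ[A] β.B.X n :=
  castX β.B (2 * n - (n + 1 - 1)) n ∘ₗ E.h (n + 1)

theorem neg_fn (x : InvDual A (D.X n)) : -S.fn (dualMap (i.f n).hom x)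
    = n.negOnePow • β.B.d (n + 1) n (E.hn x) + E.hs (dualMap (D.d (n + 1) n).hom x) := by
  have h := congrArg (castX β.B (2 * n - n) n) (E.h_eq n x)
  have h1 : castX β.B (2 * n - n) n ((0 : StrData β n D).f.f n x - (S.push i).f.f n x)
      = -S.fn (dualMap (i.f n).hom x) := by
    rw [StrData.fn_eq, ← map_neg]
    exact congrArg _ (zero_sub _)
  have h2 : castX β.B (2 * n - n) n ((bundleCx (2 * n) β.B).d (n - 1) n (E.h n x))
      = n.negOnePow • β.B.d (n + 1) n (E.hn x) := by
    rw [bundleCx_d, map_units_smul, sub_add_cancel, hn, LinearMap.comp_apply,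
      d_castX (by ring) (by ring) (i' := 2 * n - n)]
  have h3 : ∀ (k : ℤ) (hk : k = n) (w : (bundleCx (2 * n) β.B).X k),
      castX β.B (2 * n - n) n (((bundleCx (2 * n) β.B).XIsoOfEq hk).hom w)
        = castX β.B (2 * n - k) n w := by
    rintro k rfl w
    simp [HomologicalComplex.XIsoOfEq]
  refine h1.symm.trans (h.trans ?_)
  refine (map_add _ _ _).trans ?_
  rw [h2]
  exact congrArg (_ + ·) (h3 _ _ _)

theorem xi_apply (s p q : ℤ) (x : InvDual A (D.X p)) (y : InvDual A (D.X q)) :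
    -S.φ s p q (dualMap (i.f p).hom x) (dualMap (i.f q).hom y)
      = E.ξ s p (q + 1) x (dualMap (D.d (q + 1) q).hom y)
        + q.negOnePow • E.ξ s (p + 1) q (dualMap (D.d (p + 1) p).hom x) y
        + (2 * n + 1 + s - 1).negOnePow • (E.ξ (s - 1) p q x y
          + s.negOnePow • (p * q).negOnePow • star (E.ξ (s - 1) q p y x)) := by
  have h : ((0 : StrData β n D).φ - (S.push i).φ) s p q x y = hypD (2 * n + 1) E.ξ s p q x y := by
    rw [E.ξ_eq]
  rw [hypD_apply] at h
  exact (zero_sub _).symm.trans h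

theorem eta_apply (s p q : ℤ) (x : InvDual A (D.X p)) (y : InvDual A (D.X q)) :
    E.ξ s p q x y - (susp β (2 * n) s p (q - 1) (S.f.f p (dualMap (i.f p).hom x)) (E.h q y)
        + (2 * n - 1 + q).negOnePow • ((p - 1) * (q - 1)).negOnePow •
          star (susp β (2 * n) (s - 1) (q - 1) (p - 1) (E.h q y) (E.h p x)))
        + S.θ s p q (dualMap (i.f p).hom x) (dualMap (i.f q).hom y)
      = E.η s p (q + 1) x (dualMap (D.d (q + 1) q).hom y)
        + q.negOnePow • E.η s (p + 1) q (dualMap (D.d (p + 1) p).hom x) y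
        + (2 * n + 2 + s - 1).negOnePow • (E.η (s - 1) p q x y
          + s.negOnePow • (p * q).negOnePow • star (E.η (s - 1) q p y x)) := by
  have h : (E.ξ - hypHtpy (2 * n) (S.push i).f (0 : StrData β n D).f E.h (susp β (2 * n))
      - (0 : StrData β n D).θ + (S.push i).θ) s p q x y = hypD (2 * n + 2) E.η s p q x y := by
    rw [E.η_eq]
  have hθ : (S.push i).θ s p q x y
      = S.θ s p q (dualMap (i.f p).hom x) (dualMap (i.f q).hom y) := rfl
  have hz : (0 : StrData β n D).f.f q y = 0 := rfl
  rw [hypD_apply, hyp_sub_sub_add_apply, hypHtpy_apply, hθ, hz, map_zero, smul_zero, add_zero,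
    StrData.zero_θ, hyp_zero_apply, sub_zero] at h
  exact h

theorem neg_phi_eq (x y : InvDual A (D.X n)) :
    -S.φ 0 n n (dualMap (i.f n).hom x) (dualMap (i.f n).hom y)
      = E.ξ 0 n (n + 1) x (dualMap (D.d (n + 1) n).hom y)
        + n.negOnePow • E.ξ 0 (n + 1) n (dualMap (D.d (n + 1) n).hom x) y := by
  have h := E.xi_apply 0 n n x y
  rw [E.ξ_symm (0 - 1) n n (by omega)] at h
  simpa using h

/-- The `s = -1` component of the `η`-equation, where `ξ_{-1}` is zero: `θ_{-1}` on restricted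
classes is expressed by the null-homotopy, up to terms in `d^* x`, `d^* y` and a skew term. -/
theorem theta_eq (x y : InvDual A (D.X n)) :
    S.θ (-1) n n (dualMap (i.f n).hom x) (dualMap (i.f n).hom y)
      = β.β (-2 * n - 1) n (n + 1) (S.fn (dualMap (i.f n).hom x)) (E.hn y)
        + star (β.β (-2 * n - 2) (n + 1) (n + 1) (E.hn y) (E.hn x))
        + E.η (-1) n (n + 1) x (dualMap (D.d (n + 1) n).hom y)
        + n.negOnePow • E.η (-1) (n + 1) n (dualMap (D.d (n + 1) n).hom x) y
        + (E.η (-2) n n x y - n.negOnePow • star (E.η (-2) n n y x)) := by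
  have h := E.eta_apply (-1) n n x y
  have e1 : (2 * n - 1 + n).negOnePow • ((n - 1) * (n - 1)).negOnePow = (1 : ℤˣ) := by
    rw [smul_eq_mul, ← Int.negOnePow_add]
    exact Int.negOnePow_even _ (by
      rcases Int.even_or_odd n with ⟨k, rfl⟩ | ⟨k, rfl⟩
      · exact ⟨2 * k * k + k, by ring⟩
      · exact ⟨2 * k * k + 3 * k + 1, by ring⟩)
  have b1 : susp β (2 * n) (-1) n (n - 1) (S.f.f n (dualMap (i.f n).hom x)) (E.h n y)
      = β.β (-2 * n - 1) n (n + 1) (S.fn (dualMap (i.f n).hom x)) (E.hn y) := by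
    rw [StrData.fn_eq]
    exact ChainBundle.β_castX (by ring) (by ring) (by ring) _ _
  have b2 : susp β (2 * n) (-1 - 1) (n - 1) (n - 1) (E.h n y) (E.h n x)
      = β.β (-2 * n - 2) (n + 1) (n + 1) (E.hn y) (E.hn x) :=
    ChainBundle.β_castX (by ring) (by ring) (by ring) _ _
  rw [← smul_assoc, e1, one_smul, b1, b2, E.ξ_symm (-1) n n (by omega),
    show (-1 : ℤ) - 1 = -2 from rfl, Int.negOnePow_even (2 * n + 2 + -1 - 1) ⟨n, by ring⟩,
    Int.negOnePow_odd (-1) ⟨-1, by ring⟩, one_smul, Units.neg_smul, one_smul, ← sub_eq_add_neg,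
    Int.negOnePow_mul_self, LinearMap.zero_apply, InvDual.zero_apply, zero_sub,
    neg_add_eq_iff_eq_add] at h
  rw [h]
  abel

section

variable (hC : Subsingleton (C.X (n + 1))) (hD : Subsingleton (D.X (n + 1 + 1)))

include hC in
theorem pull_eq_zero (u : InvDual A (D.X (n + 1))) : dualMap (i.f (n + 1)).hom u = 0 := by
  have := subsingleton_dual (A := A) (M := C.X (n + 1))
  exact Subsingleton.elim _ _

include hD in
theorem d_dual_eq_zero (u : InvDual A (D.X (n + 1))) :
    dualMap (D.d (n + 1 + 1) (n + 1)).hom u = 0 := by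
  have := subsingleton_dual (A := A) (M := D.X (n + 1 + 1))
  exact Subsingleton.elim _ _

include hC hD in
theorem d_hs (u : InvDual A (D.X (n + 1))) : β.B.d n (n - 1) (E.hs u) = 0 := by
  have h := E.h_eq (n + 1) u
  have h0 : (dualCx D).d (n + 1) (n + 1 + 1) u = 0 := d_dual_eq_zero hD u
  have h1 : (S.push i).f.f (n + 1) u = 0 := by
    show S.f.f (n + 1) (dualMap (i.f (n + 1)).hom u) = 0
    rw [pull_eq_zero hC, map_zero]
  have h2 : (0 : StrData β n D).f.f (n + 1) u = 0 := rfl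
  rw [h0, map_zero, map_zero, add_zero, h1, h2, sub_zero, bundleCx_d, eq_comm] at h
  have h3 : β.B.d (2 * n - (n + 1 - 1)) (2 * n - (n + 1)) (E.h (n + 1) u) = 0 := by
    rcases Int.units_eq_one_or (n + 1 - 1 + 1).negOnePow with e | e <;> rw [e] at h
    · simpa using h
    · simpa using h
  rw [hs, LinearMap.comp_apply, d_castX (by ring) (by ring) (i' := 2 * n - (n + 1)), h3, map_zero]

-- The `s = 1` component of the `ξ`-equation: `ξ_0` is symmetric only up to `ξ_1`. This is why `ξ_1`
-- enters the pairing `hypLam` on the stabilizing form.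
include hC hD in
theorem xi_zero_swap (u : InvDual A (D.X (n + 1))) (x : InvDual A (D.X n)) :
    E.ξ 0 (n + 1) n u x
      = star (E.ξ 0 n (n + 1) x u) + E.ξ 1 (n + 1) (n + 1) u (dualMap (D.d (n + 1) n).hom x) := by
  have h := E.xi_apply 1 (n + 1) n u x
  rw [pull_eq_zero hC, d_dual_eq_zero hD, map_zero, map_zero,
    InvDual.zero_apply, InvDual.zero_apply, smul_zero, add_zero, neg_zero,
    Int.negOnePow_odd (2 * n + 1 + 1 - 1) ⟨n, by ring⟩, Int.negOnePow_one,
    Int.negOnePow_even ((n + 1) * n) (by rw [mul_comm]; exact Int.even_mul_succ_self n), one_smul,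
    Units.neg_smul, Units.neg_smul, one_smul, one_smul] at h
  change 0 = _ + -(E.ξ 0 (n + 1) n u x + -star (E.ξ 0 n (n + 1) x u)) at h
  rw [← sub_eq_zero, ← neg_eq_zero, h]
  abel

-- The `s = 1` component of the `η`-equation on `D^{n+1}`. It is the hypothesis of `presents_hyp`:
-- up to the sign `ε`, the pair `(hs, η_0)` presents `ξ_1`.
include hC hD in
theorem xi_one_eq (u v : InvDual A (D.X (n + 1))) :
    E.ξ 1 (n + 1) (n + 1) u v = n.negOnePow • β.β (-2 * n) n n (E.hs u) (E.hs v)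
      + (E.η 0 (n + 1) (n + 1) u v + n.negOnePow • star (E.η 0 (n + 1) (n + 1) v u)) := by
  have h := E.eta_apply 1 (n + 1) (n + 1) u v
  have b2 : susp β (2 * n) (1 - 1) (n + 1 - 1) (n + 1 - 1) (E.h (n + 1) v) (E.h (n + 1) u)
      = β.β (-2 * n) n n (E.hs v) (E.hs u) :=
    ChainBundle.β_castX (by ring) (by ring) (by ring) _ _
  have e1 : (2 * n - 1 + (n + 1)).negOnePow • ((n + 1 - 1) * (n + 1 - 1)).negOnePow = (1 : ℤˣ) := by
    rw [smul_eq_mul, ← Int.negOnePow_add]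
    exact Int.negOnePow_even _ (by
      rcases Int.even_or_odd n with ⟨k, rfl⟩ | ⟨k, rfl⟩
      · exact ⟨2 * k * k + 3 * k, by ring⟩
      · exact ⟨2 * k * k + 5 * k + 2, by ring⟩)
  rw [pull_eq_zero hC u, pull_eq_zero hC v, d_dual_eq_zero hD, d_dual_eq_zero hD, map_zero,
    map_zero, map_zero, map_zero, map_zero, InvDual.zero_apply, InvDual.zero_apply, smul_zero,
    ← smul_assoc, e1, one_smul, b2,
    Int.negOnePow_even (2 * n + 2 + 1 - 1) ⟨n + 1, by ring⟩, Int.negOnePow_one,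
    Int.negOnePow_mul_self, Int.negOnePow_succ, one_smul, Units.neg_smul, Units.neg_smul, one_smul,
    neg_neg, cyc0 _ _ (E.d_hs hC hD v) (E.d_hs hC hD u), star_star_units, star_star] at h
  simp only [InvDual.zero_apply, zero_add, add_zero] at h
  rw [sub_eq_iff_eq_add'] at h
  exact h

-- The `s = 0` component of the `η`-equation, used to compare the pairing `ξ_0(x)(d^* x)` with the
-- Wu class of `i^* x`.
include hC hD in
theorem xi_zero_eq (x : InvDual A (D.X n)) (u : InvDual A (D.X (n + 1))) :
    E.ξ 0 n (n + 1) x u = β.β (-2 * n) n n (S.fn (dualMap (i.f n).hom x)) (E.hs u)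
      + n.negOnePow • star (β.β (-2 * n - 1) n (n + 1) (E.hs u) (E.hn x))
      - n.negOnePow • E.η 0 (n + 1) (n + 1) (dualMap (D.d (n + 1) n).hom x) u
      - E.η (-1) n (n + 1) x u - star (E.η (-1) (n + 1) n u x) := by
  have h := E.eta_apply 0 n (n + 1) x u
  have b1 : susp β (2 * n) 0 n (n + 1 - 1) (S.f.f n (dualMap (i.f n).hom x)) (E.h (n + 1) u)
      = β.β (-2 * n) n n (S.fn (dualMap (i.f n).hom x)) (E.hs u) := by
    rw [StrData.fn_eq]
    exact ChainBundle.β_castX (by ring) (by ring) (by ring) _ _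
  have b2 : susp β (2 * n) (0 - 1) (n + 1 - 1) (n - 1) (E.h (n + 1) u) (E.h n x)
      = β.β (-2 * n - 1) n (n + 1) (E.hs u) (E.hn x) :=
    ChainBundle.β_castX (by ring) (by ring) (by ring) _ _
  have e1 : (2 * n - 1 + (n + 1)).negOnePow • ((n - 1) * (n + 1 - 1)).negOnePow = n.negOnePow := by
    rw [smul_eq_mul, ← Int.negOnePow_add]
    exact negOnePow_congr (by
      rcases Int.even_or_odd n with ⟨k, rfl⟩ | ⟨k, rfl⟩
      · exact ⟨2 * k * k + k, by ring⟩
      · exact ⟨2 * k * k + 3 * k + 1, by ring⟩)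
  rw [pull_eq_zero hC u, d_dual_eq_zero hD, map_zero,
    map_zero, ← smul_assoc, e1, b1, b2,
    Int.negOnePow_odd (2 * n + 2 + 0 - 1) ⟨n, by ring⟩, Int.negOnePow_zero,
    Int.negOnePow_even (n * (n + 1)) (Int.even_mul_succ_self n), Int.negOnePow_succ, one_smul,
    one_smul, Units.neg_smul, Units.neg_smul, one_smul, add_zero, zero_add] at h
  rw [sub_eq_iff_eq_add] at h
  rw [h]
  change -_ + -(E.η (-1) n (n + 1) x u + star (E.η (-1) (n + 1) n u x)) + _ = _
  abel

end

end StrEquiv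

/-- The normal Wu class of the restriction of a cocycle of `D`, corrected by the contribution of its
coboundary. -/
theorem StrEquiv.wu_add_eq_zero (E : StrEquiv (S.push i) 0) (hC : Subsingleton (C.X (n + 1)))
    (hD : Subsingleton (D.X (n + 1 + 1))) (x : InvDual A (D.X n))
    (hx : dualMap (C.d (n + 1) n).hom (dualMap (i.f n).hom x) = 0) :
    S.wu (dualMap (i.f n).hom x) hx
      + Q.mk (E.ξ 0 n (n + 1) x (dualMap (D.d (n + 1) n).hom x)
        + n.negOnePow • E.η 0 (n + 1) (n + 1) (dualMap (D.d (n + 1) n).hom x)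
          (dualMap (D.d (n + 1) n).hom x)) (E.hs (dualMap (D.d (n + 1) n).hom x))
          (E.d_hs hC hD _) = 0 := by
  set z := dualMap (i.f n).hom x with hz
  set v := dualMap (D.d (n + 1) n).hom x with hv
  rw [StrData.wu_eq, Q.mk_add_mk]
  have hb := E.neg_fn x
  -- By `neg_fn` the sum of the two second components bounds, up to sign, `ε hn x`. In the first
  -- component everything cancels except four terms that are visibly in `skew`.
  refine Q.mk_eq_mk_iff.2 ⟨n.negOnePow • E.hn x, ?_, ?_⟩
  · rw [map_units_smul (β.B.d (n + 1) n).hom]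
    show 0 - (S.fn z + E.hs v) = _
    rw [zero_sub, neg_add, ← hz] at *
    rw [hb]
    abel
  · show 0 - (_ - _) + _ ∈ _
    rw [E.theta_eq x x, E.xi_zero_eq hC hD x v, ← hz, ← hv]
    have m1 := (skew A n).neg_mem (sub_skew (n := n) (E.η (-2) n n x x))
    have m2 := skew_sub (n := n) (β.β (-2 * n - 2) (n + 1) (n + 1) (E.hn x) (E.hn x))
    have m3 := (skew A n).neg_mem (skew_sub (n := n) (E.η (-1) (n + 1) n v x))
    have m4 := sub_skew (n := n) (β.β (-2 * n - 1) n (n + 1) (E.hs v) (E.hn x))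
    convert (skew A n).add_mem ((skew A n).add_mem m1 m2) ((skew A n).add_mem m3 m4) using 1
    rcases Int.units_eq_one_or n.negOnePow with e | e <;> rw [e] <;> simp [corr, e] <;> abel

/-- For a cocycle of `D` the corrections involving `d^* x` vanish, and the null-homotopy alone kills
the Wu class. No condition on the dimension of `C` or `D` is needed here. -/
theorem StrEquiv.wu_eq_zero (E : StrEquiv (S.push i) 0) (x : InvDual A (D.X n))
    (hv : dualMap (D.d (n + 1) n).hom x = 0) :
    S.wu (dualMap (i.f n).hom x) (dualMap_cocycle i hv) = 0 := by
  set z := dualMap (i.f n).hom x with hz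
  have hb := E.neg_fn x
  rw [hv, map_zero, add_zero, ← hz] at hb
  rw [StrData.wu_eq]
  refine Q.mk_eq_mk_iff.2 ⟨n.negOnePow • E.hn x, ?_, ?_⟩
  · rw [map_units_smul (β.B.d (n + 1) n).hom]
    exact (zero_sub _).trans hb
  · show 0 - S.θ (-1) n n z z + corr _ (0 : β.B.X n) _ ∈ _
    rw [hz, E.theta_eq x x, hv, ← hz]
    have m1 := (skew A n).neg_mem (sub_skew (n := n) (E.η (-2) n n x x))
    have m2 := skew_sub (n := n) (β.β (-2 * n - 2) (n + 1) (n + 1) (E.hn x) (E.hn x))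
    convert (skew A n).add_mem m1 m2 using 1
    rcases Int.units_eq_one_or n.negOnePow with e | e <;> rw [e] <;> simp [corr, e] <;> abel

end Null

/-! ### Dimension zero: stable lagrangians over an arbitrary ring. -/

section DimensionZero

variable {A : Type u} [Ring A] [StarRing A] {n : ℤ} {β : ChainBundle A}

/-- The direct summand condition is automatic: `L^*` is projective, so the exact sequence splits on
the right and therefore on the left. -/
theorem QForm.isHyperbolic_of_exact (F : QForm (Q β n)) {L : Type u} [AddCommGroup L] [Module A L]
    [Module.Projective A (InvDual A L)] (j : L →ₗ[A] F.M) (hj : Function.Injective j)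
    (hex : ∀ x, (∀ l, F.lam x (j l) = 0) ↔ x ∈ LinearMap.range j)
    (hsurj : ∀ g : L →ₗ[A] A, ∃ x, ∀ l, F.lam x (j l) = g l) (hmu : ∀ l, F.mu (j l) = 0) :
    F.IsHyperbolic := by
  have hs : Function.Surjective (dualMap j ∘ₗ F.lam) := fun g => by
    obtain ⟨x, hx⟩ := hsurj g
    exact ⟨x, InvDual.ext hx⟩
  have he : Function.Exact j (dualMap j ∘ₗ F.lam) := fun x =>
    ⟨fun h => (hex x).1 fun l => DFunLike.congr_fun h l, fun h => InvDual.ext ((hex x).2 h)⟩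
  obtain ⟨s, hs'⟩ := Module.projective_lifting_property (dualMap j ∘ₗ F.lam) LinearMap.id hs
  have hiff : (Function.Injective j ∧ ∃ l, (dualMap j ∘ₗ F.lam) ∘ₗ l = LinearMap.id) ↔
      (Function.Surjective (dualMap j ∘ₗ F.lam) ∧ ∃ l, l ∘ₗ j = LinearMap.id) :=
    he.split_tfae'.out 0 1
  exact F.isHyperbolic_of_injection j (hiff.1 ⟨hj, s, hs'⟩).2 hex hsurj hmu

/-- The quadratic form with a given presentation. -/
def Presents.toQForm {M : Type u} [AddCommGroup M] [Module A M] [Module.Finite A M]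
    [Module.Projective A M] {f : M →ₗ[A] β.B.X n} {θ lam : M →ₗ[A] InvDual A M}
    {mu : M → (Q β n).carrier} (P : Presents f θ lam mu) (h : Function.Bijective lam) :
    QForm (Q β n) where
  M := M
  lam := lam
  lam_symm := P.lam_symm
  nonsing := h
  mu := mu
  mu_smul := P.mu_smul
  r_mu := P.r_mu
  mu_add := P.mu_add

section Hyp

variable {D : Type u} [AddCommGroup D] [Module A D]

/-- The pairing `star (u'(e)) + ε u(e') + ε ξ(u)(u')` on `D^* ⊕ D`. -/
def hypLam (n : ℤ) (ξ : InvDual A D →ₗ[A] InvDual A (InvDual A D)) :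
    (InvDual A D × D) →ₗ[A] InvDual A (InvDual A D × D) :=
  pullPair (evalDual D) (LinearMap.snd A _ _) (LinearMap.fst A _ _)
    + n.negOnePow • pullPair (LinearMap.id : InvDual A D →ₗ[A] InvDual A D)
        (LinearMap.fst A _ _) (LinearMap.snd A _ _)
    + n.negOnePow • pullPair ξ (LinearMap.fst A _ _) (LinearMap.fst A _ _)

theorem hypLam_apply (ξ : InvDual A D →ₗ[A] InvDual A (InvDual A D)) (x y : InvDual A D × D) :
    hypLam n ξ x y = star (y.1 x.2) + n.negOnePow • x.1 y.2 + n.negOnePow • ξ x.1 y.1 := by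
  rw [hypLam]
  rcases Int.units_eq_one_or n.negOnePow with e | e <;> rw [e] <;> simp

/-- The matrix is triangular with respect to `D^* ⊕ D`: pairing with `(0, x)` detects `u`, and
pairing with `(y, 0)` then detects `e`. -/
theorem hypLam_bijective [Module.Finite A D] [Module.Projective A D]
    (ξ : InvDual A D →ₗ[A] InvDual A (InvDual A D)) : Function.Bijective (hypLam n ξ) := by
  have hu : ∀ (e : ℤˣ) (u : InvDual A D) (x : D), (e • u) x = e • u x := fun e u x => by
    rcases Int.units_eq_one_or e with rfl | rfl <;> simp
  constructor
  · refine (injective_iff_map_eq_zero _).2 ?_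
    rintro ⟨u, e⟩ h
    have h' : ∀ y, hypLam n ξ (u, e) y = 0 := fun y => by rw [h]; rfl
    have h1 : u = 0 := InvDual.ext fun x => by
      have := h' (0, x)
      rw [hypLam_apply] at this
      exact (smul_eq_zero_iff_eq n.negOnePow).1 (by simpa using this)
    subst h1
    have h2 : e = 0 := eq_zero_of_dual (A := A) e fun y => by
      have := h' (y, 0)
      rw [hypLam_apply] at this
      simpa using this
    rw [h2]
    rfl
  · intro g
    let u : InvDual A D := n.negOnePow • dualMap (LinearMap.inr A _ _) g
    obtain ⟨e, he⟩ := evalDual_surjective (A := A) (M := D)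
      (dualMap (LinearMap.inl A _ _) g - n.negOnePow • ξ u)
    refine ⟨(u, e), InvDual.ext ?_⟩
    rintro ⟨u', e'⟩
    rw [hypLam_apply]
    have h1 : star (u' e) = g (u', 0) - n.negOnePow • ξ u u' := by
      rw [← evalDual_apply, he]
      rcases Int.units_eq_one_or n.negOnePow with e | e <;> rw [e] <;> simp
    have h2 : n.negOnePow • u e' = g (0, e') := by
      show n.negOnePow • (n.negOnePow • dualMap (LinearMap.inr A _ _) g : InvDual A D) e' = _
      rw [hu, smul_smul, Int.units_mul_self, one_smul]
      rfl
    show star (u' e) + n.negOnePow • u e' + n.negOnePow • ξ u u' = g (u', e')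
    rw [h1, h2]
    have h3 : g (u', e') = g (u', 0) + g (0, e') := by rw [← map_add]; simp
    rw [h3]
    abel

/-- The pairing `star (u'(e)) + ε η(u)(u')` on `D^* ⊕ D`. -/
def hypTheta (n : ℤ) (η : InvDual A D →ₗ[A] InvDual A (InvDual A D)) :
    (InvDual A D × D) →ₗ[A] InvDual A (InvDual A D × D) :=
  pullPair (evalDual D) (LinearMap.snd A _ _) (LinearMap.fst A _ _)
    + n.negOnePow • pullPair η (LinearMap.fst A _ _) (LinearMap.fst A _ _)

theorem hypTheta_apply (η : InvDual A D →ₗ[A] InvDual A (InvDual A D)) (x y : InvDual A D × D) :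
    hypTheta n η x y = star (y.1 x.2) + n.negOnePow • η x.1 y.1 := by
  rw [hypTheta]
  rcases Int.units_eq_one_or n.negOnePow with e | e <;> rw [e] <;> simp

theorem presents_hyp (h : InvDual A D →ₗ[A] β.B.X n)
    (ξ η : InvDual A D →ₗ[A] InvDual A (InvDual A D)) (hd : ∀ u, β.B.d n (n - 1) (h u) = 0)
    (hξ : ∀ u v, ξ u v = n.negOnePow • β.β (-2 * n) n n (h u) (h v)
      + (η u v + n.negOnePow • star (η v u))) :
    Presents (h ∘ₗ LinearMap.fst A _ D) (hypTheta n η) (hypLam n ξ)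
      (fun x => Q.mk (hypTheta n η x x) (h x.1) (hd x.1)) where
  d_f x := hd x.1
  lam_eq x y := by
    rw [hypLam_apply, hypTheta_apply, hypTheta_apply, hξ]
    show _ - β.β (-2 * n) n n (h x.1) (h y.1) = _
    rcases Int.units_eq_one_or n.negOnePow with e | e <;> rw [e] <;> simp <;> abel
  mu_eq x := rfl

/-- The summand `D` is a lagrangian, because `ξ`, `η` and `h` involve only the `D^*`-coordinate. -/
theorem hyp_isHyperbolic [Module.Finite A D] [Module.Projective A D]
    (h : InvDual A D →ₗ[A] β.B.X n)
    (ξ η : InvDual A D →ₗ[A] InvDual A (InvDual A D)) (hd : ∀ u, β.B.d n (n - 1) (h u) = 0)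
    (hξ : ∀ u v, ξ u v = n.negOnePow • β.β (-2 * n) n n (h u) (h v)
      + (η u v + n.negOnePow • star (η v u))) :
    ((presents_hyp h ξ η hd hξ).toQForm (hypLam_bijective ξ)).IsHyperbolic := by
  have hu : ∀ (e : ℤˣ) (u : InvDual A D) (x : D), (e • u) x = e • u x := fun e u x => by
    rcases Int.units_eq_one_or e with rfl | rfl <;> simp
  have hl : ∀ (x : InvDual A D × D) (e : D), hypLam n ξ x (0, e) = n.negOnePow • x.1 e :=
    fun x e => by
      rw [hypLam_apply]
      simp
  refine QForm.isHyperbolic_of_injection _ (LinearMap.inr A (InvDual A D) D)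
    ⟨LinearMap.snd A _ _, rfl⟩ (fun x => ⟨fun h => ?_, ?_⟩) (fun g => ?_) (fun e => ?_)
  · obtain ⟨u, e⟩ : InvDual A D × D := x
    have h0 : u = 0 := InvDual.ext fun e' => by
      have h1 := (hl (u, e) e').symm.trans (h e')
      rcases Int.units_eq_one_or n.negOnePow with e | e <;> rw [e] at h1
      · simpa using h1
      · simpa using h1
    exact ⟨e, by rw [h0]; rfl⟩
  · rintro ⟨e, rfl⟩ e'
    exact (hl (0, e) e').trans (smul_zero _)
  · refine ⟨((n.negOnePow • (show InvDual A D from g), 0) : InvDual A D × D), fun e => ?_⟩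
    refine (hl _ e).trans ?_
    rw [hu, smul_smul, Int.units_mul_self, one_smul]
    rfl
  · refine Q.mk_congr (a' := 0) (b' := 0) (h' := map_zero (β.B.d n (n - 1)).hom) ?_ (map_zero h)
    show hypTheta n η (0, e) (0, e) = 0
    rw [hypTheta_apply]
    simp

end Hyp

/-- The form of a Poincaré complex concentrated in degree `n`. -/
theorem PoincareCx.exists_form (E : PoincareCx β n) (hC : ∀ r, r ≠ n → Subsingleton (E.C.X r)) :
    ∃ F : QForm (Q β n), IsFormCx F E := by
  let K := LinearMap.ker (dualMap (E.C.d (n + 1) n).hom)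
  have hK : K = ⊤ := eq_top_iff.2 fun z _ => cocycle_conc hC z
  have := E.dim.fin n
  have := E.dim.proj n
  let e : K ≃ₗ[A] InvDual A (E.C.X n) := (LinearEquiv.ofEq _ _ hK).trans Submodule.topEquiv
  have : Module.Finite A K := Module.Finite.equiv e.symm
  have : Module.Projective A K := Module.Projective.of_equiv e.symm
  have P := E.isStr.presents
  have hbij : Function.Bijective (pullPair (E.S.φ 0 n n) K.subtype K.subtype) := by
    constructor
    · refine (injective_iff_map_eq_zero _).2 fun z hz => Subtype.ext ?_
      refine coBd_conc hC (E.duality.inj n n (by ring) z.1 ((coCyc_iff rfl _).2 z.2) ?_)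
      have : hypSharp E.S.φ n n z.1 = 0 := E.dim.ext fun y => by
        rw [apply_hypSharp E.dim, map_zero]
        exact star_eq_zero.2 (DFunLike.congr_fun hz (e.symm y))
      rw [this]
      exact isBd_zero
    · intro g
      obtain ⟨c, hc⟩ := evalDual_surjective (A := A) (M := E.C.X n)
        (dualMap e.symm.toLinearMap g)
      obtain ⟨z, hz, hb⟩ := E.duality.surj n n (by ring) c ((isCyc_iff (by ring) _).2
        (show E.C.d n (n - 1) c = 0 by
          have := hC (n - 1) (by omega)
          exact Subsingleton.elim _ _))
      have hb := sub_eq_zero.1 (isBd_conc hC hb)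
      refine ⟨⟨z, cocycle_conc hC z⟩, InvDual.ext fun w => ?_⟩
      show E.S.φ 0 n n z w.1 = g w
      have h1 := apply_hypSharp E.dim E.S.φ n n z w.1
      rw [← hb] at h1
      have h2 : evalDual (E.C.X n) c w.1 = g w := by
        rw [hc]
        rfl
      rw [← h2, evalDual_apply, h1, star_star]
  refine ⟨P.toQForm hbij, hC, LinearEquiv.refl A K, fun x y => rfl, fun x => rfl⟩

/-- The form of a boundary is stably hyperbolic, in low dimensions. -/
theorem IsFormCx.mk_eq_zero_of_isBoundary {F : QForm (Q β n)} {E : PoincareCx β n}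
    (h : IsFormCx F E) {D : ChainComplex (ModuleCat.{u} A) ℤ}
    (hD : ∀ r, r ≠ n → r ≠ n + 1 → Subsingleton (D.X r)) (hdim : IsDim (2 * n + 1) D)
    (i : E.C ⟶ D) (K : StrEquiv (E.S.push i) 0) (hK : IsPairDuality n E.S.φ i K.ξ) :
    WSet.mk F = 0 := by
  obtain ⟨hC, e, hl, hm⟩ := h
  have hC1 : Subsingleton (E.C.X (n + 1)) := hC _ (by omega)
  have hC2 : Subsingleton (E.C.X (n - 1)) := hC _ (by omega)
  have hD2 : Subsingleton (D.X (n + 1 + 1)) := hD _ (by omega) (by omega)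
  have hD3 : Subsingleton (D.X (n - 1)) := hD _ (by omega) (by omega)
  have := hdim.fin n
  have := hdim.proj n
  have := hdim.fin (n + 1)
  have := hdim.proj (n + 1)
  have hd := K.d_hs hC1 hD2
  have hξ := K.xi_one_eq hC1 hD2
  let H := (presents_hyp K.hs (K.ξ 1 (n + 1) (n + 1)) (K.η 0 (n + 1) (n + 1)) hd hξ).toQForm
    (hypLam_bijective _)
  have hH : H.IsHyperbolic := hyp_isHyperbolic _ _ _ hd hξ
  -- It is enough to find a lagrangian after adding `H`, itself hyperbolic and so zero in the Witt
  -- group.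
  suffices hs : (F.sum H).IsHyperbolic by
    have := WSet.mk_of_isHyperbolic hs
    rwa [WSet.mk_sum, WSet.mk_of_isHyperbolic hH, add_zero] at this
  let δ : InvDual A (D.X n) →ₗ[A] InvDual A (D.X (n + 1)) := dualMap (D.d (n + 1) n).hom
  let X := hypSharp K.ξ n (n + 1)
  let X' := hypSharp K.ξ (n + 1) n
  let P := hypSharp E.S.φ n n
  let r : InvDual A (D.X n) →ₗ[A] LinearMap.ker (dualMap (E.C.d (n + 1) n).hom) :=
    (dualMap (i.f n).hom).codRestrict _ fun x => cocycle_conc hC _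
  -- The lagrangian is `D^n`, embedded by `x ↦ (i^* x, d^* x, ξ_0 x)`.
  let j : InvDual A (D.X n) →ₗ[A] F.M × (InvDual A (D.X (n + 1)) × D.X (n + 1)) :=
    LinearMap.prod (e.symm.toLinearMap ∘ₗ r) (LinearMap.prod δ X)
  -- The adjoint of `j` sends `(m, u, c)` to `i φ_0(m) + d c + ε ξ_0(u)` in `D_n`. Hence the
  -- orthogonal complement of the image is a kernel in the cone, accessible to pair duality.
  have hN : ∀ (m : F.M) (u : InvDual A (D.X (n + 1))) (c : D.X (n + 1)) (y : InvDual A (D.X n)),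
      (F.sum H).lam (m, (u, c)) (j y)
        = star (y (i.f n (P (e m).1) + D.d (n + 1) n c + n.negOnePow • X' u)) := by
    intro m u c y
    show F.lam m (e.symm (r y)) + hypLam n (K.ξ 1 (n + 1) (n + 1)) (u, c) (δ y, X y) = _
    rw [← hl, e.apply_symm_apply, hypLam_apply]
    have h1 : star (y (i.f n (P (e m).1))) = E.S.φ 0 n n (e m).1 (r y).1 := by
      have h0 : y (i.f n (P (e m).1)) = (r y).1 (P (e m).1) := rfl
      rw [h0, apply_hypSharp E.dim, star_star]
    have h2 : u (X y) = star (K.ξ 0 n (n + 1) y u) := apply_hypSharp hdim _ _ _ _ _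
    have h3 : y (X' u) = star (K.ξ 0 (n + 1) n u y) := apply_hypSharp hdim _ _ _ _ _
    have h4 := K.xi_zero_swap hC1 hD2 u y
    have h5 : y (n.negOnePow • X' u) = n.negOnePow • y (X' u) := by
      rcases Int.units_eq_one_or n.negOnePow with e | e <;> rw [e] <;> simp
    rw [map_add, map_add, star_add, star_add, h1, h5, h3, star_star_units, star_star, h4, smul_add]
    show _ + (star (δ y c) + n.negOnePow • u (X y)
      + n.negOnePow • K.ξ 1 (n + 1) (n + 1) u (δ y)) = _
    rw [h2, add_assoc, add_assoc]
    rfl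
  have hpair : ∀ x, D.d (n + 1) n (X x) + n.negOnePow • X' (δ x) + i.f n (P (r x).1) = 0 :=
    fun x => pair_d_sharp E.dim hdim K rfl rfl x
  have hPinj : ∀ z z' : InvDual A (E.C.X n), P z = P z' → z = z' := fun z z' hz => by
    rw [← sub_eq_zero]
    refine coBd_conc hC (E.duality.inj n n (by ring) _ ((coCyc_iff rfl _).2 (cocycle_conc hC _)) ?_)
    have : hypSharp E.S.φ n n (z - z') = 0 := by rw [map_sub]; exact sub_eq_zero.2 hz
    rw [this]
    exact isBd_zero
  have hPsurj : ∀ c, ∃ m, P (e m).1 = c := fun c => by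
    obtain ⟨z, hz, hb⟩ := E.duality.surj n n (by ring) c ((isCyc_iff (by ring) _).2
        (Subsingleton.elim (E.C.d n (n - 1) c) 0))
    refine ⟨e.symm ⟨z, cocycle_conc hC z⟩, ?_⟩
    rw [e.apply_symm_apply]
    exact (sub_eq_zero.1 (isBd_conc hC hb)).symm
  have hcoBd : ∀ x : InvDual A (D.X n), CoBd D x → x = 0 := fun x hx => by
    obtain ⟨w, hw⟩ := (exists_coboundary_iff x).2 hx
    have := subsingleton_dual (A := A) (M := D.X (n - 1))
    rw [← hw, Subsingleton.elim w 0, map_zero]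
  refine QForm.isHyperbolic_of_exact (F.sum H) j ?_ ?_ ?_ ?_
  · refine (injective_iff_map_eq_zero j).2 fun x hx => ?_
    have h1 : r x = 0 := (LinearEquiv.map_eq_zero_iff e.symm).1 (congrArg Prod.fst hx)
    have h2 : δ x = 0 := congrArg (fun w => w.2.1) hx
    have h3 : X x = 0 := congrArg (fun w => w.2.2) hx
    refine hcoBd x (hK.inj n (n + 1) n (by ring) rfl x ((coCyc_iff rfl _).2 h2) 0 0 ?_ ?_)
    · rw [map_zero, map_zero, add_zero]
      exact h3
    · rw [map_zero, neg_zero]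
      have : dualMap (i.f n).hom x = 0 := congrArg Subtype.val h1
      rw [this, map_zero]
  · rintro ⟨m, u, c⟩
    constructor
    · intro h0
      have hN0 : i.f n (P (e m).1) + D.d (n + 1) n c + n.negOnePow • X' u = 0 :=
          hdim.ext fun y => by
        have := (hN m u c y).symm.trans (h0 y)
        rw [star_eq_zero] at this
        rw [this, map_zero]
      -- Injectivity of duality on `D^{n+1}` gives `u = d^* x0`. After subtracting `j x0` the
      -- remainder is a cone cycle, and surjectivity on `D^n` supplies a cocycle `x1` with `j x1`
      -- equal to it.
      have hu : CoBd D u := by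
        refine hK.inj (n + 1) n (n - 1) (by ring) (by ring) u
          ((coCyc_iff rfl _).2 (StrEquiv.d_dual_eq_zero hD2 u)) (-(n.negOnePow • c))
          (-(n.negOnePow • P (e m).1)) ?_ (Subsingleton.elim _ _)
        rw [map_neg, map_neg, map_units_smul (D.d (n + 1) n).hom, map_units_smul (i.f n).hom]
        have h1 : X' u = n.negOnePow • (n.negOnePow • X' u) := by
          rw [smul_smul, Int.units_mul_self, one_smul]
        have h2 : n.negOnePow • X' u = -(D.d (n + 1) n c) - i.f n (P (e m).1) := by
          rw [← sub_eq_zero, ← hN0]; abel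
        refine h1.trans ?_
        rw [h2, smul_sub, smul_neg, sub_eq_add_neg]
      obtain ⟨x0, hx0⟩ := (coBd_iff rfl u).1 hu
      have hx0 : δ x0 = u := hx0
      obtain ⟨x1, hx1, y', c', h1, h2⟩ := hK.surj n (n + 1) n (by ring) rfl (c - X x0)
        (P ((e m).1 - (r x0).1)) (by
          have h1 := hpair x0
          rw [hx0] at h1
          rw [map_sub, map_sub, map_sub, ← sub_eq_zero.2 (hN0.trans h1.symm)]
          abel) ((isCyc_iff (by ring) _).2 (Subsingleton.elim (E.C.d n (n - 1) _) 0))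
      rw [Subsingleton.elim y' 0, Subsingleton.elim c' 0, map_zero, map_zero, add_zero,
        add_zero] at h1
      rw [Subsingleton.elim c' 0, map_zero, sub_zero] at h2
      have h3 : (e m).1 - (r x0).1 = (r x1).1 := hPinj _ _ h2
      have hx1 : δ x1 = 0 := (coCyc_iff rfl _).1 hx1
      refine ⟨x0 + x1, (map_add j x0 x1).trans ?_⟩
      refine Prod.ext ?_ (Prod.ext ?_ ?_)
      · show e.symm (r x0) + e.symm (r x1) = m
        rw [← map_add, LinearEquiv.symm_apply_eq]
        refine Subtype.ext ?_
        show (r x0).1 + (r x1).1 = _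
        rw [← h3]
        abel
      · show δ x0 + δ x1 = u
        rw [hx0, hx1, add_zero]
      · show X x0 + X x1 = c
        have h1 : c - X x0 = X x1 := h1
        rw [← h1]
        abel
    · rintro ⟨x, hx⟩ y
      rw [← hx]
      refine (hN _ _ _ y).trans ?_
      have h1 := hpair x
      have h2 : (e (e.symm (r x))) = r x := e.apply_symm_apply _
      have h3 : i.f n (P (e (e.symm (r x))).1) + D.d (n + 1) n (X x) + n.negOnePow • X' (δ x)
          = 0 := by
        rw [h2, ← h1]
        abel
      refine (congrArg (fun w => star (y w)) h3).trans ?_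
      rw [map_zero, star_zero]
  · intro g
    obtain ⟨w, hw⟩ := evalDual_surjective (A := A) (M := D.X n) g
    -- Any `w` in `D_n` is a cone cycle, as `C` and `D` vanish in degree `n - 1`; surjectivity of
    -- duality gives its preimage under the adjoint of `j`.
    obtain ⟨u, hu, y', c', h1, h2⟩ := hK.surj (n + 1) n (n - 1) (by ring) (by ring) w 0
      (Subsingleton.elim _ _) (fun _ => map_zero _)
    obtain ⟨m, hm'⟩ := hPsurj c'
    refine ⟨(m, (n.negOnePow • u, y')), fun y => (hN m _ y' y).trans ?_⟩
    have h3 : i.f n (P (e m).1) + D.d (n + 1) n y' + n.negOnePow • X' (n.negOnePow • u) = w := by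
      rw [hm', map_units_smul X', smul_smul, Int.units_mul_self, one_smul, h1]
      show _ = X' u + _ + _
      abel
    rw [h3, ← evalDual_apply, hw]
    rfl
  · intro x
    show F.mu (e.symm (r x)) + Q.mk (hypTheta n (K.η 0 (n + 1) (n + 1)) (δ x, X x) (δ x, X x))
      (K.hs (δ x)) (hd _) = 0
    have hw : F.mu (e.symm (r x)) = E.S.wu (r x).1 (r x).2 := by
      rw [← hm]
      simp only [e.apply_symm_apply]
    rw [hw]
    refine Eq.trans (congrArg (_ + ·) (Q.mk_congr ?_ rfl))
      (K.wu_add_eq_zero hC1 hD2 x (cocycle_conc hC _))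
    rw [hypTheta_apply]
    have h2 : (δ x) (X x) = star (K.ξ 0 n (n + 1) x (δ x)) := apply_hypSharp hdim _ _ _ _ _
    show star ((δ x) (X x)) + _ = _
    rw [h2, star_star]

/-- In dimension zero, every Poincaré complex is associated to a form. -/
theorem wittToL_zero_bijective (β : ChainBundle A) (hn : (0 : ℤ) ≤ 0) :
    Function.Bijective (wittToL β hn) := by
  have hC : ∀ (E : PoincareCx β 0) r, r ≠ 0 → Subsingleton (E.C.X r) := fun E r hr =>
    E.dim.zero r (by omega)
  have H1 : ∀ E : PoincareCx β 0, ∃ F : QForm (Q β 0), IsFormCx F E := fun E =>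
    E.exists_form (hC E)
  constructor
  · obtain ⟨Ψ, hΨ, -⟩ := exists_splitting (β := β) hn
      (fun E => (H1 E).imp fun F h => h.isCohomologyForm) (fun E F hF hb => by
        obtain ⟨D, hD, i, K, hK⟩ := hb.exists E.dim
        exact (isFormCx_iff.2 ⟨hC E, hF⟩).mk_eq_zero_of_isBoundary
          (fun r h0 h1 => hD.zero r (by omega)) hD i K hK)
    -- Injectivity comes from the left inverse, so no relation has to be extracted from an equality
    -- of cobordism classes.
    exact Function.LeftInverse.injective hΨ
  · rintro ⟨E⟩
    obtain ⟨F, hF⟩ := H1 E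
    exact ⟨WSet.mk F, hF.wittToL_mk hn⟩

end DimensionZero

/-! ### Semisimple rings: the splitting by the cohomology form. -/

section Semisimple

variable {A : Type u} [Ring A] [StarRing A] {n : ℤ} {β : ChainBundle A}

theorem finite_submodule [IsNoetherianRing A] {M : Type u} [AddCommGroup M] [Module A M]
    [Module.Finite A M] (N : Submodule A M) : Module.Finite A N :=
  inferInstance

/-- Over a semisimple ring, a chain on which all cocycles vanish is a boundary. -/
theorem isBd_of_forall_coCyc [IsSemisimpleRing A] {m : ℤ} {C : ChainComplex (ModuleCat.{u} A) ℤ}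
    (hC : IsDim m C) {q : ℤ} (c : C.X q) (h : ∀ w : InvDual A (C.X q), CoCyc C w → w c = 0) :
    IsBd C c := by
  have := hC.fin q
  let B := LinearMap.range (C.d (q + 1) q).hom
  have : Module.Projective A (C.X q ⧸ B) := Module.projective_of_isSemisimpleRing A _
  have h0 : B.mkQ c = 0 := eq_zero_of_dual (A := A) _ fun y =>
    h (dualMap B.mkQ y) ((coCyc_iff rfl _).2 (InvDual.ext fun x => by
      show y (B.mkQ ((C.d (q + 1) q).hom x)) = 0
      rw [show B.mkQ ((C.d (q + 1) q).hom x) = 0 from (Submodule.Quotient.mk_eq_zero B).2 ⟨x, rfl⟩,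
        map_zero]))
  obtain ⟨x, hx⟩ := (Submodule.Quotient.mk_eq_zero B).1 h0
  exact (isBd_iff rfl _).2 ⟨x, hx⟩

/-- Over a semisimple ring, linear maps extend from submodules. -/
theorem exists_extend [IsSemisimpleRing A] {M N : Type u} [AddCommGroup M] [Module A M]
    [AddCommGroup N] [Module A N] (K : Submodule A M) (g : K →ₗ[A] N) :
    ∃ G : M →ₗ[A] N, ∀ x : K, G x = g x := by
  obtain ⟨G, hG⟩ := IsSemisimpleModule.extension_property K.subtype K.subtype_injective g
  exact ⟨G, fun x => LinearMap.congr_fun hG x⟩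

section Coboundary

variable {C : ChainComplex (ModuleCat.{u} A) ℤ} {S : StrData β n C} (hS : S.IsStr)

include hS

/-- The `s = 0` component of `dφ = 0` at `(b, w)`. Together with symmetry on cocycles it lets `φ_0`
descend to cohomology in both variables. -/
theorem StrData.IsStr.phi_coboundary {k : ℤ} (hk : k + 1 = n) (b : InvDual A (C.X k))
    (w : InvDual A (C.X n)) (hw : dualMap (C.d (n + 1) n).hom w = 0) :
    S.φ 0 n n (dualMap (C.d n k).hom b) w = 0 := by
  subst hk
  have h : hypD (2 * (k + 1)) S.φ 0 k (k + 1) b w = 0 := by rw [hS.φ_cycle]; rfl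
  have hw : (dualCx C).d (k + 1) (k + 1 + 1) w = 0 := hw
  rw [hypD_apply, hS.φ_symm (0 - 1) _ _ (by omega), hS.φ_symm (0 - 1) _ _ (by omega), hw,
    map_zero] at h
  simp only [LinearMap.zero_apply, InvDual.zero_apply, star_zero, smul_zero, add_zero,
    zero_add] at h
  exact (smul_eq_zero_iff_eq (k + 1).negOnePow).1 h

/-- The normal Wu class of a coboundary is zero. -/
theorem StrData.IsStr.wu_coboundary {k : ℤ} (hk : k + 1 = n) (b : InvDual A (C.X k))
    (hz : dualMap (C.d (n + 1) n).hom (dualMap (C.d n k).hom b) = 0) :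
    S.wu (dualMap (C.d n k).hom b) hz = 0 := by
  subst hk
  set z := dualMap (C.d (k + 1) k).hom b with hzdef
  have hzd : (dualCx C).d k (k + 1) b = z := rfl
  have hz0 : (dualCx C).d (k + 1) (k + 1 + 1) z = 0 := hz
  -- Up to sign, `g = f^* b` is the chain relating the Wu class of `d^* b` to zero.
  let g : β.B.X (k + 1 + 1) := castX β.B (2 * (k + 1) - k) (k + 1 + 1) (S.f.f k b)
  have hg : S.fn z = (k + 1).negOnePow • β.B.d (k + 1 + 1) (k + 1) g := by
    have h := cochain_comm S.f k (k + 1) b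
    rw [hzd, bundleCx_d] at h
    rw [StrData.fn_eq, ← h, map_units_smul, d_castX (by ring) (by ring)
      (i' := 2 * (k + 1) - (k + 1))]
  -- For negative `s` the chain `φ` disappears and `-f^%(S^{2n} β) = dθ`. Its components at `s = -1`
  -- and `s = -2` compute `θ_{-1}` on `d^* b`, modulo skew terms from `θ_{-2}` and `θ_{-3}`.
  have eqn : ∀ (s p q : ℤ) (x : InvDual A (C.X p)) (y : InvDual A (C.X q)), s < 0 →
      -susp β (2 * (k + 1)) s p q (S.f.f p x) (S.f.f q y)
        = hypD (2 * (k + 1) + 1) S.θ s p q x y := fun s p q x y hs => by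
    have h : (S.φ - hypPull S.f (susp β (2 * (k + 1)))) s p q x y
      = hypD (2 * (k + 1) + 1) S.θ s p q x y := by rw [hS.eq]
    rw [← h]
    have h1 : S.φ s p q x y = 0 := by rw [hS.φ_symm s p q hs]; rfl
    show _ = S.φ s p q x y - susp β (2 * (k + 1)) s p q (S.f.f p x) (S.f.f q y)
    rw [h1, zero_sub]
  have h1 := eqn (-1) k (k + 1) b z (by omega)
  have h2 := eqn (-2) k k b b (by omega)
  rw [hypD_apply, hz0, hzd, map_zero, zero_add] at h1
  rw [hypD_apply, hzd] at h2
  have b1 : susp β (2 * (k + 1)) (-1) k (k + 1) (S.f.f k b) (S.f.f (k + 1) z)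
      = β.β (-2 * (k + 1) - 1) (k + 1 + 1) (k + 1) g (S.fn z) := by
    rw [StrData.fn_eq]
    exact ChainBundle.β_castX (by ring) (by ring) (by ring) _ _
  have b2 : susp β (2 * (k + 1)) (-2) k k (S.f.f k b) (S.f.f k b)
      = β.β (-2 * (k + 1) - 2) (k + 1 + 1) (k + 1 + 1) g g :=
    ChainBundle.β_castX (by ring) (by ring) (by ring) _ _
  rw [b1, Int.negOnePow_odd (2 * (k + 1) + 1 + -1 - 1) ⟨k, by ring⟩,
    Int.negOnePow_odd (-1) ⟨-1, by ring⟩,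
    Int.negOnePow_even (k * (k + 1)) (Int.even_mul_succ_self k), hg,
    show (-1 : ℤ) - 1 = -2 from rfl] at h1
  rw [b2, Int.negOnePow_even (2 * (k + 1) + 1 + -2 - 1) ⟨k, by ring⟩,
    Int.negOnePow_even (-2) ⟨-1, by ring⟩, Int.negOnePow_mul_self,
    show (-2 : ℤ) - 1 = -3 from rfl] at h2
  rw [StrData.wu_eq]
  refine (Q.mk_eq_mk_iff (h := map_zero (β.B.d (k + 1) (k + 1 - 1)).hom)
    (a := 0) (b := 0)).2 ⟨(k + 1).negOnePow • g, ?_, ?_⟩ |>.symm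
  · rw [map_units_smul (β.B.d (k + 1 + 1) (k + 1)).hom, sub_zero]
    exact hg
  · rw [hg]
    convert (skew A (k + 1)).sub_mem (sub_skew (n := k + 1) (S.θ (-2) (k + 1) k z b))
      (skew_sub (n := k + 1) (S.θ (-3) k k b b)) using 1
    rw [← hzdef]
    rw [Int.negOnePow_succ] at h1 ⊢
    rw [← sub_eq_zero] at h1 h2 ⊢
    have h3 := congrArg₂ (fun s t => -((k + 1).negOnePow • (s + t))) h1 h2
    simp only [add_zero, smul_zero, neg_zero] at h3
    refine Eq.trans ?_ h3
    rcases Int.units_eq_one_or k.negOnePow with e | e <;>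
      simp [corr, e, Int.negOnePow_succ] <;> abel

end Coboundary

variable [IsSemisimpleRing A]

/-- Over a semisimple ring, every Poincaré complex has a cohomology form. -/
theorem PoincareCx.exists_cohomologyForm (E : PoincareCx β n) :
    ∃ F : QForm (Q β n), IsCohomologyForm E F := by
  let Z := LinearMap.ker (dualMap (E.C.d (n + 1) n).hom)
  -- `Z ⧸ W` is `H^n(C)`. Pairing and Wu class vanish on `W`, so both descend to the quotient.
  let W : Submodule A Z := (LinearMap.range (dualMap (E.C.d n (n - 1)).hom)).comap Z.subtype
  have := E.dim.fin n
  have := E.dim.proj n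
  have := E.dim.fin (n - 1)
  have := E.dim.proj (n - 1)
  have P := E.isStr.presents
  have hcyc : ∀ z : Z, CoCyc E.C z.1 := fun z => (coCyc_iff rfl _).2 z.2
  have hW0 : ∀ z ∈ W, ∀ w : Z, E.S.φ 0 n n z.1 w.1 = 0 := by
    rintro z ⟨b, hb⟩ w
    have hb : dualMap (E.C.d n (n - 1)).hom b = z.1 := hb
    rw [← hb]
    exact E.isStr.phi_coboundary (by ring) b w.1 w.2
  have hW1 : ∀ z ∈ W, ∀ w : Z, E.S.φ 0 n n w.1 z.1 = 0 := fun z hz w => by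
    have h1 := P.lam_symm w z
    have h2 : pullPair (E.S.φ 0 n n) Z.subtype Z.subtype z w = 0 := hW0 z hz w
    rw [h2, star_zero, smul_zero] at h1
    exact h1.symm
  have hWmu : ∀ z ∈ W, E.S.wu z.1 z.2 = 0 := by
    rintro ⟨z, hz⟩ ⟨b, hb⟩
    have hb : dualMap (E.C.d n (n - 1)).hom b = z := hb
    subst hb
    exact E.isStr.wu_coboundary (by ring) b _
  let lam₁ : Z →ₗ[A] InvDual A (Z ⧸ W) :=
    { toFun := fun z => W.liftQ (pullPair (E.S.φ 0 n n) Z.subtype Z.subtype z : Z →ₗ[A] A)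
        fun w hw => hW1 w hw z
      map_add' := fun z z' => InvDual.ext fun y => by
        obtain ⟨w, rfl⟩ := W.mkQ_surjective y
        show pullPair (E.S.φ 0 n n) Z.subtype Z.subtype (z + z') w = _
        rw [map_add]
        rfl
      map_smul' := fun a z => InvDual.ext fun y => by
        obtain ⟨w, rfl⟩ := W.mkQ_surjective y
        show pullPair (E.S.φ 0 n n) Z.subtype Z.subtype (a • z) w = _
        rw [map_smul]
        rfl }
  let lam : (Z ⧸ W) →ₗ[A] InvDual A (Z ⧸ W) := W.liftQ lam₁ fun z hz => InvDual.ext fun y => by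
    obtain ⟨w, rfl⟩ := W.mkQ_surjective y
    exact hW0 z hz w
  have hlam : ∀ z w : Z, lam (W.mkQ z) (W.mkQ w) = E.S.φ 0 n n z.1 w.1 := fun _ _ => rfl
  let mu : (Z ⧸ W) → (Q β n).carrier := Quotient.lift (fun z : Z => E.S.wu z.1 z.2) (by
    intro z w hzw
    have hzw : z - w ∈ W := (Submodule.quotientRel_def W).1 hzw
    have h := P.mu_add (z - w) w
    have h1 : pullPair (E.S.φ 0 n n) Z.subtype Z.subtype (z - w) w = 0 := hW0 _ hzw w
    rw [h1, map_zero] at h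
    simp only [sub_add_cancel] at h
    rw [hWmu _ hzw, sub_zero, sub_eq_zero] at h
    exact h)
  have hmu : ∀ z : Z, mu (W.mkQ z) = E.S.wu z.1 z.2 := fun _ => rfl
  have hbij : Function.Bijective lam := by
    constructor
    · refine (injective_iff_map_eq_zero lam).2 fun x hx => ?_
      obtain ⟨z, rfl⟩ := W.mkQ_surjective x
      have h1 : CoBd E.C z.1 := E.duality.inj n n (by ring) z.1 (hcyc z)
        (isBd_of_forall_coCyc E.dim _ fun w hw => by
          rw [apply_hypSharp E.dim, star_eq_zero]
          have := hlam z ⟨w, (coCyc_iff rfl _).1 hw⟩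
          rw [hx] at this
          exact this.symm)
      exact (Submodule.Quotient.mk_eq_zero W).2 ((exists_coboundary_iff z.1).2 h1)
    · intro g
      -- A functional on `H^n(C)` is extended to `C^n`, hence is evaluation at some `c` in `C_n`. It
      -- kills coboundaries, so `c` is a cycle, and Poincaré duality represents it by a cocycle.
      obtain ⟨G, hG⟩ := exists_extend Z ((show (Z ⧸ W) →ₗ[A] A from g) ∘ₗ W.mkQ)
      obtain ⟨c, hc⟩ := evalDual_surjective (A := A) (M := E.C.X n) G
      have hc' : ∀ w : InvDual A (E.C.X n), star (w c) = G w := fun w => DFunLike.congr_fun hc w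
      have hcyc' : IsCyc E.C c := (isCyc_iff (j := n - 1) (by ring) c).2
        (eq_zero_of_dual (A := A) _ fun b => by
          have h1 : star ((dualMap (E.C.d n (n - 1)).hom b) c) = 0 := by
            rw [hc']
            let w : Z := ⟨dualMap (E.C.d n (n - 1)).hom b,
              InvDual.ext fun x => by
                show b ((E.C.d n (n - 1)).hom ((E.C.d (n + 1) n).hom x)) = 0
                rw [← ModuleCat.comp_apply, E.C.d_comp_d]
                exact map_zero b⟩
            have h2 : W.mkQ w = 0 := (Submodule.Quotient.mk_eq_zero W).2 ⟨b, rfl⟩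
            refine (hG w).trans ?_
            rw [LinearMap.comp_apply, h2, map_zero]
          exact star_eq_zero.1 h1)
      obtain ⟨z, hz, hb⟩ := E.duality.surj n n (by ring) c hcyc'
      obtain ⟨y, hy⟩ := (isBd_iff rfl _).1 hb
      refine ⟨W.mkQ ⟨z, (coCyc_iff rfl _).1 hz⟩, InvDual.ext fun x => ?_⟩
      obtain ⟨w, rfl⟩ := W.mkQ_surjective x
      rw [hlam]
      have h1 : G w.1 = g (W.mkQ w) := hG w
      rw [← h1, ← hc']
      have h2 : w.1 c = w.1 (hypSharp E.S.φ n n z) := by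
        rw [← sub_eq_zero, ← map_sub, ← hy]
        exact DFunLike.congr_fun w.2 y
      rw [h2, apply_hypSharp E.dim, star_star]
  have : Module.Finite A Z := finite_submodule Z
  have : Module.Projective A (Z ⧸ W) := Module.projective_of_isSemisimpleRing A _
  let F : QForm (Q β n) :=
    { M := Z ⧸ W
      lam := lam
      lam_symm := fun x y => by
        obtain ⟨z, rfl⟩ := W.mkQ_surjective x
        obtain ⟨w, rfl⟩ := W.mkQ_surjective y
        exact P.lam_symm z w
      nonsing := hbij
      mu := mu
      mu_smul := fun a x => by
        obtain ⟨z, rfl⟩ := W.mkQ_surjective x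
        exact P.mu_smul a z
      r_mu := fun x => by
        obtain ⟨z, rfl⟩ := W.mkQ_surjective x
        exact P.r_mu z
      mu_add := fun x y => by
        obtain ⟨z, rfl⟩ := W.mkQ_surjective x
        obtain ⟨w, rfl⟩ := W.mkQ_surjective y
        exact P.mu_add z w }
  exact ⟨F, W.mkQ, W.mkQ_surjective, fun z => Submodule.Quotient.mk_eq_zero W, hlam, hmu⟩

/-- Over a semisimple ring, the cohomology form of a boundary is hyperbolic. -/
theorem IsCohomologyForm.isHyperbolic {E : PoincareCx β n} {F : QForm (Q β n)}
    (h : IsCohomologyForm E F) (hb : E.S.IsBoundary) : F.IsHyperbolic := by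
  obtain ⟨D, hD, i, K, hK⟩ := hb.exists E.dim
  obtain ⟨π, hs, hk, hl, hm⟩ := h
  -- The lagrangian is the image of `H^n(D)` in `H^n(C)`.
  let T := π ∘ₗ cocycleMap n i
  have hcycD : ∀ z : LinearMap.ker (dualMap (D.d (n + 1) n).hom), CoCyc D z.1 := fun z =>
    (coCyc_iff rfl _).2 z.2
  have hcyc : ∀ z : LinearMap.ker (dualMap (E.C.d (n + 1) n).hom), CoCyc E.C z.1 := fun z =>
    (coCyc_iff rfl _).2 z.2
  have hiso : ∀ z w, F.lam (T z) (T w) = 0 := fun z w => by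
    show F.lam (π _) (π _) = 0
    rw [hl]
    have h1 := K.neg_phi_eq z.1 w.1
    have hz : dualMap (D.d (n + 1) n).hom z.1 = 0 := z.2
    have hw : dualMap (D.d (n + 1) n).hom w.1 = 0 := w.2
    rw [hz, hw, map_zero, map_zero, InvDual.zero_apply, smul_zero, add_zero, neg_eq_zero] at h1
    exact h1
  obtain ⟨L', hL'⟩ := exists_isCompl (LinearMap.range T)
  refine ⟨LinearMap.range T, ⟨L', hL'⟩, fun x => ⟨fun hx => ?_, ?_⟩, fun g => ?_, ?_⟩
  · have hx' : ∀ z, F.lam x (T z) = 0 := fun z => DFunLike.congr_fun hx ⟨T z, z, rfl⟩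
    obtain ⟨c, rfl⟩ := hs x
    -- If `π c` is orthogonal to the image, then `i φ_0(c)` is annihilated by all cocycles of `D`
    -- and bounds some `y`. So `(-y, φ_0(c))` is a cone cycle, and duality of the pair yields a
    -- cocycle of `D` restricting to the class of `c`.
    obtain ⟨y, hy⟩ := (isBd_iff (i := n) rfl _).1 (isBd_of_forall_coCyc hD
      (i.f n (hypSharp E.S.φ n n c.1)) fun w hw => by
        have h1 := hx' ⟨w, (coCyc_iff rfl _).1 hw⟩
        have h2 : F.lam (π c) (T ⟨w, (coCyc_iff rfl _).1 hw⟩)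
          = E.S.φ 0 n n c.1 (dualMap (i.f n).hom w) := hl _ _
        rw [h2, ← star_eq_zero, ← apply_hypSharp E.dim] at h1
        exact h1)
    have hPc : IsCyc E.C (hypSharp E.S.φ n n c.1) := (isCyc_iff (j := n - 1) (by ring) _).2 (by
      have h1 := E.isStr.d_sharp E.dim (p := n) (p' := n + 1) (q := n - 1) (q' := n) rfl (by ring)
        c.1
      have h2 : dualMap (E.C.d (n + 1) n).hom c.1 = 0 := c.2
      rwa [h2, map_zero, smul_zero, add_zero] at h1)
    obtain ⟨z, hz, y', c', -, h2⟩ := hK.surj n (n + 1) n (by ring) rfl (-y)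
      (hypSharp E.S.φ n n c.1) (by rw [map_neg, hy, neg_add_cancel]) hPc
    refine ⟨⟨T ⟨z, (coCyc_iff rfl _).1 hz⟩, _, rfl⟩, ?_⟩
    show π (cocycleMap n i ⟨z, (coCyc_iff rfl _).1 hz⟩) = π c
    rw [eq_comm, ← sub_eq_zero, ← map_sub, hk, exists_coboundary_iff]
    refine E.duality.inj n n (by ring) _ (hcyc _) ((isBd_iff rfl _).2 ⟨-c', ?_⟩)
    show _ = hypSharp E.S.φ n n (c.1 - dualMap (i.f n).hom z)
    rw [map_sub, h2, map_neg]
    abel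
  · rintro ⟨⟨_, z, rfl⟩, rfl⟩
    refine InvDual.ext ?_
    rintro ⟨_, w, rfl⟩
    exact hiso z w
  · obtain ⟨G, hG⟩ := exists_extend (LinearMap.range T) (show LinearMap.range T →ₗ[A] A from g)
    obtain ⟨x, hx⟩ := F.nonsing.2 G
    exact ⟨x, InvDual.ext fun l => (DFunLike.congr_fun hx l.1).trans (hG l)⟩
  · rintro _ ⟨z, rfl⟩
    refine (hm _).trans ?_
    exact K.wu_eq_zero z.1 z.2

theorem exists_splitting_of_isSemisimpleRing (hn : 0 ≤ n) :
    ∃ Ψ : LSet β n →+ WSet (Q β n), (∀ w, Ψ (wittToL β hn w) = w) ∧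
      ∀ (E : PoincareCx β n) (F : QForm (Q β n)), IsCohomologyForm E F →
        Ψ (LSet.mk E) = WSet.mk F :=
  exists_splitting hn (fun E => E.exists_cohomologyForm) fun _ _ h hb =>
    WSet.mk_of_isHyperbolic (h.isHyperbolic hb)

end Semisimple
end ChainBundleL

theorem mainTheorem7 {A : Type u} [Ring A] [StarRing A] (β : ChainBundleL.ChainBundle A) :
    ∃ (_ : ∀ n : ℕ, AddCommGroup (ChainBundleL.WSet (ChainBundleL.Q β n)))
      (_ : ∀ n : ℕ, AddCommGroup (ChainBundleL.LSet β n)),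
      (∀ (n : ℕ) (F G : ChainBundleL.QForm (ChainBundleL.Q β n)),
        ChainBundleL.WSet.mk (F.sum G) = ChainBundleL.WSet.mk F + ChainBundleL.WSet.mk G) ∧
      (∀ (n : ℕ) (E E' : ChainBundleL.PoincareCx β n),
        ChainBundleL.LSet.mk (E.sum E') = ChainBundleL.LSet.mk E + ChainBundleL.LSet.mk E') ∧
      ∃ Φ : ∀ n : ℕ, ChainBundleL.WSet (ChainBundleL.Q β n) →+ ChainBundleL.LSet β n,
        (∀ (n : ℕ) (F : ChainBundleL.QForm (ChainBundleL.Q β n)),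
          (∃ E : ChainBundleL.PoincareCx β n, ChainBundleL.IsFormCx F E) ∧
          ∀ E : ChainBundleL.PoincareCx β n, ChainBundleL.IsFormCx F E →
            Φ n (ChainBundleL.WSet.mk F) = ChainBundleL.LSet.mk E) ∧
        Function.Bijective (Φ 0) ∧
        (IsField A → ∀ n : ℕ, ∃ Ψ : ChainBundleL.LSet β n →+ ChainBundleL.WSet (ChainBundleL.Q β n),
          (∀ w, Ψ (Φ n w) = w) ∧
          ∀ E : ChainBundleL.PoincareCx β n, ∃ F : ChainBundleL.QForm (ChainBundleL.Q β n),
            ChainBundleL.IsCohomologyForm E F ∧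
            Ψ (ChainBundleL.LSet.mk E) = ChainBundleL.WSet.mk F) := by
  refine ⟨fun n => ChainBundleL.addCommGroupWSet, fun n => ChainBundleL.addCommGroupLSet,
    fun n F G => rfl, fun n E E' => rfl,
    fun n => ChainBundleL.wittToL β (Int.natCast_nonneg n), fun n F =>
      ⟨ChainBundleL.exists_isFormCx (Int.natCast_nonneg n) F, fun E h =>
        h.wittToL_mk (Int.natCast_nonneg n)⟩,
    ChainBundleL.wittToL_zero_bijective β le_rfl, fun hA n => ?_⟩
  -- A field is a semisimple ring, which is all that the splitting uses.
  letI := hA.toField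
  obtain ⟨Ψ, h1, h2⟩ :=
    ChainBundleL.exists_splitting_of_isSemisimpleRing (β := β) (Int.natCast_nonneg n)
  refine ⟨Ψ, h1, fun E => ?_⟩
  obtain ⟨F, hF⟩ := E.exists_cohomologyForm
  exact ⟨F, hF, h2 E F hF⟩
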